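/- Fix reals $\beta,\gamma\ge 0$, not both $0$, with $\beta\gamma<1$ (antiferromagnetic), $\lambda>0$, and $a,b,c\in\mathbb R$. For a finite graph $G=(V,E)$ and $\sigma:V\to\{0,1\}$ let $|\sigma|$ be the number of vertices of spin $1$, and let $m_0(\sigma),m_1(\sigma)$ be the numbers of edges whose endpoints both have spin $0$, respectively $1$. Let $\mu_G(\sigma)\propto\lambda^{|\sigma|}\beta^{m_0(\sigma)}\gamma^{m_1(\sigma)}$ (with $0^0=1$) be the Gibbs distribution and $o_G(\sigma)=a|\sigma|+b\,m_0(\sigma)+c\,m_1(\sigma)$ the $(a,b,c)$ vertex-edge observable. Assume that the observable is non-trivial on general graphs, i.e. none of the following holds: (i) $a=b=c=0$; (ii) $\beta=0$ and $a=c=0$; (iii) $\gamma=0$ and $a=b=0$; (iv) $\beta=\gamma$, $\lambda=1$ and $b+c=0$. Assume moreover that it is not the case that $\beta=\gamma$, $\lambda=1$, $a=0$ and $b=c$. If $\lambda\ne\frac{1-\beta}{1-\gamma}$, a field gadget is a finite tree rooted at a vertex $\rho$ of degree one. If $\lambda=\frac{1-\beta}{1-\gamma}$, a field gadget is a rooted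 graph obtained from such a tree by replacing some (at least one) of the leaves other than $\rho$ by distinct cycles of length four (identifying the leaf with a vertex of its cycle). The effective field and the observable gap of a field gadget $\mathcal T$ with root $\rho$ are, with $\mu=\mu_{\mathcal T}$, $$R_{\mathcal T}=\frac1\lambda\,\frac{\mu(\sigma_\rho=1)}{\mu(\sigma_\rho=0)},\qquad O_{\mathcal T}=\mathbf E_{\mu}[o_{\mathcal T}(\sigma)\mid\sigma_\rho=1]-a-\mathbf E_{\mu}[o_{\mathcal T}(\sigma)\mid\sigma_\rho=0].$$ Then there are constants $\hat R,\hat O,\Xi>0$, a constant $C$, a polynomial $p$ and a deterministic algorithm (depending on $\beta,\gamma,\lambda,a,b,c$) which, on input a rational $r\in(0,1/2)$, halts within time $p(\mathrm{bits}(r))$ and outputs a pair of field gadgets $\mathcal T_1,\mathcal T_2$, each with all degrees at most $3$ and with at most $C|\log r|$ vertices, such that $$|R_{\mathcal T_1}-\hat R|\le r,\quad |R_{\mathcal T_2}-\hat R|\le r,\quad |O_{\mathcal T_1}-O_{\mathcal T_2}|\ge\hat O,\quad |O_{\mathcal T_1}|\le\Xi,\quad |O_{\mathcal T_2}|\le\Xi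 .$$ Here $\mathrm{bits}(r)$ is the total bit length of the numerator and the denominator of $r$ in lowest terms. Time is counted on a random access machine with logarithmic cost (every operation is charged the bit lengths of its operands). The real parameters are accessible to the algorithm through approximations: when it asks for $x\in\{\beta,\gamma,\lambda\}$ with precision $n$, it receives some integer within distance $1$ of $2^n x$ and is charged at least $n$; the guarantees hold for all answers that are correct in this sense. -/

import Mathlib

/-! ### Antiferromagnetic 2-spin systems and vertex-edge observables -/

section SpinSystem

/-- The pair of edge activities `(β, γ)` is antiferromagnetic. -/
def Antiferromagnetic (β γ : ℝ) : Prop :=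
  0 ≤ β ∧ 0 ≤ γ ∧ β * γ < 1 ∧ (β ≠ 0 ∨ γ ≠ 0)

/-- The `(a, b, c)` vertex-edge observable is trivial on general graphs. -/
def TrivialOnGeneralGraphs (β γ lam a b c : ℝ) : Prop :=
  (a = 0 ∧ b = 0 ∧ c = 0) ∨ (β = 0 ∧ a = 0 ∧ c = 0) ∨ (γ = 0 ∧ a = 0 ∧ b = 0) ∨
    (β = γ ∧ lam = 1 ∧ b + c = 0)

/-- `|σ|`: the number of vertices of spin `1`. -/
noncomputable def numOnes {V : Type} (σ : V → Fin 2) : ℕ := {v | σ v = 1}.ncard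

/-- `m_i(σ)`: the number of edges both of whose endpoints have spin `i`. -/
noncomputable def monoEdges {V : Type} (G : SimpleGraph V) (i : Fin 2) (σ : V → Fin 2) : ℕ :=
  {e | e ∈ G.edgeSet ∧ ∀ v ∈ e, σ v = i}.ncard

/-- The weight `λ^|σ| β^{m₀(σ)} γ^{m₁(σ)}` (with `0 ^ 0 = 1`). -/
noncomputable def spinWeight {V : Type} (β γ lam : ℝ) (G : SimpleGraph V) (σ : V → Fin 2) : ℝ :=
  lam ^ numOnes σ * β ^ monoEdges G 0 σ * γ ^ monoEdges G 1 σ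

/-- The value `o_G(σ) = a |σ| + b m₀(σ) + c m₁(σ)` of the observable on a configuration. -/
noncomputable def obsValue {V : Type} (a b c : ℝ) (G : SimpleGraph V) (σ : V → Fin 2) : ℝ :=
  a * numOnes σ + b * monoEdges G 0 σ + c * monoEdges G 1 σ

variable {V : Type} [Fintype V] [DecidableEq V]

/-- The partition function. -/
noncomputable def partitionFn (β γ lam : ℝ) (G : SimpleGraph V) : ℝ :=
  ∑ σ : V → Fin 2, spinWeight β γ lam G σ

/-- The Gibbs distribution `μ_{G;β,γ,λ}`. -/
noncomputable def gibbs (β γ lam : ℝ) (G : SimpleGraph V) (σ : V → Fin 2) : ℝ :=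
  spinWeight β γ lam G σ / partitionFn β γ lam G

/-- `μ(σ_ρ = s)`. -/
noncomputable def spinProb (β γ lam : ℝ) (G : SimpleGraph V) (ρ : V) (s : Fin 2) : ℝ :=
  ∑ σ : V → Fin 2 with σ ρ = s, gibbs β γ lam G σ

/-- `E_{σ ∼ μ}[f(σ) | σ_ρ = s]`. -/
noncomputable def condExpSpin (β γ lam : ℝ) (G : SimpleGraph V) (ρ : V) (s : Fin 2)
    (f : (V → Fin 2) → ℝ) : ℝ :=
  (∑ σ : V → Fin 2 with σ ρ = s, gibbs β γ lam G σ * f σ) / spinProb β γ lam G ρ s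

/-- The effective field `R = (1/λ) μ(σ_ρ = 1) / μ(σ_ρ = 0)` of a graph `G` rooted at `ρ`. -/
noncomputable def effectiveField (β γ lam : ℝ) (G : SimpleGraph V) (ρ : V) : ℝ :=
  1 / lam * (spinProb β γ lam G ρ 1 / spinProb β γ lam G ρ 0)

/-- The observable gap `O = E[o(σ) | σ_ρ = 1] - a - E[o(σ) | σ_ρ = 0]` of a graph `G`
rooted at `ρ`. -/
noncomputable def observableGap (β γ lam a b c : ℝ) (G : SimpleGraph V) (ρ : V) : ℝ :=
  condExpSpin β γ lam G ρ 1 (obsValue a b c G) - a - condExpSpin β γ lam G ρ 0 (obsValue a b c G)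

end SpinSystem

/-! ### Field gadgets -/

section Gadgets

/-- A finite rooted graph, with vertex set `{0, …, n - 1}`. -/
structure RootedGraph where
  n : ℕ
  graph : SimpleGraph (Fin n)
  root : Fin n

/-- The adjacency relation of `attachFourCycles`. -/
def attachFourCyclesAdj {V : Type} (T : SimpleGraph V) (S : Set V) :
    V ⊕ (S × Fin 3) → V ⊕ (S × Fin 3) → Prop
  | .inl u, .inl v => T.Adj u v
  | .inl u, .inr (s, i) => u = s ∧ i ≠ 1
  | .inr (s, i), .inl u => u = s ∧ i ≠ 1
  | .inr (s, i), .inr (s', j) => s = s' ∧ (i.val + 1 = j.val ∨ j.val + 1 = i.val)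

/-- The graph obtained from `T` by identifying every vertex `s ∈ S` with a vertex of its own new
cycle of length four `s - (s,0) - (s,1) - (s,2) - s`. -/
def attachFourCycles {V : Type} (T : SimpleGraph V) (S : Set V) :
    SimpleGraph (V ⊕ (S × Fin 3)) where
  Adj := attachFourCyclesAdj T S
  symm := ⟨by
    rintro (u | ⟨s, i⟩) (v | ⟨s', j⟩) h
    · exact SimpleGraph.Adj.symm (G := T) h
    · exact h
    · exact h
    · exact ⟨h.1.symm, h.2.symm⟩⟩
  loopless := ⟨by
    rintro (u | ⟨s, i⟩) h
    · exact T.irrefl h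
    · have := h.2
      omega⟩

/-- Field gadgets. If `λ ≠ (1-β)/(1-γ)` these are the rooted trees whose root has degree one;
if `λ = (1-β)/(1-γ)` they are the graphs obtained from such a tree by replacing some of the leaves
(vertices of degree one other than the root) by distinct cycles of length four. (For
antiferromagnetic `(β, γ)` the two equations `λ = (1-β)/(1-γ)` and `λ (1-γ) = 1-β` say the same.) -/
def IsFieldGadget (β γ lam : ℝ) (T : RootedGraph) : Prop :=
  (lam * (1 - γ) ≠ 1 - β ∧ T.graph.IsTree ∧ (T.graph.neighborSet T.root).ncard = 1) ∨
  (lam * (1 - γ) = 1 - β ∧ ∃ (T₀ : RootedGraph) (S : Set (Fin T₀.n)),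
    T₀.graph.IsTree ∧ (T₀.graph.neighborSet T₀.root).ncard = 1 ∧ S.Nonempty ∧
    (∀ s ∈ S, s ≠ T₀.root ∧ (T₀.graph.neighborSet s).ncard = 1) ∧
    ∃ φ : T.graph ≃g attachFourCycles T₀.graph S, φ T.root = Sum.inl T₀.root)

/-- `L` is a listing of the rooted graph `T`: the endpoints of its edges, one edge after the other,
then the end mark `-1`, the number of vertices, and the root. -/
def IsListing (L : List ℤ) (T : RootedGraph) : Prop :=
  ∃ E : List (Fin T.n × Fin T.n),
    (∀ u v, T.graph.Adj u v ↔ (u, v) ∈ E ∨ (v, u) ∈ E) ∧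
    L = E.flatMap (fun e => [(e.1.val : ℤ), (e.2.val : ℤ)]) ++ [-1, (T.n : ℤ), (T.root.val : ℤ)]

end Gadgets

/-! ### Algorithms: random access machines with logarithmic cost

A program works on a memory whose cells hold integers (with indirect addressing) and writes
integers on an output tape. Every operation is charged the bit lengths of its operands, so that
running times are polynomially related to those of Turing machines. Real constants of the problem
are accessible only through approximations: a query for constant `j` with precision `2⁻ⁿ` returns
an integer and is charged at least `n`. -/

section Machine

/-- The bit length of an integer. -/
def bitLen (z : ℤ) : ℕ := z.natAbs.size

/-- `bits(r)` for a rational number in lowest terms. -/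
def ratBits (r : ℚ) : ℕ := bitLen r.num + bitLen r.den

/-- Expressions, over `k` real constants. -/
inductive RamExpr (k : ℕ) : Type where
  | const (z : ℤ)
  | load (addr : RamExpr k)
  | add (e₁ e₂ : RamExpr k)
  | sub (e₁ e₂ : RamExpr k)
  | mul (e₁ e₂ : RamExpr k)
  | div (e₁ e₂ : RamExpr k)
  | query (j : Fin k) (e : RamExpr k)

/-- Programs; a test succeeds when its expression is positive. -/
inductive RamProg (k : ℕ) : Type where
  | skip
  | store (addr e : RamExpr k)
  | emit (e : RamExpr k)
  | seq (p₁ p₂ : RamProg k)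
  | ite (e : RamExpr k) (p₁ p₂ : RamProg k)
  | loop (e : RamExpr k) (p : RamProg k)

/-- Memory and output tape. -/
structure RamState where
  mem : ℤ → ℤ
  out : List ℤ

/-- The value of an expression, where `name j n` answers the queries. -/
def RamExpr.eval {k : ℕ} (name : Fin k → ℕ → ℤ) (mem : ℤ → ℤ) : RamExpr k → ℤ
  | .const z => z
  | .load e => mem (e.eval name mem)
  | .add e₁ e₂ => e₁.eval name mem + e₂.eval name mem
  | .sub e₁ e₂ => e₁.eval name mem - e₂.eval name mem
  | .mul e₁ e₂ => e₁.eval name mem * e₂.eval name mem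
  | .div e₁ e₂ => e₁.eval name mem / e₂.eval name mem
  | .query j e => name j (e.eval name mem).toNat

/-- The cost of evaluating an expression. -/
def RamExpr.cost {k : ℕ} (name : Fin k → ℕ → ℤ) (mem : ℤ → ℤ) : RamExpr k → ℕ
  | .const z => 1 + bitLen z
  | .load e => e.cost name mem + 1 + bitLen (e.eval name mem) + bitLen (mem (e.eval name mem))
  | .add e₁ e₂ => e₁.cost name mem + e₂.cost name mem + 1 +
      bitLen (e₁.eval name mem) + bitLen (e₂.eval name mem)
  | .sub e₁ e₂ => e₁.cost name mem + e₂.cost name mem + 1 +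
      bitLen (e₁.eval name mem) + bitLen (e₂.eval name mem)
  | .mul e₁ e₂ => e₁.cost name mem + e₂.cost name mem + 1 +
      bitLen (e₁.eval name mem) + bitLen (e₂.eval name mem)
  | .div e₁ e₂ => e₁.cost name mem + e₂.cost name mem + 1 +
      bitLen (e₁.eval name mem) + bitLen (e₂.eval name mem)
  | .query j e => e.cost name mem + 1 + (e.eval name mem).natAbs +
      bitLen (name j (e.eval name mem).toNat)

/-- `RamExec name p s s' t`: started in state `s`, the program `p` halts in state `s'` after
time `t`. -/
inductive RamExec {k : ℕ} (name : Fin k → ℕ → ℤ) :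
    RamProg k → RamState → RamState → ℕ → Prop where
  | skip (s : RamState) : RamExec name .skip s s 1
  | store (addr e : RamExpr k) (s : RamState) :
      RamExec name (.store addr e) s
        ⟨Function.update s.mem (addr.eval name s.mem) (e.eval name s.mem), s.out⟩
        (addr.cost name s.mem + e.cost name s.mem + 1)
  | emit (e : RamExpr k) (s : RamState) :
      RamExec name (.emit e) s ⟨s.mem, s.out ++ [e.eval name s.mem]⟩ (e.cost name s.mem + 1)
  | seq (p₁ p₂ : RamProg k) (s₁ s₂ s₃ : RamState) (t₁ t₂ : ℕ) :
      RamExec name p₁ s₁ s₂ t₁ → RamExec name p₂ s₂ s₃ t₂ →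
      RamExec name (.seq p₁ p₂) s₁ s₃ (t₁ + t₂)
  | iteTrue (e : RamExpr k) (p₁ p₂ : RamProg k) (s s' : RamState) (t : ℕ) :
      0 < e.eval name s.mem → RamExec name p₁ s s' t →
      RamExec name (.ite e p₁ p₂) s s' (e.cost name s.mem + 1 + t)
  | iteFalse (e : RamExpr k) (p₁ p₂ : RamProg k) (s s' : RamState) (t : ℕ) :
      e.eval name s.mem ≤ 0 → RamExec name p₂ s s' t →
      RamExec name (.ite e p₁ p₂) s s' (e.cost name s.mem + 1 + t)
  | loopTrue (e : RamExpr k) (p : RamProg k) (s₁ s₂ s₃ : RamState) (t₁ t₂ : ℕ) :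
      0 < e.eval name s₁.mem → RamExec name p s₁ s₂ t₁ → RamExec name (.loop e p) s₂ s₃ t₂ →
      RamExec name (.loop e p) s₁ s₃ (e.cost name s₁.mem + 1 + t₁ + t₂)
  | loopFalse (e : RamExpr k) (p : RamProg k) (s : RamState) :
      e.eval name s.mem ≤ 0 →
      RamExec name (.loop e p) s s (e.cost name s.mem + 1)

/-- The initial state on a rational input: numerator and denominator in cells `0` and `1`, all
other cells `0`, empty output. -/
def ratInput (r : ℚ) : RamState :=
  ⟨fun i => if i = 0 then r.num else if i = 1 then (r.den : ℤ) else 0, []⟩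

/-- On input `r` the program halts within time `t` and its output is the list `L`. -/
def RamOutputs {k : ℕ} (name : Fin k → ℕ → ℤ) (p : RamProg k) (r : ℚ) (L : List ℤ) (t : ℕ) :
    Prop :=
  ∃ (s : RamState) (t' : ℕ), RamExec name p (ratInput r) s t' ∧ s.out = L ∧ t' ≤ t

/-- `name` answers queries about the real numbers `x j` correctly: the answer to the query with
precision `n` is an integer within distance `1` of `2ⁿ x j`. -/
def IsName {k : ℕ} (x : Fin k → ℝ) (name : Fin k → ℕ → ℤ) : Prop :=
  ∀ j n, |(name j n : ℝ) - 2 ^ n * x j| ≤ 1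

end Machine

/-! ### Partition functions of rooted graphs over a commutative ring -/

section RootedPartition

open Classical in
theorem numOnes_eq_sum {V : Type} [Fintype V] (σ : V → Fin 2) :
    numOnes σ = ∑ v, if σ v = 1 then 1 else 0 := by
  rw [numOnes, Set.ncard_eq_toFinset_card', Set.toFinset_ofPred, Finset.card_filter]

open Classical in
theorem two_mul_monoEdges {V : Type} [Fintype V] (G : SimpleGraph V) (i : Fin 2)
    (σ : V → Fin 2) :
    2 * monoEdges G i σ = ∑ u, ∑ v, if G.Adj u v ∧ σ u = i ∧ σ v = i then 1 else 0 := by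
  let H : SimpleGraph V :=
    { Adj := fun u v => G.Adj u v ∧ σ u = i ∧ σ v = i
      symm := ⟨fun u v h => ⟨h.1.symm, h.2.2, h.2.1⟩⟩
      loopless := ⟨fun u h => G.irrefl h.1⟩ }
  have h1 : {e | e ∈ G.edgeSet ∧ ∀ v ∈ e, σ v = i} = H.edgeSet := by
    ext e
    induction e with
    | _ u v => simp [H]
  have h2 := H.sum_degrees_eq_twice_card_edges
  rw [monoEdges, h1, ← SimpleGraph.coe_edgeFinset, Set.ncard_coe_finset, ← h2]
  refine Finset.sum_congr rfl fun u _ => ?_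
  rw [← SimpleGraph.card_neighborFinset_eq_degree, SimpleGraph.neighborFinset_eq_filter,
    Finset.card_filter]

open Classical in
theorem ncard_neighborSet_eq_sum {V : Type} [Fintype V] (G : SimpleGraph V) (u : V) :
    (G.neighborSet u).ncard = ∑ v, if G.Adj u v then 1 else 0 := by
  rw [Set.ncard_eq_toFinset_card', ← Finset.card_filter]
  congr 1
  ext v
  simp

/-- The part of the partition function with spin `s` at the vertex `r`, for parameters in a
commutative ring. -/
noncomputable def rootZ {A : Type} [CommRing A] (Λ B Γ : A) {V : Type} [Fintype V] [DecidableEq V]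
    (G : SimpleGraph V) (r : V) (s : Fin 2) : A :=
  ∑ σ : V → Fin 2 with σ r = s, Λ ^ numOnes σ * B ^ monoEdges G 0 σ * Γ ^ monoEdges G 1 σ

/-- The graph obtained by adding a new vertex `none`, adjacent to the vertices of `S`. -/
def attachRoot {V : Type} (G : SimpleGraph V) (S : Set V) : SimpleGraph (Option V) where
  Adj
    | none, none => False
    | none, some v => v ∈ S
    | some v, none => v ∈ S
    | some u, some v => G.Adj u v
  symm := ⟨by
    rintro (_ | u) (_ | v) h
    · exact h
    · exact h
    · exact h
    · exact SimpleGraph.Adj.symm (G := G) h⟩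
  loopless := ⟨by
    rintro (_ | u) h
    · exact h
    · exact G.irrefl h⟩

variable {V W : Type}

@[simp] theorem attachRoot_none_none (G : SimpleGraph V) (S : Set V) :
    ¬ (attachRoot G S).Adj none none := fun h => h

@[simp] theorem attachRoot_none_some (G : SimpleGraph V) (S : Set V) (v : V) :
    (attachRoot G S).Adj none (some v) ↔ v ∈ S := Iff.rfl

@[simp] theorem attachRoot_some_none (G : SimpleGraph V) (S : Set V) (v : V) :
    (attachRoot G S).Adj (some v) none ↔ v ∈ S := Iff.rfl

@[simp] theorem attachRoot_some_some (G : SimpleGraph V) (S : Set V) (u v : V) :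
    (attachRoot G S).Adj (some u) (some v) ↔ G.Adj u v := Iff.rfl

variable [Fintype V] [Fintype W]

theorem numOnes_option (σ : Option V → Fin 2) :
    numOnes σ = (σ none : ℕ) + numOnes (fun v => σ (some v)) := by
  rw [numOnes_eq_sum, numOnes_eq_sum, Fintype.sum_option]
  congr 1
  generalize σ none = x
  fin_cases x <;> simp

theorem numOnes_sum (σ : V ⊕ W → Fin 2) :
    numOnes σ = numOnes (fun v => σ (.inl v)) + numOnes (fun v => σ (.inr v)) := by
  simp only [numOnes_eq_sum, Fintype.sum_sum_type]

open Classical in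
theorem monoEdges_attachRoot (G : SimpleGraph V) (S : Set V) (i : Fin 2)
    (σ : Option V → Fin 2) :
    monoEdges (attachRoot G S) i σ =
      (∑ v, if v ∈ S ∧ σ none = i ∧ σ (some v) = i then 1 else 0) +
        monoEdges G i (fun v => σ (some v)) := by
  have h := two_mul_monoEdges (attachRoot G S) i σ
  have h' := two_mul_monoEdges G i (fun v => σ (some v))
  simp only [Fintype.sum_option, attachRoot_none_none, attachRoot_none_some,
    attachRoot_some_none, attachRoot_some_some, false_and, if_false, zero_add,
    Finset.sum_add_distrib, ← h'] at h
  have h2 : ∀ v, (v ∈ S ∧ σ (some v) = i ∧ σ none = i) ↔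
      (v ∈ S ∧ σ none = i ∧ σ (some v) = i) := fun v => by tauto
  simp only [h2] at h
  omega

theorem monoEdges_sum (G : SimpleGraph V) (H : SimpleGraph W) (i : Fin 2)
    (σ : V ⊕ W → Fin 2) :
    monoEdges (G ⊕g H) i σ =
      monoEdges G i (fun v => σ (.inl v)) + monoEdges H i (fun v => σ (.inr v)) := by
  classical
  have h := two_mul_monoEdges (G ⊕g H) i σ
  have h1 := two_mul_monoEdges G i (fun v => σ (.inl v))
  have h2 := two_mul_monoEdges H i (fun v => σ (.inr v))
  have h3 : ∀ v w, ¬ (G ⊕g H).Adj (.inr w) (.inl v) := by simp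
  simp only [Fintype.sum_sum_type, SimpleGraph.sum_adj_inl, SimpleGraph.sum_adj_inr,
    SimpleGraph.not_adj_sum_inl_inr, h3, false_and, if_false,
    Finset.sum_const_zero, add_zero, zero_add, ← h1, ← h2] at h
  omega

theorem monoEdges_attachRoot_single (G : SimpleGraph V) (r : V) (i : Fin 2)
    (σ : Option V → Fin 2) :
    monoEdges (attachRoot G {r}) i σ =
      (if σ none = i ∧ σ (some r) = i then 1 else 0) + monoEdges G i (fun v => σ (some v)) := by
  classical
  rw [monoEdges_attachRoot]
  simp [ite_and]

theorem monoEdges_attachRoot_pair (G : SimpleGraph V) (H : SimpleGraph W) (r : V) (s : W)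
    (i : Fin 2) (σ : Option (V ⊕ W) → Fin 2) :
    monoEdges (attachRoot (G ⊕g H) {.inl r, .inr s}) i σ =
      (if σ none = i ∧ σ (some (.inl r)) = i then 1 else 0) +
      (if σ none = i ∧ σ (some (.inr s)) = i then 1 else 0) +
      (monoEdges G i (fun v => σ (some (.inl v))) +
        monoEdges H i (fun v => σ (some (.inr v)))) := by
  classical
  rw [monoEdges_attachRoot, monoEdges_sum]
  simp [ite_and]

theorem numOnes_equiv (e : V ≃ W) (σ : W → Fin 2) : numOnes (σ ∘ e) = numOnes σ := by
  classical
  rw [numOnes_eq_sum, numOnes_eq_sum]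
  exact e.sum_comp (fun w => if σ w = 1 then 1 else 0)

theorem monoEdges_iso {G : SimpleGraph V} {H : SimpleGraph W} (e : G ≃g H) (i : Fin 2)
    (σ : W → Fin 2) : monoEdges G i (σ ∘ e) = monoEdges H i σ := by
  classical
  have h := two_mul_monoEdges G i (σ ∘ e)
  have h' := two_mul_monoEdges H i σ
  rw [← e.toEquiv.sum_comp] at h'
  have : ∀ u, (∑ v, if H.Adj (e.toEquiv u) v ∧ σ (e.toEquiv u) = i ∧ σ v = i then 1 else 0) =
      ∑ v, if G.Adj u v ∧ (σ ∘ e) u = i ∧ (σ ∘ e) v = i then 1 else 0 := by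
    intro u
    rw [← e.toEquiv.sum_comp]
    refine Finset.sum_congr rfl fun v _ => ?_
    simp [e.map_adj_iff]
  simp only [this] at h'
  omega

variable [DecidableEq V] [DecidableEq W] {A : Type} [CommRing A]

theorem sum_option_fun (f : (Option V → Fin 2) → A) (s : Fin 2) :
    ∑ σ : Option V → Fin 2 with σ none = s, f σ =
      ∑ τ : V → Fin 2, f (fun o => o.elim s τ) := by
  refine Finset.sum_bij' (fun σ _ v => σ (some v)) (fun τ _ o => o.elim s τ) ?_ ?_ ?_ ?_ ?_
  · simp
  · simp
  · intro σ hσ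
    simp only [Finset.mem_filter, Finset.mem_univ, true_and] at hσ
    funext o
    cases o <;> simp [hσ]
  · simp
  · intro σ hσ
    simp only [Finset.mem_filter, Finset.mem_univ, true_and] at hσ
    congr 1
    funext o
    cases o <;> simp [hσ]

theorem sum_fun_eq_sum_root (f : (V → Fin 2) → A) (r : V) :
    ∑ σ : V → Fin 2, f σ = ∑ t : Fin 2, ∑ σ : V → Fin 2 with σ r = t, f σ :=
  (Finset.sum_fiberwise _ _ _).symm

/-- The edge activity between the spins `s` and `t`. -/
def edgeAct (B Γ : A) (s t : Fin 2) : A :=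
  (if s = 0 ∧ t = 0 then B else 1) * (if s = 1 ∧ t = 1 then Γ else 1)

theorem pow_edge (B Γ : A) (s t : Fin 2) :
    B ^ (if s = 0 ∧ t = 0 then 1 else 0) * Γ ^ (if s = 1 ∧ t = 1 then 1 else 0) =
      edgeAct B Γ s t := by
  unfold edgeAct
  split_ifs <;> simp

theorem rootZ_attachRoot_single (Λ B Γ : A) (G : SimpleGraph V) (r : V) (s : Fin 2) :
    rootZ Λ B Γ (attachRoot G {r}) none s =
      Λ ^ (s : ℕ) * ∑ t, edgeAct B Γ s t * rootZ Λ B Γ G r t := by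
  simp only [rootZ]
  rw [sum_option_fun, sum_fun_eq_sum_root _ r, Finset.mul_sum]
  refine Finset.sum_congr rfl fun t _ => ?_
  rw [Finset.mul_sum, Finset.mul_sum]
  refine Finset.sum_congr rfl fun τ hτ => ?_
  simp only [Finset.mem_filter, Finset.mem_univ, true_and] at hτ
  rw [numOnes_option, monoEdges_attachRoot_single, monoEdges_attachRoot_single]
  simp only [Option.elim, hτ, pow_add, ← pow_edge B Γ s t]
  ring

theorem rootZ_attachRoot_pair (Λ B Γ : A) (G : SimpleGraph V) (H : SimpleGraph W) (r : V) (r' : W)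
    (s : Fin 2) :
    rootZ Λ B Γ (attachRoot (G ⊕g H) {.inl r, .inr r'}) none s =
      Λ ^ (s : ℕ) * (∑ t, edgeAct B Γ s t * rootZ Λ B Γ G r t) *
        ∑ t, edgeAct B Γ s t * rootZ Λ B Γ H r' t := by
  simp only [rootZ]
  rw [sum_option_fun, ← (Equiv.sumArrowEquivProdArrow V W (Fin 2)).symm.sum_comp,
    Fintype.sum_prod_type]
  have key : ∀ (σ : V → Fin 2) (τ : W → Fin 2),
      (Λ ^ numOnes (fun o : Option (V ⊕ W) => o.elim s (Sum.elim σ τ)) *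
        B ^ monoEdges (attachRoot (G ⊕g H) {.inl r, .inr r'}) 0
          (fun o => o.elim s (Sum.elim σ τ)) *
        Γ ^ monoEdges (attachRoot (G ⊕g H) {.inl r, .inr r'}) 1
          (fun o => o.elim s (Sum.elim σ τ))) =
      Λ ^ (s : ℕ) *
        (edgeAct B Γ s (σ r) * (Λ ^ numOnes σ * B ^ monoEdges G 0 σ * Γ ^ monoEdges G 1 σ)) *
        (edgeAct B Γ s (τ r') *
          (Λ ^ numOnes τ * B ^ monoEdges H 0 τ * Γ ^ monoEdges H 1 τ)) := by
    intro σ τ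
    rw [numOnes_option, numOnes_sum, monoEdges_attachRoot_pair, monoEdges_attachRoot_pair]
    simp only [Option.elim, Sum.elim_inl, Sum.elim_inr, pow_add, ← pow_edge B Γ s]
    ac_rfl
  have e : ∀ (X : Type) [Fintype X] [DecidableEq X] (K : SimpleGraph X) (x : X),
      (∑ t, edgeAct B Γ s t * ∑ σ : X → Fin 2 with σ x = t,
        Λ ^ numOnes σ * B ^ monoEdges K 0 σ * Γ ^ monoEdges K 1 σ) =
      ∑ σ : X → Fin 2, edgeAct B Γ s (σ x) *
        (Λ ^ numOnes σ * B ^ monoEdges K 0 σ * Γ ^ monoEdges K 1 σ) := by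
    intro X _ _ K x
    rw [sum_fun_eq_sum_root _ x]
    refine Finset.sum_congr rfl fun t _ => ?_
    rw [Finset.mul_sum]
    refine Finset.sum_congr rfl fun τ hτ => ?_
    simp only [Finset.mem_filter, Finset.mem_univ, true_and] at hτ
    rw [hτ]
  rw [e, e, mul_assoc, Finset.sum_mul_sum, Finset.mul_sum]
  refine Finset.sum_congr rfl fun σ _ => ?_
  rw [Finset.mul_sum]
  refine Finset.sum_congr rfl fun τ _ => ?_
  rw [← mul_assoc]
  exact key σ τ

theorem rootZ_iso (Λ B Γ : A) {G : SimpleGraph V} {H : SimpleGraph W} (e : G ≃g H) (r : V)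
    (s : Fin 2) : rootZ Λ B Γ G r s = rootZ Λ B Γ H (e r) s := by
  simp only [rootZ, Finset.sum_filter]
  rw [← (Equiv.arrowCongr e.toEquiv (Equiv.refl (Fin 2))).symm.sum_comp]
  refine Finset.sum_congr rfl fun σ _ => ?_
  have : (Equiv.arrowCongr e.toEquiv (Equiv.refl (Fin 2))).symm σ = σ ∘ e := rfl
  rw [this, show numOnes (σ ∘ e) = numOnes σ from numOnes_equiv e.toEquiv σ, monoEdges_iso,
    monoEdges_iso]
  rfl

end RootedPartition

section DualPartition

open DualNumber TrivSqZeroExt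

variable {V : Type} [Fintype V] [DecidableEq V]

/-- The number `x` with logarithmic derivative `d`, as a dual number. -/
def dualExp (x d : ℝ) : ℝ[ε] := (x, x * d)

@[simp] theorem fst_dualExp (x d : ℝ) : fst (dualExp x d) = x := rfl

@[simp] theorem snd_dualExp (x d : ℝ) : snd (dualExp x d) = x * d := rfl

theorem dualExp_mul (x d y e : ℝ) : dualExp x d * dualExp y e = dualExp (x * y) (d + e) := by
  ext
  · simp
  · simp
    ring

theorem dualExp_pow (x d : ℝ) (n : ℕ) : dualExp x d ^ n = dualExp (x ^ n) (d * n) := by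
  induction n with
  | zero => ext <;> simp
  | succ n ih => rw [pow_succ, ih, dualExp_mul, pow_succ]; push_cast; ring_nf

theorem fst_sum' {ι : Type} (s : Finset ι) (f : ι → ℝ[ε]) :
    fst (∑ i ∈ s, f i) = ∑ i ∈ s, fst (f i) :=
  map_sum (fstHom ℝ ℝ ℝ) f s

theorem snd_sum' {ι : Type} (s : Finset ι) (f : ι → ℝ[ε]) :
    snd (∑ i ∈ s, f i) = ∑ i ∈ s, snd (f i) :=
  map_sum (sndHom ℝ ℝ) f s

variable (β γ lam a b c : ℝ)

theorem rootZ_dual (G : SimpleGraph V) (r : V) (s : Fin 2) :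
    rootZ (dualExp lam a) (dualExp β b) (dualExp γ c) G r s =
      inl (∑ σ : V → Fin 2 with σ r = s, spinWeight β γ lam G σ) +
        inr (∑ σ : V → Fin 2 with σ r = s, spinWeight β γ lam G σ * obsValue a b c G σ) := by
  have h : ∀ σ : V → Fin 2, dualExp lam a ^ numOnes σ * dualExp β b ^ monoEdges G 0 σ *
      dualExp γ c ^ monoEdges G 1 σ = dualExp (spinWeight β γ lam G σ) (obsValue a b c G σ) := by
    intro σ
    rw [dualExp_pow, dualExp_pow, dualExp_pow, dualExp_mul, dualExp_mul]
    rfl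
  simp only [rootZ, h]
  apply TrivSqZeroExt.ext
  · simp [fst_sum']
  · simp [snd_sum']

theorem effectiveField_eq (G : SimpleGraph V) (r : V) (hZ : partitionFn β γ lam G ≠ 0) :
    effectiveField β γ lam G r = 1 / lam *
      ((∑ σ : V → Fin 2 with σ r = 1, spinWeight β γ lam G σ) /
        ∑ σ : V → Fin 2 with σ r = 0, spinWeight β γ lam G σ) := by
  unfold effectiveField spinProb gibbs
  rw [← Finset.sum_div, ← Finset.sum_div, div_div_div_cancel_right₀ hZ]

theorem condExpSpin_eq (G : SimpleGraph V) (r : V) (s : Fin 2) (f : (V → Fin 2) → ℝ)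
    (hZ : partitionFn β γ lam G ≠ 0) :
    condExpSpin β γ lam G r s f =
      (∑ σ : V → Fin 2 with σ r = s, spinWeight β γ lam G σ * f σ) /
        ∑ σ : V → Fin 2 with σ r = s, spinWeight β γ lam G σ := by
  unfold condExpSpin spinProb gibbs
  simp only [div_mul_eq_mul_div]
  rw [← Finset.sum_div, ← Finset.sum_div, div_div_div_cancel_right₀ hZ]

/-- `x` and `o` are the field and the gap at the vertex `r`: the dual partition functions with
the two spins at `r` are in the ratio of `lam x` to `1`. -/
structure HasField (G : SimpleGraph V) (r : V) (x o : ℝ) : Prop where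
  pos : 0 < fst (rootZ (dualExp lam a) (dualExp β b) (dualExp γ c) G r 0)
  ratio : rootZ (dualExp lam a) (dualExp β b) (dualExp γ c) G r 1 =
    dualExp lam a * dualExp x o * rootZ (dualExp lam a) (dualExp β b) (dualExp γ c) G r 0

variable {β γ lam a b c}

theorem HasField.spec {G : SimpleGraph V} {r : V} {x o : ℝ} (hlam : 0 < lam) (hx : 0 < x)
    (h : HasField β γ lam a b c G r x o) :
    effectiveField β γ lam G r = x ∧ observableGap β γ lam a b c G r = o := by
  obtain ⟨h0, h1⟩ := h
  rw [rootZ_dual] at h0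
  rw [rootZ_dual, rootZ_dual] at h1
  set Z0 := ∑ σ : V → Fin 2 with σ r = 0, spinWeight β γ lam G σ with hZ0
  set Z1 := ∑ σ : V → Fin 2 with σ r = 1, spinWeight β γ lam G σ with hZ1
  set N0 := ∑ σ : V → Fin 2 with σ r = 0, spinWeight β γ lam G σ * obsValue a b c G σ with hN0
  set N1 := ∑ σ : V → Fin 2 with σ r = 1, spinWeight β γ lam G σ * obsValue a b c G σ with hN1
  simp only [fst_add, fst_inl, fst_inr, add_zero] at h0
  have e1 : Z1 = lam * x * Z0 := by
    have := congrArg fst h1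
    simpa using this
  have e2 : N1 = lam * x * N0 + (lam * (x * o) + lam * a * x) * Z0 := by
    have := congrArg snd h1
    simp at this
    linarith
  have hZ : partitionFn β γ lam G ≠ 0 := by
    have : partitionFn β γ lam G = Z0 + Z1 := by
      rw [partitionFn, sum_fun_eq_sum_root _ r, Fin.sum_univ_two]
    rw [this, e1]
    positivity
  constructor
  · rw [effectiveField_eq _ _ _ _ _ hZ, ← hZ0, ← hZ1, e1]
    field_simp
  · unfold observableGap
    rw [condExpSpin_eq _ _ _ _ _ _ _ hZ, condExpSpin_eq _ _ _ _ _ _ _ hZ, ← hZ0, ← hZ1, ← hN0,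
      ← hN1, e1, e2]
    field_simp
    ring

variable {W : Type} [Fintype W] [DecidableEq W]

/-- The field of a vertex with one child with field `x`. -/
noncomputable def fieldStep (β γ lam x : ℝ) : ℝ := (1 + γ * (lam * x)) / (β + lam * x)

/-- The gap of a vertex with one child with field `x` and gap `o`. -/
noncomputable def gapStep (β γ lam a b c x o : ℝ) : ℝ :=
  -((1 - β * γ) * (lam * x) / ((β + lam * x) * (1 + γ * (lam * x)))) * (o + a) +
    (-b * β / (β + lam * x) + c * γ * (lam * x) / (1 + γ * (lam * x)))

theorem childSum_ratio {G : SimpleGraph V} {r : V} {x o : ℝ} (hβ : 0 ≤ β) (hγ : 0 ≤ γ)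
    (hlam : 0 < lam) (hx : 0 < x) (h : HasField β γ lam a b c G r x o) :
    0 < fst (∑ t, edgeAct (dualExp β b) (dualExp γ c) 0 t *
        rootZ (dualExp lam a) (dualExp β b) (dualExp γ c) G r t) ∧
    (∑ t, edgeAct (dualExp β b) (dualExp γ c) 1 t *
        rootZ (dualExp lam a) (dualExp β b) (dualExp γ c) G r t) =
      dualExp (fieldStep β γ lam x) (gapStep β γ lam a b c x o) *
      ∑ t, edgeAct (dualExp β b) (dualExp γ c) 0 t *
        rootZ (dualExp lam a) (dualExp β b) (dualExp γ c) G r t := by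
  obtain ⟨h0, h1⟩ := h
  simp only [Fin.sum_univ_two, h1]
  set Z := rootZ (dualExp lam a) (dualExp β b) (dualExp γ c) G r 0
  have hy : 0 < lam * x := by positivity
  constructor
  · simp only [edgeAct]
    simp
    positivity
  · have key : edgeAct (dualExp β b) (dualExp γ c) 1 0 +
        edgeAct (dualExp β b) (dualExp γ c) 1 1 * (dualExp lam a * dualExp x o) =
        dualExp (fieldStep β γ lam x) (gapStep β γ lam a b c x o) *
        (edgeAct (dualExp β b) (dualExp γ c) 0 0 +
        edgeAct (dualExp β b) (dualExp γ c) 0 1 * (dualExp lam a * dualExp x o)) := by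
      have p1 : 0 < β + lam * x := by positivity
      have p2 : 0 < 1 + γ * (lam * x) := by positivity
      apply TrivSqZeroExt.ext
      · simp only [edgeAct]
        simp [fieldStep]
        field_simp
      · simp only [edgeAct]
        simp [fieldStep, gapStep]
        field_simp
        ring
    linear_combination key * Z

theorem HasField.single {G : SimpleGraph V} {r : V} {x o : ℝ} (hβ : 0 ≤ β) (hγ : 0 ≤ γ)
    (hlam : 0 < lam) (hx : 0 < x) (h : HasField β γ lam a b c G r x o) :
    HasField β γ lam a b c (attachRoot G {r}) none (fieldStep β γ lam x)
      (gapStep β γ lam a b c x o) := by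
  obtain ⟨h0, h1⟩ := childSum_ratio hβ hγ hlam hx h
  constructor
  · rw [rootZ_attachRoot_single]
    simpa using h0
  · rw [rootZ_attachRoot_single, rootZ_attachRoot_single, h1]
    simp
    ring

theorem HasField.pair {G : SimpleGraph V} {H : SimpleGraph W} {r : V} {r' : W} {x o x' o' : ℝ}
    (hβ : 0 ≤ β) (hγ : 0 ≤ γ) (hlam : 0 < lam) (hx : 0 < x) (hx' : 0 < x')
    (h : HasField β γ lam a b c G r x o) (h' : HasField β γ lam a b c H r' x' o') :
    HasField β γ lam a b c (attachRoot (G ⊕g H) {.inl r, .inr r'}) none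
      (fieldStep β γ lam x * fieldStep β γ lam x')
      (gapStep β γ lam a b c x o + gapStep β γ lam a b c x' o') := by
  obtain ⟨h0, h1⟩ := childSum_ratio hβ hγ hlam hx h
  obtain ⟨h0', h1'⟩ := childSum_ratio hβ hγ hlam hx' h'
  constructor
  · rw [rootZ_attachRoot_pair]
    simpa using mul_pos h0 h0'
  · rw [rootZ_attachRoot_pair, rootZ_attachRoot_pair, h1, h1', ← dualExp_mul]
    simp
    ring

theorem HasField.of_iso {G : SimpleGraph V} {H : SimpleGraph W} {r : V} {x o : ℝ} (e : G ≃g H)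
    (h : HasField β γ lam a b c G r x o) : HasField β γ lam a b c H (e r) x o := by
  obtain ⟨h0, h1⟩ := h
  rw [rootZ_iso _ _ _ e] at h0
  rw [rootZ_iso _ _ _ e, rootZ_iso _ _ _ e] at h1
  exact ⟨h0, h1⟩

end DualPartition

/-! ### Numbered rooted graphs and binary gadgets -/

/-- A finite rooted graph with a numbering of its vertices and a list of its edges. -/
structure NumberedGraph where
  V : Type
  [fintype : Fintype V]
  [decEq : DecidableEq V]
  graph : SimpleGraph V
  root : V
  size : ℕ
  num : V ≃ Fin size
  edges : List (V × V)
  adj_iff : ∀ u v, graph.Adj u v ↔ (u, v) ∈ edges ∨ (v, u) ∈ edges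
  num_root : (num root : ℕ) = 0

attribute [instance] NumberedGraph.fintype NumberedGraph.decEq

namespace NumberedGraph

/-- Add a new root, adjacent to the old one. -/
abbrev single (P : NumberedGraph) : NumberedGraph where
  V := Option P.V
  graph := attachRoot P.graph {P.root}
  root := none
  size := P.size + 1
  num := (Equiv.optionCongr P.num).trans (finSuccEquiv P.size).symm
  edges := (none, some P.root) :: P.edges.map fun e => (some e.1, some e.2)
  adj_iff := by
    rintro (_ | u) (_ | v) <;> simp [P.adj_iff]
  num_root := by simp

/-- Add a new root, adjacent to the roots of two disjoint graphs. -/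
abbrev pair (P Q : NumberedGraph) : NumberedGraph where
  V := Option (P.V ⊕ Q.V)
  graph := attachRoot (P.graph ⊕g Q.graph) {.inl P.root, .inr Q.root}
  root := none
  size := P.size + Q.size + 1
  num := (Equiv.optionCongr ((Equiv.sumCongr P.num Q.num).trans finSumFinEquiv)).trans
    (finSuccEquiv (P.size + Q.size)).symm
  edges := ((none, some (.inl P.root)) ::
    P.edges.map fun e => (some (.inl e.1), some (.inl e.2))) ++
    ((none, some (.inr Q.root)) :: Q.edges.map fun e => (some (.inr e.1), some (.inr e.2)))
  adj_iff := by
    rintro (_ | u | u) (_ | v | v) <;> simp [P.adj_iff, Q.adj_iff]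
  num_root := by simp

/-- The rooted graph on `{0, …, n - 1}` obtained from the numbering. -/
abbrev toRooted (P : NumberedGraph) : RootedGraph where
  n := P.size
  graph := P.graph.comap P.num.symm
  root := P.num P.root

/-- The isomorphism with the rooted graph on numbers. -/
def isoRooted (P : NumberedGraph) : P.graph ≃g P.toRooted.graph :=
  (SimpleGraph.Iso.comap P.num.symm P.graph).symm

@[simp] theorem isoRooted_root (P : NumberedGraph) : P.isoRooted P.root = P.toRooted.root := rfl

/-- The list of the endpoints of the edges, as numbers. -/
def numEdges (P : NumberedGraph) : List (ℕ × ℕ) :=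
  P.edges.map fun e => ((P.num e.1 : ℕ), (P.num e.2 : ℕ))

/-- The listing of a list of edges, a number of vertices, and the root `0`. -/
def _root_.edgeListing (E : List (ℕ × ℕ)) : List ℤ :=
  E.flatMap fun e => [(e.1 : ℤ), (e.2 : ℤ)]

theorem isListing (P : NumberedGraph) :
    IsListing (edgeListing P.numEdges ++ [-1, (P.size : ℤ), 0]) P.toRooted := by
  refine ⟨P.edges.map fun e => (P.num e.1, P.num e.2), fun u v => ?_, ?_⟩
  · change P.graph.Adj (P.num.symm u) (P.num.symm v) ↔ _
    rw [P.adj_iff]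
    have : ∀ u v, (P.num.symm u, P.num.symm v) ∈ P.edges ↔
        (u, v) ∈ P.edges.map fun e => (P.num e.1, P.num e.2) := by
      intro u v
      simp only [List.mem_map, Prod.mk.injEq, Prod.exists]
      constructor
      · intro h
        exact ⟨_, _, h, by simp, by simp⟩
      · rintro ⟨a, b, h, rfl, rfl⟩
        simpa using h
    rw [this, this]
  · have h0 : (P.toRooted.root.val : ℤ) = 0 := by
      change ((P.num P.root : ℕ) : ℤ) = 0
      rw [P.num_root]
      rfl
    rw [h0, edgeListing, numEdges, List.flatMap_map, List.flatMap_map]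

/-- The degree of a vertex. -/
noncomputable def deg (P : NumberedGraph) (v : P.V) : ℕ := (P.graph.neighborSet v).ncard

theorem deg_toRooted (P : NumberedGraph) (v : P.V) :
    (P.toRooted.graph.neighborSet (P.isoRooted v)).ncard = P.deg v := by
  rw [deg, ← Nat.card_coe_set_eq, ← Nat.card_coe_set_eq]
  exact (Nat.card_congr (P.isoRooted.mapNeighborSet v)).symm

theorem deg_single_none (P : NumberedGraph) : P.single.deg none = 1 := by
  classical
  unfold deg
  rw [ncard_neighborSet_eq_sum]
  change ∑ v : Option P.V, (if (attachRoot P.graph {P.root}).Adj none v then 1 else 0) = 1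
  rw [Fintype.sum_option]
  simp

theorem deg_single_some (P : NumberedGraph) (v : P.V) :
    P.single.deg (some v) = P.deg v + if v = P.root then 1 else 0 := by
  classical
  unfold deg
  rw [ncard_neighborSet_eq_sum, ncard_neighborSet_eq_sum]
  change ∑ w : Option P.V, (if (attachRoot P.graph {P.root}).Adj (some v) w then 1 else 0) = _
  rw [Fintype.sum_option]
  simp [add_comm]

theorem deg_pair_none (P Q : NumberedGraph) : (P.pair Q).deg none = 2 := by
  classical
  unfold deg
  rw [ncard_neighborSet_eq_sum]
  change ∑ v : Option (P.V ⊕ Q.V),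
    (if (attachRoot (P.graph ⊕g Q.graph) {.inl P.root, .inr Q.root}).Adj none v then 1 else 0) = 2
  rw [Fintype.sum_option, Fintype.sum_sum_type]
  simp

theorem deg_pair_inl (P Q : NumberedGraph) (v : P.V) :
    (P.pair Q).deg (some (.inl v)) = P.deg v + if v = P.root then 1 else 0 := by
  classical
  unfold deg
  rw [ncard_neighborSet_eq_sum, ncard_neighborSet_eq_sum]
  change ∑ w : Option (P.V ⊕ Q.V), (if (attachRoot (P.graph ⊕g Q.graph)
    {.inl P.root, .inr Q.root}).Adj (some (.inl v)) w then 1 else 0) = _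
  rw [Fintype.sum_option, Fintype.sum_sum_type]
  simp [add_comm]

theorem deg_pair_inr (P Q : NumberedGraph) (v : Q.V) :
    (P.pair Q).deg (some (.inr v)) = Q.deg v + if v = Q.root then 1 else 0 := by
  classical
  unfold deg
  rw [ncard_neighborSet_eq_sum, ncard_neighborSet_eq_sum]
  change ∑ w : Option (P.V ⊕ Q.V), (if (attachRoot (P.graph ⊕g Q.graph)
    {.inl P.root, .inr Q.root}).Adj (some (.inr v)) w then 1 else 0) = _
  rw [Fintype.sum_option, Fintype.sum_sum_type]
  simp [add_comm]

end NumberedGraph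

section Trees

theorem connected_of_reachable {V : Type} {G : SimpleGraph V} (r : V)
    (h : ∀ v, G.Reachable r v) : G.Connected :=
  { preconnected := fun u v => (h u).symm.trans (h v)
    nonempty := ⟨r⟩ }

theorem card_edgeSet_eq_monoEdges {V : Type} (G : SimpleGraph V) :
    Nat.card G.edgeSet = monoEdges G 0 fun _ => 0 := by
  rw [monoEdges, Nat.card_coe_set_eq]
  simp

variable {V W : Type} [Fintype V] [Fintype W]

/-- Embedding of a graph as a subgraph away from an attached root. -/
def someHom (G : SimpleGraph V) (S : Set V) : G →g attachRoot G S :=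
  ⟨some, fun h => h⟩

theorem isTree_single {G : SimpleGraph V} (r : V) (h : G.IsTree) :
    (attachRoot G {r}).IsTree := by
  rw [SimpleGraph.isTree_iff_connected_and_card] at h ⊢
  obtain ⟨hc, hn⟩ := h
  have hr : (attachRoot G {r}).Reachable none (some r) :=
    SimpleGraph.Adj.reachable (by simp)
  constructor
  · refine connected_of_reachable none fun v => ?_
    cases v with
    | none => exact SimpleGraph.Reachable.refl _
    | some v => exact hr.trans ((hc.preconnected r v).map (someHom G {r}))
  · rw [card_edgeSet_eq_monoEdges] at hn ⊢
    rw [monoEdges_attachRoot_single, Finite.card_option, ← hn]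
    simp
    omega

theorem isTree_pair {G : SimpleGraph V} {H : SimpleGraph W} (r : V) (s : W) (hG : G.IsTree)
    (hH : H.IsTree) : (attachRoot (G ⊕g H) {.inl r, .inr s}).IsTree := by
  rw [SimpleGraph.isTree_iff_connected_and_card] at hG hH ⊢
  obtain ⟨hc, hn⟩ := hG
  obtain ⟨hc', hn'⟩ := hH
  set K := attachRoot (G ⊕g H) {.inl r, .inr s}
  have hr : K.Reachable none (some (.inl r)) := SimpleGraph.Adj.reachable (by simp [K])
  have hs : K.Reachable none (some (.inr s)) := SimpleGraph.Adj.reachable (by simp [K])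
  constructor
  · refine connected_of_reachable none fun v => ?_
    rcases v with _ | v | v
    · exact SimpleGraph.Reachable.refl _
    · exact hr.trans (((hc.preconnected r v).map
        (SimpleGraph.Embedding.sumInl (G := G) (H := H)).toHom).map (someHom (G ⊕g H) _))
    · exact hs.trans (((hc'.preconnected s v).map
        (SimpleGraph.Embedding.sumInr (G := G) (H := H)).toHom).map (someHom (G ⊕g H) _))
  · rw [card_edgeSet_eq_monoEdges] at hn hn' ⊢
    rw [monoEdges_attachRoot_pair, Finite.card_option, Nat.card_sum, ← hn, ← hn']
    simp
    omega

end Trees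

/-! ### Binary gadgets -/

/-- Shapes of binary gadgets: a vertex with at most two children, each of them a gadget. -/
inductive Gad : Type
  | leaf
  | un (t : Gad)
  | bin (s t : Gad)

namespace Gad

/-- The number of vertices, when leaves have `k` vertices. -/
def size (k : ℕ) : Gad → ℕ
  | leaf => k
  | un t => t.size k + 1
  | bin s t => s.size k + t.size k + 1

/-- The edges of a gadget with numbered vertices, when its root has number `s` and is attached to
the vertex `p`, and leaves have `k` vertices and edges `E`. -/
def code (k : ℕ) (E : List (ℕ × ℕ)) : Gad → ℕ → ℕ → List (ℕ × ℕ)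
  | leaf, p, s => (p, s) :: E.map fun e => (s + e.1, s + e.2)
  | un t, p, s => (p, s) :: t.code k E s (s + 1)
  | bin t u, p, s => (p, s) :: (t.code k E s (s + 1) ++ u.code k E s (s + t.size k + 1))

/-- The graph of a gadget, with leaves of a given form. -/
def graph (B : NumberedGraph) : Gad → NumberedGraph
  | leaf => B
  | un t => (t.graph B).single
  | bin s t => (s.graph B).pair (t.graph B)

/-- The gadget with its root edge. -/
abbrev rooted (B : NumberedGraph) (t : Gad) : RootedGraph := ((un t).graph B).toRooted

theorem size_graph (B : NumberedGraph) (t : Gad) : (t.graph B).size = t.size B.size := by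
  induction t with
  | leaf => rfl
  | un t ih => simp [graph, size, ih]
  | bin s t ih ih' => simp [graph, size, ih, ih']

theorem code_eq (B : NumberedGraph) (t : Gad) (p s : ℕ) :
    t.code B.size B.numEdges p s =
      (p, s) :: (t.graph B).numEdges.map fun e => (s + e.1, s + e.2) := by
  induction t generalizing p s with
  | leaf => rfl
  | un t ih =>
    simp only [code, graph, ih]
    simp [NumberedGraph.numEdges, (t.graph B).num_root, Function.comp_def]
    intros; omega
  | bin t u ih ih' =>
    simp only [code, graph, ih, ih']
    simp [NumberedGraph.numEdges, (t.graph B).num_root, (u.graph B).num_root, Function.comp_def,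
      size_graph]
    simp only [add_assoc, add_comm 1]

theorem isListing_rooted (B : NumberedGraph) (t : Gad) :
    IsListing (edgeListing (t.code B.size B.numEdges 0 1) ++
        [-1, (((un t).size B.size : ℕ) : ℤ), 0])
      (t.rooted B) := by
  have h := ((un t).graph B).isListing
  rw [size_graph] at h
  convert h using 3
  · have := code_eq B (un t) 0 0
    simpa [code] using this

theorem rooted_n (B : NumberedGraph) (t : Gad) : (t.rooted B).n = t.size B.size + 1 := by
  change ((un t).graph B).size = _
  rw [size_graph, size]

theorem deg_le (B : NumberedGraph) (hB : B.deg B.root ≤ 2) (hB' : ∀ v, B.deg v ≤ 3) (t : Gad) :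
    (t.graph B).deg (t.graph B).root ≤ 2 ∧ ∀ v, (t.graph B).deg v ≤ 3 := by
  induction t with
  | leaf => exact ⟨hB, hB'⟩
  | un t ih =>
    simp only [graph]
    refine ⟨by rw [NumberedGraph.deg_single_none]; omega, ?_⟩
    rintro (_ | v)
    · rw [NumberedGraph.deg_single_none]; omega
    · rw [NumberedGraph.deg_single_some]
      split_ifs with h
      · rw [h]; omega
      · exact ih.2 v
  | bin s t ih ih' =>
    simp only [graph]
    refine ⟨by rw [NumberedGraph.deg_pair_none], ?_⟩
    rintro (_ | v | v)
    · rw [NumberedGraph.deg_pair_none]; omega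
    · rw [NumberedGraph.deg_pair_inl]
      split_ifs with h
      · rw [h]; omega
      · exact ih.2 v
    · rw [NumberedGraph.deg_pair_inr]
      split_ifs with h
      · rw [h]; omega
      · exact ih'.2 v

theorem deg_rooted_le (B : NumberedGraph) (hB : B.deg B.root ≤ 2) (hB' : ∀ v, B.deg v ≤ 3)
    (t : Gad) (v : Fin (t.rooted B).n) : ((t.rooted B).graph.neighborSet v).ncard ≤ 3 := by
  have := NumberedGraph.deg_toRooted ((un t).graph B) (((un t).graph B).num.symm v)
  have h2 := (deg_le B hB hB' (un t)).2 (((un t).graph B).num.symm v)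
  rw [← this] at h2
  convert h2
  exact (((un t).graph B).num.apply_symm_apply v).symm

theorem deg_rooted_root (B : NumberedGraph) (t : Gad) :
    ((t.rooted B).graph.neighborSet (t.rooted B).root).ncard = 1 := by
  have := NumberedGraph.deg_toRooted ((un t).graph B) ((un t).graph B).root
  rw [NumberedGraph.isoRooted_root] at this
  rw [this]
  exact NumberedGraph.deg_single_none _

end Gad

namespace NumberedGraph

/-- A single vertex. -/
def vertex : NumberedGraph where
  V := Unit
  graph := ⊥
  root := ()
  size := 1
  num := Equiv.ofUnique _ _
  edges := []
  adj_iff := by simp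
  num_root := rfl

/-- The edges of a cycle of length four. -/
def _root_.fourCycleEdges : List (Fin 4 × Fin 4) := [(0, 1), (1, 2), (2, 3), (0, 3)]

/-- The graph of a cycle of length four. -/
def _root_.fourCycleGraph : SimpleGraph (Fin 4) where
  Adj i j := (i, j) ∈ fourCycleEdges ∨ (j, i) ∈ fourCycleEdges
  symm := ⟨fun _ _ h => h.symm⟩
  loopless := ⟨by decide⟩

instance : DecidableRel fourCycleGraph.Adj := fun i j =>
  inferInstanceAs (Decidable ((i, j) ∈ fourCycleEdges ∨ (j, i) ∈ fourCycleEdges))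

/-- A cycle of length four. -/
abbrev fourCycle : NumberedGraph where
  V := Fin 4
  graph := fourCycleGraph
  root := 0
  size := 4
  num := Equiv.refl _
  edges := fourCycleEdges
  adj_iff := fun _ _ => Iff.rfl
  num_root := rfl

theorem deg_vertex (v : vertex.V) : vertex.deg v = 0 := by
  classical
  unfold deg
  rw [ncard_neighborSet_eq_sum]
  exact Finset.sum_eq_zero fun w _ => if_neg id

theorem deg_fourCycle (v : fourCycle.V) : fourCycle.deg v = 2 := by
  classical
  unfold deg
  rw [ncard_neighborSet_eq_sum]
  have key : ∀ v : Fin 4, (∑ w : Fin 4, if fourCycleGraph.Adj v w then 1 else 0) = 2 := by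
    decide
  convert key v

/-- `C` is obtained from `T` by replacing some leaves by cycles of length four. -/
def IsCycleExpansion (C T : NumberedGraph) : Prop :=
  ∃ (f : C.V → T.V) (l : C.V → Fin 4) (S : Set T.V),
    S.Nonempty ∧ (∀ v ∈ S, T.deg v + (if v = T.root then 1 else 0) = 1) ∧
    f C.root = T.root ∧ l C.root = 0 ∧
    (∀ v i, (i = 0 ∨ v ∈ S) ↔ ∃ x, f x = v ∧ l x = i) ∧
    (∀ x y, f x = f y → l x = l y → x = y) ∧
    ∀ x y, C.graph.Adj x y ↔ (l x = 0 ∧ l y = 0 ∧ T.graph.Adj (f x) (f y)) ∨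
      (f x = f y ∧ fourCycleGraph.Adj (l x) (l y))

theorem fourCycle_isCycleExpansion : IsCycleExpansion fourCycle vertex := by
  refine ⟨fun _ => (), id, Set.univ, ⟨(), trivial⟩, ?_, rfl, rfl, ?_, ?_, ?_⟩
  · intro v _
    have hv : v = vertex.root := rfl
    rw [deg_vertex, if_pos hv]
  · intro v i
    simp only [Set.mem_univ, or_true, true_iff]
    exact ⟨i, rfl, rfl⟩
  · intro x y _ h
    exact h
  · intro x y
    constructor
    · intro h
      exact Or.inr ⟨rfl, h⟩
    · rintro (h | h)
      · exact absurd h.2.2 id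
      · exact h.2

theorem IsCycleExpansion.single {C T : NumberedGraph} (h : IsCycleExpansion C T) :
    IsCycleExpansion C.single T.single := by
  obtain ⟨f, l, S, hS, hd, hr, hl, hsurj, hinj, hadj⟩ := h
  refine ⟨Option.map f, fun x => x.elim 0 l, some '' S, hS.image _, ?_, rfl, rfl, ?_, ?_, ?_⟩
  · rintro _ ⟨v, hv, rfl⟩
    rw [deg_single_some]
    simpa using hd v hv
  · rintro (_ | v) i
    · constructor
      · rintro (rfl | h)
        · exact ⟨none, rfl, rfl⟩
        · simp at h
      · rintro ⟨_ | x, h, h'⟩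
        · exact Or.inl h'.symm
        · simp at h
    · have := hsurj v i
      constructor
      · intro h
        obtain ⟨x, h1, h2⟩ := this.1 (by simpa using h)
        exact ⟨some x, by simp [h1], h2⟩
      · rintro ⟨_ | x, h, h'⟩
        · simp at h
        · have := this.2 ⟨x, by simpa using h, h'⟩
          simpa using this
  · rintro (_ | x) (_ | y) h h'
    · rfl
    · simp at h
    · simp at h
    · rw [hinj x y (by simpa using h) h']
  · rintro (_ | x) (_ | y)
    · simp
    · have := hsurj T.root 0
      simp only [attachRoot_none_some, Option.map, Option.elim]
      simp
      constructor
      · rintro rfl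
        exact ⟨hl, hr⟩
      · rintro ⟨h1, h2⟩
        exact hinj _ _ (h2.trans hr.symm) (h1.trans hl.symm)
    · simp only [attachRoot_some_none, Option.map, Option.elim]
      simp
      constructor
      · rintro rfl
        exact ⟨hl, hr⟩
      · rintro ⟨h1, h2⟩
        exact hinj _ _ (h2.trans hr.symm) (h1.trans hl.symm)
    · simp [hadj]

theorem IsCycleExpansion.pair {C T C' T' : NumberedGraph} (h : IsCycleExpansion C T)
    (h' : IsCycleExpansion C' T') : IsCycleExpansion (C.pair C') (T.pair T') := by
  obtain ⟨f, l, S, hS, hd, hr, hl, hsurj, hinj, hadj⟩ := h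
  obtain ⟨f', l', S', hS', hd', hr', hl', hsurj', hinj', hadj'⟩ := h'
  refine ⟨Option.map (Sum.map f f'), fun x => x.elim 0 (Sum.elim l l'),
    some '' (Sum.inl '' S ∪ Sum.inr '' S'), (hS.image _).inl.image _, ?_, rfl, rfl, ?_, ?_, ?_⟩
  · rintro _ ⟨_, ⟨v, hv, rfl⟩ | ⟨v, hv, rfl⟩, rfl⟩
    · rw [deg_pair_inl]
      simpa using hd v hv
    · rw [deg_pair_inr]
      simpa using hd' v hv
  · rintro (_ | v | v) i
    · constructor
      · rintro (rfl | h)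
        · exact ⟨none, rfl, rfl⟩
        · simp at h
      · rintro ⟨_ | x, h, h'⟩
        · exact Or.inl h'.symm
        · simp at h
    · have := hsurj v i
      constructor
      · intro h
        obtain ⟨x, h1, h2⟩ := this.1 (by simpa using h)
        exact ⟨some (.inl x), by simp [h1], h2⟩
      · rintro ⟨_ | x | x, h, h'⟩
        · simp at h
        · have := this.2 ⟨x, by simpa using h, h'⟩
          simpa using this
        · simp at h
    · have := hsurj' v i
      constructor
      · intro h
        obtain ⟨x, h1, h2⟩ := this.1 (by simpa using h)
        exact ⟨some (.inr x), by simp [h1], h2⟩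
      · rintro ⟨_ | x | x, h, h'⟩
        · simp at h
        · simp at h
        · have := this.2 ⟨x, by simpa using h, h'⟩
          simpa using this
  · rintro (_ | x | x) (_ | y | y) h h'
    · rfl
    · simp at h
    · simp at h
    · simp at h
    · rw [hinj x y (by simpa using h) h']
    · simp at h
    · simp at h
    · simp at h
    · rw [hinj' x y (by simpa using h) h']
  · have e1 : ∀ x, x = C.root ↔ l x = 0 ∧ f x = T.root := fun x =>
      ⟨by rintro rfl; exact ⟨hl, hr⟩, fun h => hinj _ _ (h.2.trans hr.symm) (h.1.trans hl.symm)⟩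
    have e2 : ∀ x, x = C'.root ↔ l' x = 0 ∧ f' x = T'.root := fun x =>
      ⟨by rintro rfl; exact ⟨hl', hr'⟩,
        fun h => hinj' _ _ (h.2.trans hr'.symm) (h.1.trans hl'.symm)⟩
    rintro (_ | x | x) (_ | y | y)
    · simp
    · simp [e1]
    · simp [e2]
    · simp [e1]
    · simp [hadj]
    · simp
    · simp [e2]
    · simp
    · simp [hadj']

theorem _root_.Gad.isCycleExpansion (t : Gad) :
    IsCycleExpansion (t.graph fourCycle) (t.graph vertex) := by
  induction t with
  | leaf => exact fourCycle_isCycleExpansion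
  | un t ih => exact ih.single
  | bin s t ih ih' => exact ih.pair ih'

theorem IsCycleExpansion.exists_iso {C T : NumberedGraph} (h : IsCycleExpansion C T) :
    ∃ S : Set (Fin T.size), S.Nonempty ∧
      (∀ s ∈ S, T.deg (T.num.symm s) + (if T.num.symm s = T.root then 1 else 0) = 1) ∧
      ∃ φ : C.toRooted.graph ≃g attachFourCycles T.toRooted.graph S,
        φ C.toRooted.root = Sum.inl T.toRooted.root := by
  classical
  obtain ⟨f, l, S, hS, hd, hr, hl, hsurj, hinj, hadj⟩ := h
  let S' : Set (Fin T.size) := {s | T.num.symm s ∈ S}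
  have hmem : ∀ x, l x ≠ 0 → T.num (f x) ∈ S' := fun x hx => by
    simpa [S', hx] using (hsurj (f x) (l x)).2 ⟨x, rfl, rfl⟩
  let F : C.V → Fin T.size ⊕ (S' × Fin 3) := fun x =>
    if h : l x = 0 then .inl (T.num (f x)) else .inr (⟨T.num (f x), hmem x h⟩, (l x).pred h)
  have hF0 : ∀ x, l x = 0 → F x = .inl (T.num (f x)) := fun x hx => dif_pos hx
  have hF1 : ∀ x (hx : l x ≠ 0), F x = .inr (⟨T.num (f x), hmem x hx⟩, (l x).pred hx) :=
    fun x hx => dif_neg hx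
  have hbij : Function.Bijective F := by
    constructor
    · intro x y hxy
      by_cases hx : l x = 0 <;> by_cases hy : l y = 0
      · rw [hF0 x hx, hF0 y hy] at hxy
        exact hinj x y (T.num.injective (Sum.inl.inj hxy)) (hx.trans hy.symm)
      · rw [hF0 x hx, hF1 y hy] at hxy
        cases hxy
      · rw [hF1 x hx, hF0 y hy] at hxy
        cases hxy
      · rw [hF1 x hx, hF1 y hy] at hxy
        have := Sum.inr.inj hxy
        rw [Prod.mk.injEq, Subtype.mk.injEq] at this
        exact hinj x y (T.num.injective this.1) (Fin.pred_inj.1 this.2)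
    · rintro (v | ⟨⟨v, hv⟩, i⟩)
      · obtain ⟨x, h1, h2⟩ := (hsurj (T.num.symm v) 0).1 (Or.inl rfl)
        exact ⟨x, by rw [hF0 x h2, h1]; simp⟩
      · obtain ⟨x, h1, h2⟩ := (hsurj (T.num.symm v) i.succ).1 (Or.inr hv)
        have hx : l x ≠ 0 := by rw [h2]; exact Fin.succ_ne_zero i
        refine ⟨x, ?_⟩
        rw [hF1 x hx]
        simp [h1, h2]
  have hFadj : ∀ x y, (attachFourCycles T.toRooted.graph S').Adj (F x) (F y) ↔
      C.graph.Adj x y := by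
    have k0 : ∀ i : Fin 4, ∀ hi : i ≠ 0, fourCycleGraph.Adj 0 i ↔ i.pred hi ≠ 1 := by
      decide
    have k1 : ∀ i j : Fin 4, ∀ hi : i ≠ 0, ∀ hj : j ≠ 0, fourCycleGraph.Adj i j ↔
        ((i.pred hi).val + 1 = (j.pred hj).val ∨ (j.pred hj).val + 1 = (i.pred hi).val) := by
      decide
    intro x y
    rw [hadj]
    by_cases hx : l x = 0 <;> by_cases hy : l y = 0
    · rw [hF0 x hx, hF0 y hy, hx, hy]
      change T.graph.Adj (T.num.symm (T.num (f x))) (T.num.symm (T.num (f y))) ↔ _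
      simp
    · rw [hF0 x hx, hF1 y hy, hx]
      change (T.num (f x) = T.num (f y) ∧ (l y).pred hy ≠ 1) ↔ _
      rw [← k0, T.num.apply_eq_iff_eq]
      simp [hy]
    · rw [hF1 x hx, hF0 y hy, hy]
      change (T.num (f y) = T.num (f x) ∧ (l x).pred hx ≠ 1) ↔ _
      rw [← k0, T.num.apply_eq_iff_eq, fourCycleGraph.adj_comm]
      simp only [hx, false_and, false_or, eq_comm]
    · rw [hF1 x hx, hF1 y hy]
      change ((⟨T.num (f x), hmem x hx⟩ : S') = ⟨T.num (f y), hmem y hy⟩ ∧ _) ↔ _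
      rw [Subtype.mk.injEq, T.num.apply_eq_iff_eq, ← k1]
      simp [hx]
  refine ⟨S', ?_, fun s hs => hd _ hs, ?_⟩
  · obtain ⟨v, hv⟩ := hS
    exact ⟨T.num v, by simpa [S'] using hv⟩
  · let e : C.graph ≃g attachFourCycles T.toRooted.graph S' :=
      ⟨Equiv.ofBijective F hbij, fun {x y} => hFadj x y⟩
    refine ⟨C.isoRooted.symm.trans e, ?_⟩
    have : C.isoRooted.symm C.toRooted.root = C.root := by
      rw [← isoRooted_root, RelIso.symm_apply_apply]
    change F (C.isoRooted.symm C.toRooted.root) = _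
    rw [this, hF0 _ hl, hr]

end NumberedGraph

namespace Gad

open NumberedGraph

theorem isTree_graph_vertex (t : Gad) : (t.graph vertex).graph.IsTree := by
  induction t with
  | leaf =>
    change (⊥ : SimpleGraph Unit).IsTree
    exact SimpleGraph.IsTree.of_subsingleton
  | un t ih => exact isTree_single _ ih
  | bin s t ih ih' => exact isTree_pair _ _ ih ih'

theorem isTree_rooted (t : Gad) : (t.rooted vertex).graph.IsTree :=
  (((un t).graph vertex).isoRooted.isTree_iff).1 (isTree_graph_vertex (un t))

theorem isFieldGadget_vertex {β γ lam : ℝ} (h : lam * (1 - γ) ≠ 1 - β) (t : Gad) :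
    IsFieldGadget β γ lam (t.rooted vertex) :=
  Or.inl ⟨h, t.isTree_rooted, deg_rooted_root _ t⟩

theorem isFieldGadget_fourCycle {β γ lam : ℝ} (h : lam * (1 - γ) = 1 - β) (t : Gad) :
    IsFieldGadget β γ lam (t.rooted fourCycle) := by
  obtain ⟨S, hS, hd, φ, hφ⟩ := (un t).isCycleExpansion.exists_iso
  refine Or.inr ⟨h, t.rooted vertex, S, t.isTree_rooted, deg_rooted_root _ t, hS,
    fun s hs => ?_, φ, hφ⟩
  have hd' := hd s hs
  have h1 := NumberedGraph.deg_toRooted ((un t).graph vertex) (((un t).graph vertex).num.symm s)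
  have h2 : ((un t).graph vertex).isoRooted (((un t).graph vertex).num.symm s) = s :=
    ((un t).graph vertex).num.apply_symm_apply s
  rw [h2] at h1
  have hne : ((un t).graph vertex).num.symm s ≠ ((un t).graph vertex).root := by
    intro h0
    have h3 : ((un t).graph vertex).deg ((un t).graph vertex).root = 1 :=
      NumberedGraph.deg_single_none _
    rw [h0, h3] at hd'
    simp at hd'
  rw [if_neg hne, add_zero] at hd'
  refine ⟨fun h0 => hne ?_, h1.trans hd'⟩
  rw [h0]
  exact ((un t).graph vertex).num.symm_apply_apply _

end Gad

/-! ### Fields and gaps of binary gadgets -/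

/-- An antiferromagnetic two-spin system with an observable, together with the logarithm of the
field and the gap of the graphs used as leaves. -/
structure TwoSpin where
  β : ℝ
  γ : ℝ
  lam : ℝ
  a : ℝ
  b : ℝ
  c : ℝ
  base : ℝ × ℝ
  β_nonneg : 0 ≤ β
  γ_nonneg : 0 ≤ γ
  mul_lt_one : β * γ < 1
  ne_zero : β ≠ 0 ∨ γ ≠ 0
  lam_pos : 0 < lam

namespace TwoSpin

variable (S : TwoSpin)

/-- The activity of a vertex with logarithmic field `u`. -/
noncomputable def act (u : ℝ) : ℝ := S.lam * Real.exp u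

theorem act_pos (u : ℝ) : 0 < S.act u := mul_pos S.lam_pos (Real.exp_pos u)

theorem den_pos (u : ℝ) : 0 < S.β + S.act u := add_pos_of_nonneg_of_pos S.β_nonneg (S.act_pos u)

theorem num_pos (u : ℝ) : 0 < 1 + S.γ * S.act u :=
  add_pos_of_pos_of_nonneg one_pos (mul_nonneg S.γ_nonneg (S.act_pos u).le)

/-- The logarithm of the field of a vertex, as a function of that of its child. -/
noncomputable def phi (u : ℝ) : ℝ := Real.log ((1 + S.γ * S.act u) / (S.β + S.act u))

/-- The derivative of `phi`. -/
noncomputable def dphi (u : ℝ) : ℝ :=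
  -((1 - S.β * S.γ) * S.act u / ((S.β + S.act u) * (1 + S.γ * S.act u)))

/-- The contribution of an edge to the gap. -/
noncomputable def eps (u : ℝ) : ℝ :=
  -S.b * S.β / (S.β + S.act u) + S.c * S.γ * S.act u / (1 + S.γ * S.act u)

/-- The logarithmic field and the gap at a vertex, as functions of those of its child. -/
noncomputable def step (p : ℝ × ℝ) : ℝ × ℝ :=
  (S.phi p.1, S.dphi p.1 * (p.2 + S.a) + S.eps p.1)

/-- The logarithmic field and the gap at the root of a shape, without root edge. -/
noncomputable def tot : Gad → ℝ × ℝ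
  | .leaf => S.base
  | .un t => S.step (tot t)
  | .bin s t => S.step (tot s) + S.step (tot t)

/-- The logarithmic field and the gap of a gadget. -/
noncomputable def val (t : Gad) : ℝ × ℝ := S.step (S.tot t)

@[simp] theorem val_leaf : S.val .leaf = S.step S.base := rfl

@[simp] theorem val_un (t : Gad) : S.val (.un t) = S.step (S.val t) := rfl

@[simp] theorem val_bin (s t : Gad) : S.val (.bin s t) = S.step (S.val s + S.val t) := rfl

theorem exp_phi (u : ℝ) : Real.exp (S.phi u) = fieldStep S.β S.γ S.lam (Real.exp u) :=
  Real.exp_log (div_pos (S.num_pos u) (S.den_pos u))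

/-- The rooted graph `B` has the logarithmic field and the gap of the leaves of `S`. -/
def IsBase (B : NumberedGraph) : Prop :=
  HasField S.β S.γ S.lam S.a S.b S.c B.graph B.root (Real.exp S.base.1) S.base.2

variable {S}

theorem hasField_graph {B : NumberedGraph} (hB : S.IsBase B) (t : Gad) :
    HasField S.β S.γ S.lam S.a S.b S.c (t.graph B).graph (t.graph B).root
      (Real.exp (S.tot t).1) (S.tot t).2 := by
  induction t with
  | leaf => exact hB
  | un t ih =>
    have := ih.single S.β_nonneg S.γ_nonneg S.lam_pos (Real.exp_pos _)
    rw [← exp_phi] at this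
    exact this
  | bin s t ih ih' =>
    have := ih.pair S.β_nonneg S.γ_nonneg S.lam_pos (Real.exp_pos _) (Real.exp_pos _) ih'
    rw [← exp_phi, ← exp_phi, ← Real.exp_add] at this
    exact this

theorem rooted_spec {B : NumberedGraph} (hB : S.IsBase B) (t : Gad) :
    effectiveField S.β S.γ S.lam (t.rooted B).graph (t.rooted B).root = Real.exp (S.val t).1 ∧
    observableGap S.β S.γ S.lam S.a S.b S.c (t.rooted B).graph (t.rooted B).root =
      (S.val t).2 :=
  ((hasField_graph hB (.un t)).of_iso ((Gad.un t).graph B).isoRooted).spec S.lam_pos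
    (Real.exp_pos _)

end TwoSpin

section Leaves

open NumberedGraph TrivSqZeroExt

variable {A : Type} [CommRing A]

theorem rootZ_vertex (Λ B Γ : A) (s : Fin 2) :
    rootZ Λ B Γ vertex.graph vertex.root s = Λ ^ (s : ℕ) := by
  have h1 : ∀ σ : Unit → Fin 2, numOnes σ = (σ () : ℕ) := by
    intro σ
    rw [numOnes_eq_sum]
    simp only [Finset.univ_unique, Finset.sum_singleton]
    generalize σ default = x
    fin_cases x <;> simp
  have h2 : ∀ (i : Fin 2) (σ : Unit → Fin 2), monoEdges (⊥ : SimpleGraph Unit) i σ = 0 := by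
    intro i σ
    have := two_mul_monoEdges (⊥ : SimpleGraph Unit) i σ
    simp only [SimpleGraph.bot_adj, false_and, if_false, Finset.sum_const_zero] at this
    omega
  change ∑ σ : Unit → Fin 2 with σ () = s, Λ ^ numOnes σ * B ^ monoEdges (⊥ : SimpleGraph Unit) 0 σ *
    Γ ^ monoEdges (⊥ : SimpleGraph Unit) 1 σ = _
  simp only [h1, h2, pow_zero, mul_one]
  rw [Finset.sum_eq_single_of_mem (fun _ => s) (by simp)]
  intro σ hσ hne
  refine absurd (funext fun x => ?_) hne
  simpa using hσ

theorem sum_fin_succ_fun {n : ℕ} (f : (Fin (n + 1) → Fin 2) → A) :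
    ∑ σ, f σ = ∑ x, ∑ τ : Fin n → Fin 2, f (Fin.cons x τ) := by
  rw [← (Fin.consEquiv fun _ : Fin (n + 1) => Fin 2).sum_comp, Fintype.sum_prod_type]
  rfl

theorem monoEdges_fourCycle (i : Fin 2) (σ : Fin 4 → Fin 2) :
    monoEdges fourCycleGraph i σ = (if σ 0 = i ∧ σ 1 = i then 1 else 0) +
      (if σ 1 = i ∧ σ 2 = i then 1 else 0) + (if σ 2 = i ∧ σ 3 = i then 1 else 0) +
      (if σ 0 = i ∧ σ 3 = i then 1 else 0) := by
  have h := two_mul_monoEdges fourCycleGraph i σ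
  have e : ∀ u v, fourCycleGraph.Adj u v ↔
    (u, v) ∈ fourCycleEdges ∨ (v, u) ∈ fourCycleEdges := fun _ _ => Iff.rfl
  simp only [Fin.sum_univ_four, e, fourCycleEdges] at h
  simp at h
  simp only [and_comm (a := σ 1 = i) (b := σ 0 = i), and_comm (a := σ 2 = i) (b := σ 1 = i),
    and_comm (a := σ 3 = i) (b := σ 2 = i), and_comm (a := σ 3 = i) (b := σ 0 = i)] at h
  omega

theorem rootZ_fourCycle (Λ B Γ : A) (s : Fin 2) :
    rootZ Λ B Γ fourCycle.graph fourCycle.root s =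
      Λ ^ (s : ℕ) * ∑ t : Fin 2, Λ ^ (t : ℕ) *
        (∑ u : Fin 2, edgeAct B Γ s u * Λ ^ (u : ℕ) * edgeAct B Γ u t) ^ 2 := by
  have h1 : ∀ σ : Fin 4 → Fin 2,
      numOnes σ = (σ 0 : ℕ) + (σ 1 : ℕ) + (σ 2 : ℕ) + (σ 3 : ℕ) := by
    intro σ
    have : ∀ x : Fin 2, (if x = 1 then 1 else 0) = (x : ℕ) := by decide
    rw [numOnes_eq_sum]
    simp only [this, Fin.sum_univ_four]
  have h2 : ∀ σ : Fin 4 → Fin 2, Λ ^ numOnes σ * B ^ monoEdges fourCycleGraph 0 σ *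
      Γ ^ monoEdges fourCycleGraph 1 σ = Λ ^ (σ 0 : ℕ) * (Λ ^ (σ 2 : ℕ) *
        ((edgeAct B Γ (σ 0) (σ 1) * Λ ^ (σ 1 : ℕ) * edgeAct B Γ (σ 1) (σ 2)) *
        (edgeAct B Γ (σ 0) (σ 3) * Λ ^ (σ 3 : ℕ) * edgeAct B Γ (σ 2) (σ 3)))) := by
    intro σ
    rw [h1, monoEdges_fourCycle, monoEdges_fourCycle]
    simp only [pow_add, ← pow_edge B Γ]
    ac_rfl
  have h3 : ∀ x y : Fin 2, edgeAct B Γ x y = edgeAct B Γ y x := by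
    intro x y
    simp only [edgeAct, and_comm]
  change ∑ σ : Fin 4 → Fin 2 with σ 0 = s, Λ ^ numOnes σ * B ^ monoEdges fourCycleGraph 0 σ *
      Γ ^ monoEdges fourCycleGraph 1 σ = _
  simp only [h2]
  rw [Finset.sum_filter, sum_fin_succ_fun]
  simp only [sum_fin_succ_fun, Fin.cons_zero]
  rw [Finset.sum_eq_single_of_mem s (Finset.mem_univ _)
    (fun x _ hx => by simp only [if_neg hx, Finset.sum_const_zero])]
  simp only [if_true, Fin.sum_univ_two, Finset.univ_unique, Finset.sum_singleton]
  have c1 : ∀ (x : Fin 2) (τ : Fin 3 → Fin 2), (Fin.cons x τ : Fin 4 → Fin 2) 1 = τ 0 :=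
    fun _ _ => rfl
  have c2 : ∀ (x : Fin 2) (τ : Fin 3 → Fin 2), (Fin.cons x τ : Fin 4 → Fin 2) 2 = τ 1 :=
    fun _ _ => rfl
  have c3 : ∀ (x : Fin 2) (τ : Fin 3 → Fin 2), (Fin.cons x τ : Fin 4 → Fin 2) 3 = τ 2 :=
    fun _ _ => rfl
  have c4 : ∀ (x : Fin 2) (τ : Fin 2 → Fin 2), (Fin.cons x τ : Fin 3 → Fin 2) 1 = τ 0 :=
    fun _ _ => rfl
  have c5 : ∀ (x : Fin 2) (τ : Fin 2 → Fin 2), (Fin.cons x τ : Fin 3 → Fin 2) 2 = τ 1 :=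
    fun _ _ => rfl
  have c6 : ∀ (x : Fin 2) (τ : Fin 1 → Fin 2), (Fin.cons x τ : Fin 2 → Fin 2) 1 = τ 0 :=
    fun _ _ => rfl
  simp only [c1, c2, c3, c4, c5, c6, Fin.cons_zero]
  rw [h3 1 0]
  ring

theorem hasField_vertex (β γ lam a b c : ℝ) :
    HasField β γ lam a b c vertex.graph vertex.root 1 0 := by
  constructor
  · rw [rootZ_vertex]
    simp
  · rw [rootZ_vertex, rootZ_vertex]
    apply TrivSqZeroExt.ext <;> simp

/-- The field of a vertex on a cycle of length four. -/
noncomputable def cycleField (β γ lam : ℝ) : ℝ :=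
  ((β + lam * γ) ^ 2 + lam * (1 + lam * γ ^ 2) ^ 2) /
    ((β ^ 2 + lam) ^ 2 + lam * (β + lam * γ) ^ 2)

/-- The gap of a vertex on a cycle of length four. -/
noncomputable def cycleGap (β γ lam a b c : ℝ) : ℝ :=
  (2 * (β + lam * γ) * (β * b + lam * γ * (a + c)) + lam * a * (1 + lam * γ ^ 2) ^ 2 +
      lam * (2 * (1 + lam * γ ^ 2) * (lam * γ ^ 2 * (a + 2 * c)))) /
    ((β + lam * γ) ^ 2 + lam * (1 + lam * γ ^ 2) ^ 2) -
  (2 * (β ^ 2 + lam) * (2 * b * β ^ 2 + lam * a) + lam * a * (β + lam * γ) ^ 2 +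
      lam * (2 * (β + lam * γ) * (β * b + lam * γ * (a + c)))) /
    ((β ^ 2 + lam) ^ 2 + lam * (β + lam * γ) ^ 2)

theorem cycleField_pos (β γ : ℝ) {lam : ℝ} (hlam : 0 < lam) :
    0 < cycleField β γ lam := by
  unfold cycleField
  positivity

theorem hasField_fourCycle (β γ a b c : ℝ) {lam : ℝ} (hlam : 0 < lam) :
    HasField β γ lam a b c fourCycle.graph fourCycle.root (cycleField β γ lam)
      (cycleGap β γ lam a b c) := by
  constructor
  · rw [rootZ_fourCycle]
    simp [Fin.sum_univ_two, edgeAct]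
    have h1 : 0 < β * β + lam := by nlinarith [mul_self_nonneg β]
    positivity
  · have p1 : 0 < (β + lam * γ) ^ 2 + lam * (1 + lam * γ ^ 2) ^ 2 := by positivity
    have p2 : 0 < (β ^ 2 + lam) ^ 2 + lam * (β + lam * γ) ^ 2 := by positivity
    rw [rootZ_fourCycle, rootZ_fourCycle]
    simp only [Fin.sum_univ_two, edgeAct, pow_two]
    apply TrivSqZeroExt.ext
    · simp [cycleField]
      field_simp
    · simp [cycleField, cycleGap]
      field_simp
      ring

end Leaves

/-! ### The map `phi` -/

namespace TwoSpin

variable (S : TwoSpin)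

open Set Filter Topology

theorem hasDerivAt_act (u : ℝ) : HasDerivAt S.act (S.act u) u := by
  unfold act
  exact (Real.hasDerivAt_exp u).const_mul _

theorem phi_eq (u : ℝ) :
    S.phi u = Real.log (1 + S.γ * S.act u) - Real.log (S.β + S.act u) :=
  Real.log_div (S.num_pos u).ne' (S.den_pos u).ne'

theorem one_sub_pos : 0 < 1 - S.β * S.γ := sub_pos.2 S.mul_lt_one

theorem hasDerivAt_phi (u : ℝ) : HasDerivAt S.phi (S.dphi u) u := by
  have h1 : HasDerivAt (fun u => 1 + S.γ * S.act u) (S.γ * S.act u) u :=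
    ((S.hasDerivAt_act u).const_mul _).const_add _
  have h2 : HasDerivAt (fun u => S.β + S.act u) (S.act u) u := (S.hasDerivAt_act u).const_add _
  have h := (h1.log (S.num_pos u).ne').sub (h2.log (S.den_pos u).ne')
  have e : S.phi = (fun u => Real.log (1 + S.γ * S.act u) - Real.log (S.β + S.act u)) :=
    funext S.phi_eq
  rw [e]
  refine h.congr_deriv ?_
  unfold dphi
  have := S.num_pos u
  have := S.den_pos u
  field_simp
  ring

theorem contDiff_act : ContDiff ℝ ⊤ S.act := by
  unfold act
  fun_prop

theorem contDiff_dphi : ContDiff ℝ ⊤ S.dphi := by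
  have h := S.contDiff_act
  refine ContDiff.neg (ContDiff.div (contDiff_const.mul h)
    ((contDiff_const.add h).mul (contDiff_const.add (contDiff_const.mul h))) fun u => ?_)
  exact (mul_pos (S.den_pos u) (S.num_pos u)).ne'

theorem contDiff_eps : ContDiff ℝ ⊤ S.eps := by
  have h := S.contDiff_act
  refine ContDiff.add (ContDiff.div contDiff_const (contDiff_const.add h)
    fun u => (S.den_pos u).ne') (ContDiff.div (contDiff_const.mul h)
    (contDiff_const.add (contDiff_const.mul h)) fun u => (S.num_pos u).ne')

theorem continuous_phi : Continuous S.phi :=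
  continuous_iff_continuousAt.2 fun u => (S.hasDerivAt_phi u).continuousAt

theorem continuous_step : Continuous S.step := by
  have h1 := S.continuous_phi
  have h2 := S.contDiff_dphi.continuous
  have h3 := S.contDiff_eps.continuous
  unfold step
  fun_prop

theorem dphi_neg (u : ℝ) : S.dphi u < 0 := by
  have h1 := S.num_pos u
  have h2 := S.den_pos u
  have h3 := S.act_pos u
  have h4 := S.one_sub_pos
  unfold dphi
  rw [neg_lt_zero]
  positivity

theorem neg_one_lt_dphi (u : ℝ) : -1 < S.dphi u := by
  have h1 := S.num_pos u
  have h2 := S.den_pos u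
  have h3 := S.act_pos u
  unfold dphi
  rw [neg_lt_neg_iff, div_lt_one (by positivity)]
  have hb := S.β_nonneg
  have hg := S.γ_nonneg
  have : 0 < S.β + 2 * (S.β * S.γ) * S.act u + S.γ * S.act u ^ 2 := by
    rcases S.ne_zero with h | h
    · have : 0 < S.β := lt_of_le_of_ne hb (Ne.symm h)
      positivity
    · have : 0 < S.γ := lt_of_le_of_ne hg (Ne.symm h)
      positivity
  nlinarith

theorem abs_eps_le (u : ℝ) : |S.eps u| ≤ |S.b| + |S.c| := by
  have h1 := S.num_pos u
  have h2 := S.den_pos u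
  have h3 := S.act_pos u
  have hb := S.β_nonneg
  have hg := S.γ_nonneg
  unfold eps
  refine (abs_add_le _ _).trans (add_le_add ?_ ?_)
  · rw [abs_div, abs_mul, abs_neg, abs_of_nonneg hb, abs_of_pos h2, div_le_iff₀ h2]
    have := abs_nonneg S.b
    nlinarith
  · rw [abs_div, abs_mul, abs_mul, abs_of_nonneg hg, abs_of_pos h1, abs_of_pos h3,
      div_le_iff₀ h1]
    have := abs_nonneg S.c
    nlinarith [mul_nonneg hg h3.le]

/-- Bounds on the decrease of `phi` from bounds on its derivative. -/
theorem phi_sub_phi_mem {x y k k' : ℝ} (hxy : x ≤ y)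
    (h : ∀ u ∈ Icc x y, k ≤ -S.dphi u ∧ -S.dphi u ≤ k') :
    k * (y - x) ≤ S.phi x - S.phi y ∧ S.phi x - S.phi y ≤ k' * (y - x) := by
  rcases hxy.eq_or_lt with rfl | hlt
  · simp
  · obtain ⟨u, hu, hd⟩ := exists_hasDerivAt_eq_slope S.phi S.dphi hlt S.continuous_phi.continuousOn
      (fun u _ => S.hasDerivAt_phi u)
    have h1 := h u (Ioo_subset_Icc_self hu)
    have h2 : S.phi x - S.phi y = -S.dphi u * (y - x) := by
      rw [hd]
      field_simp [(sub_pos.2 hlt).ne']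
      ring
    rw [h2]
    have h3 := sub_pos.2 hlt
    exact ⟨by nlinarith, by nlinarith⟩

theorem phi_strictAnti : StrictAnti S.phi :=
  strictAnti_of_hasDerivAt_neg S.hasDerivAt_phi S.dphi_neg

theorem abs_phi_sub_le {x y k' : ℝ} (h : ∀ u ∈ uIcc x y, -S.dphi u ≤ k') :
    |S.phi x - S.phi y| ≤ k' * |x - y| := by
  wlog hxy : x ≤ y generalizing x y
  · rw [abs_sub_comm, abs_sub_comm x]
    exact this (by rwa [uIcc_comm]) (le_of_not_ge hxy)
  · rw [uIcc_of_le hxy] at h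
    have h1 := S.phi_sub_phi_mem hxy (k := 0) fun u hu =>
      ⟨neg_nonneg.2 (S.dphi_neg u).le, h u hu⟩
    rw [abs_of_nonneg (by linarith [h1.1]), abs_sub_comm, abs_of_nonneg (sub_nonneg.2 hxy)]
    exact h1.2

theorem abs_phi_sub_le_abs_sub (x y : ℝ) : |S.phi x - S.phi y| ≤ |x - y| := by
  have := S.abs_phi_sub_le (x := x) (y := y) (k' := 1) fun u _ => by
    linarith [S.neg_one_lt_dphi u]
  linarith

/-- An interval `[l, U]` containing all the logarithmic fields of gadgets, and bounds for the
derivative of `phi` on a neighbourhood of `[2 l, 2 U]`. -/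
structure Region where
  l : ℝ
  U : ℝ
  k₀ : ℝ
  k₁ : ℝ
  l_nonpos : l ≤ 0
  U_nonneg : 0 ≤ U
  l_le_base : l ≤ S.base.1
  base_le_U : S.base.1 ≤ U
  maps : ∀ u ∈ Icc (2 * l) (2 * U), S.phi u ∈ Icc l U
  k₀_pos : 0 < k₀
  k₁_lt_one : k₁ < 1
  bound : ∀ u ∈ Icc (3 * l - U - 1) (3 * U - l + 1), k₀ ≤ -S.dphi u ∧ -S.dphi u ≤ k₁

theorem phi_lt (hβ : 0 < S.β) (u : ℝ) : S.phi u < -Real.log S.β := by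
  rw [← Real.log_inv]
  refine Real.log_lt_log (div_pos (S.num_pos u) (S.den_pos u)) ?_
  rw [div_lt_iff₀ (S.den_pos u), ← sub_pos]
  have h3 := S.act_pos u
  have h4 := S.one_sub_pos
  have : S.β⁻¹ * (S.β + S.act u) - (1 + S.γ * S.act u) =
      S.β⁻¹ * ((1 - S.β * S.γ) * S.act u) := by
    field_simp
    ring
  rw [this]
  positivity

theorem lt_phi (hγ : 0 < S.γ) (u : ℝ) : Real.log S.γ < S.phi u := by
  refine Real.log_lt_log hγ ?_
  rw [lt_div_iff₀ (S.den_pos u)]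
  have h3 := S.act_pos u
  have h4 := S.one_sub_pos
  linarith

theorem nonempty_region : Nonempty S.Region := by
  obtain ⟨l, U, h1, h2, h3, h4, h5⟩ : ∃ l U, l ≤ 0 ∧ 0 ≤ U ∧ l ≤ S.base.1 ∧ S.base.1 ≤ U ∧
      ∀ u ∈ Icc (2 * l) (2 * U), S.phi u ∈ Icc l U := by
    rcases S.ne_zero with h | h
    · have hβ := lt_of_le_of_ne S.β_nonneg (Ne.symm h)
      set U := max 0 (max S.base.1 (-Real.log S.β)) with hU
      have u1 : 0 ≤ U := le_max_left _ _
      have u2 : S.base.1 ≤ U := (le_max_left _ _).trans (le_max_right _ _)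
      have u3 : -Real.log S.β ≤ U := (le_max_right _ _).trans (le_max_right _ _)
      refine ⟨min 0 (min S.base.1 (S.phi (2 * U))), U, min_le_left _ _, u1,
        (min_le_right _ _).trans (min_le_left _ _), u2, fun u hu => ⟨?_, ?_⟩⟩
      · refine ((min_le_right _ _).trans (min_le_right _ _)).trans (S.phi_strictAnti.antitone hu.2)
      · exact (S.phi_lt hβ u).le.trans u3
    · have hγ := lt_of_le_of_ne S.γ_nonneg (Ne.symm h)
      set l := min 0 (min S.base.1 (Real.log S.γ)) with hl
      have u1 : l ≤ 0 := min_le_left _ _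
      have u2 : l ≤ S.base.1 := (min_le_right _ _).trans (min_le_left _ _)
      have u3 : l ≤ Real.log S.γ := (min_le_right _ _).trans (min_le_right _ _)
      refine ⟨l, max 0 (max S.base.1 (S.phi (2 * l))), u1, le_max_left _ _, u2,
        (le_max_left _ _).trans (le_max_right _ _), fun u hu => ⟨?_, ?_⟩⟩
      · exact u3.trans (S.lt_phi hγ u).le
      · exact (S.phi_strictAnti.antitone hu.1).trans
          ((le_max_right _ _).trans (le_max_right _ _))
  have hne : (Icc (3 * l - U - 1) (3 * U - l + 1)).Nonempty := ⟨0, by constructor <;> linarith⟩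
  have hc : ContinuousOn (fun u => -S.dphi u) (Icc (3 * l - U - 1) (3 * U - l + 1)) :=
    S.contDiff_dphi.continuous.neg.continuousOn
  obtain ⟨x, -, hx⟩ := isCompact_Icc.exists_isMinOn hne hc
  obtain ⟨y, -, hy⟩ := isCompact_Icc.exists_isMaxOn hne hc
  exact ⟨⟨l, U, -S.dphi x, -S.dphi y, h1, h2, h3, h4, h5, neg_pos.2 (S.dphi_neg x),
    by linarith [S.neg_one_lt_dphi y], fun u hu => ⟨hx hu, hy hu⟩⟩⟩

variable {S}

namespace Region

variable (R : S.Region)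

theorem k₁_pos : 0 < R.k₁ := by
  have h := R.bound 0 ⟨by linarith [R.l_nonpos, R.U_nonneg], by linarith [R.l_nonpos, R.U_nonneg]⟩
  linarith [R.k₀_pos]

theorem maps_add {x y : ℝ} (hx : x ∈ Icc R.l R.U) (hy : y ∈ Icc R.l R.U) :
    S.phi (x + y) ∈ Icc R.l R.U :=
  R.maps _ ⟨by linarith [hx.1, hy.1], by linarith [hx.2, hy.2]⟩

theorem maps_self {x : ℝ} (hx : x ∈ Icc R.l R.U) : S.phi x ∈ Icc R.l R.U := by
  have := R.maps_add hx (y := 0) ⟨R.l_nonpos, R.U_nonneg⟩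
  simpa using this

theorem val_mem (t : Gad) : (S.val t).1 ∈ Icc R.l R.U := by
  induction t with
  | leaf => exact R.maps_self ⟨R.l_le_base, R.base_le_U⟩
  | un t ih => exact R.maps_self ih
  | bin s t ih ih' => exact R.maps_add ih ih'

theorem exists_fixed {e : ℝ} (he : e ∈ Icc R.l R.U) : ∃ z ∈ Icc R.l R.U, S.phi (z + e) = z := by
  have hle : R.l ≤ R.U := R.l_nonpos.trans R.U_nonneg
  have hc : ContinuousOn (fun z => S.phi (z + e) - z) (Icc R.l R.U) :=
    ((S.continuous_phi.comp (continuous_id.add continuous_const)).sub continuous_id).continuousOn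
  have h := intermediate_value_Icc' hle hc
  have h0 : (0 : ℝ) ∈ Icc (S.phi (R.U + e) - R.U) (S.phi (R.l + e) - R.l) :=
    ⟨by linarith [(R.maps_add (right_mem_Icc.2 hle) he).2],
      by linarith [(R.maps_add (left_mem_Icc.2 hle) he).1]⟩
  obtain ⟨z, hz, hz'⟩ := h h0
  exact ⟨z, hz, by simpa [sub_eq_zero] using hz'⟩

theorem abs_phi_sub_le {x y : ℝ} (hx : x ∈ Icc (3 * R.l - R.U - 1) (3 * R.U - R.l + 1))
    (hy : y ∈ Icc (3 * R.l - R.U - 1) (3 * R.U - R.l + 1)) :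
    |S.phi x - S.phi y| ≤ R.k₁ * |x - y| :=
  S.abs_phi_sub_le fun u hu => (R.bound u (uIcc_subset_Icc hx hy hu)).2

theorem mem_domain {x y : ℝ} (hx : x ∈ Icc (2 * R.l - R.U - 1) (2 * R.U - R.l + 1))
    (hy : y ∈ Icc R.l R.U) : x + y ∈ Icc (3 * R.l - R.U - 1) (3 * R.U - R.l + 1) :=
  ⟨by linarith [hx.1, hy.1], by linarith [hx.2, hy.2]⟩

theorem mem_wide {x : ℝ} (hx : x ∈ Icc R.l R.U) :
    x ∈ Icc (2 * R.l - R.U - 1) (2 * R.U - R.l + 1) :=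
  ⟨by linarith [hx.1, R.l_nonpos, R.U_nonneg], by linarith [hx.2, R.l_nonpos, R.U_nonneg]⟩

theorem mem_domain_self {x : ℝ} (hx : x ∈ Icc (2 * R.l - R.U - 1) (2 * R.U - R.l + 1)) :
    x ∈ Icc (3 * R.l - R.U - 1) (3 * R.U - R.l + 1) := by
  simpa using R.mem_domain hx (y := 0) ⟨R.l_nonpos, R.U_nonneg⟩

end Region

/-! ### Nets of fields -/

variable (S)

/-- Arbitrarily close to `s` there are finite sets of gadgets whose logarithmic fields span an
interval and leave in it only gaps of at most `q` times its length. -/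
def HasNets (q s : ℝ) : Prop :=
  ∀ δ > 0, ∃ (A : List Gad) (t₀ t₁ : Gad), t₀ ∈ A ∧ t₁ ∈ A ∧ (S.val t₀).1 < (S.val t₁).1 ∧
    (∀ t ∈ A, |(S.val t).1 - s| < δ) ∧
    ∀ x ∈ Icc (S.val t₀).1 (S.val t₁).1, ∃ t ∈ A,
      |x - (S.val t).1| ≤ q * ((S.val t₁).1 - (S.val t₀).1)

variable {S}

theorem exists_hasNets_one (R : S.Region) (hb : S.phi S.base.1 ≠ S.base.1) :
    ∃ s ∈ Icc R.l R.U, S.HasNets 1 s := by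
  obtain ⟨s, hs, hfix⟩ := R.exists_fixed (e := 0) ⟨R.l_nonpos, R.U_nonneg⟩
  rw [add_zero] at hfix
  let p : ℕ → Gad := fun n => Gad.un^[n] .leaf
  have hp : ∀ n, (S.val (p (n + 1))).1 = S.phi (S.val (p n)).1 := by
    intro n
    simp only [p, Function.iterate_succ_apply']
    rfl
  have hne : ∀ n, (S.val (p n)).1 ≠ (S.val (p (n + 1))).1 := by
    intro n
    induction n with
    | zero =>
      rw [hp]
      exact fun h => hb (S.phi_strictAnti.injective h).symm
    | succ n ih =>
      rw [hp, hp (n + 1)]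
      exact fun h => ih (S.phi_strictAnti.injective h)
  have hdist : ∀ n, |(S.val (p n)).1 - s| ≤ R.k₁ ^ n * |(S.val (p 0)).1 - s| := by
    intro n
    induction n with
    | zero => simp
    | succ n ih =>
      rw [hp]
      nth_rewrite 1 [← hfix]
      refine (R.abs_phi_sub_le (R.mem_domain_self (R.mem_wide (R.val_mem _)))
        (R.mem_domain_self (R.mem_wide hs))).trans ?_
      rw [pow_succ']
      nlinarith [R.k₁_pos]
  have hlim : Tendsto (fun n => R.k₁ ^ n * |(S.val (p 0)).1 - s|) atTop (𝓝 0) := by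
    simpa using (tendsto_pow_atTop_nhds_zero_of_lt_one R.k₁_pos.le R.k₁_lt_one).mul_const
      |(S.val (p 0)).1 - s|
  refine ⟨s, hs, fun δ hδ => ?_⟩
  obtain ⟨n, hn⟩ := (eventually_atTop.1 (hlim.eventually_lt_const hδ))
  have h1 := (hdist n).trans_lt (hn n le_rfl)
  have h2 := (hdist (n + 1)).trans_lt (hn (n + 1) (Nat.le_succ n))
  have key : ∀ t t', |(S.val t).1 - s| < δ → |(S.val t').1 - s| < δ →
      (S.val t).1 < (S.val t').1 →
      ∃ (A : List Gad) (t₀ t₁ : Gad), t₀ ∈ A ∧ t₁ ∈ A ∧ (S.val t₀).1 < (S.val t₁).1 ∧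
        (∀ t ∈ A, |(S.val t).1 - s| < δ) ∧ ∀ x ∈ Icc (S.val t₀).1 (S.val t₁).1, ∃ t ∈ A,
          |x - (S.val t).1| ≤ 1 * ((S.val t₁).1 - (S.val t₀).1) := by
    intro t t' ht ht' hlt
    refine ⟨[t, t'], t, t', by simp, by simp, hlt, by simp [ht, ht'], fun x hx =>
      ⟨t, by simp, ?_⟩⟩
    rw [abs_of_nonneg (sub_nonneg.2 hx.1), one_mul]
    linarith [hx.2]
  rcases lt_or_gt_of_ne (hne n) with h | h
  · exact key _ _ h1 h2 h
  · exact key _ _ h2 h1 h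

theorem HasNets.step {q s : ℝ} (hq : 0 ≤ q) (h : S.HasNets q s) :
    S.HasNets (3 / 4 * q) (S.phi (2 * s)) := by
  intro δ hδ
  set d := -S.dphi (2 * s) with hd
  have hdpos : 0 < d := neg_pos.2 (S.dphi_neg _)
  obtain ⟨η, hη, hηd⟩ := Metric.continuousAt_iff.1
    (S.contDiff_dphi.continuous.continuousAt (x := 2 * s)) (d / 5) (by positivity)
  obtain ⟨A, t₀, t₁, h0, h1, hlt, hclose, hnet⟩ := h (min (η / 2) (δ / 2)) (by positivity)
  set lo := (S.val t₀).1
  set hi := (S.val t₁).1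
  have hA : ∀ t ∈ A, |(S.val t).1 - s| < η / 2 ∧ |(S.val t).1 - s| < δ / 2 := fun t ht =>
    lt_min_iff.1 (hclose t ht)
  have hbound : ∀ u ∈ Icc (2 * lo) (2 * hi), 4 / 5 * d ≤ -S.dphi u ∧ -S.dphi u ≤ 6 / 5 * d := by
    intro u hu
    have e0 := abs_lt.1 (hA t₀ h0).1
    have e1 := abs_lt.1 (hA t₁ h1).1
    have : dist u (2 * s) < η := by
      rw [Real.dist_eq, abs_lt]
      constructor <;> linarith [hu.1, hu.2]
    have := hηd this
    rw [Real.dist_eq, abs_lt] at this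
    constructor <;> linarith
  refine ⟨A.map (Gad.bin t₀) ++ A.map (Gad.bin t₁), .bin t₁ t₁, .bin t₀ t₀, ?_, ?_, ?_, ?_, ?_⟩
  · simp [h1]
  · simp [h0]
  · change S.phi (hi + hi) < S.phi (lo + lo)
    exact S.phi_strictAnti (by linarith)
  · intro t ht
    have : ∃ x ∈ A, ∃ y ∈ A, t = .bin x y := by
      rw [List.mem_append, List.mem_map, List.mem_map] at ht
      rcases ht with ⟨y, hy, rfl⟩ | ⟨y, hy, rfl⟩
      · exact ⟨t₀, h0, y, hy, rfl⟩
      · exact ⟨t₁, h1, y, hy, rfl⟩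
    obtain ⟨x, hx, y, hy, rfl⟩ := this
    change |S.phi ((S.val x).1 + (S.val y).1) - S.phi (2 * s)| < δ
    refine (S.abs_phi_sub_le_abs_sub _ _).trans_lt ?_
    have e0 := abs_lt.1 (hA x hx).2
    have e1 := abs_lt.1 (hA y hy).2
    rw [abs_lt]
    constructor <;> linarith
  · change ∀ x ∈ Icc (S.phi (hi + hi)) (S.phi (lo + lo)), ∃ t ∈ _, |x - (S.val t).1| ≤
      3 / 4 * q * (S.phi (lo + lo) - S.phi (hi + hi))
    rw [← two_mul, ← two_mul]
    intro x hx
    have hle : 2 * lo ≤ 2 * hi := by linarith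
    obtain ⟨v, hv, rfl⟩ := intermediate_value_Icc' hle S.continuous_phi.continuousOn hx
    have hspan := (S.phi_sub_phi_mem hle hbound).1
    obtain ⟨r, hr, y, hy, hyr⟩ : ∃ r, (r = t₀ ∨ r = t₁) ∧ ∃ y ∈ A,
        |v - ((S.val r).1 + (S.val y).1)| ≤ q * (hi - lo) := by
      rcases le_total v (lo + hi) with hle' | hle'
      · obtain ⟨y, hy, hyv⟩ := hnet (v - lo) ⟨by linarith [hv.1], by linarith⟩
        refine ⟨t₀, Or.inl rfl, y, hy, ?_⟩
        rwa [← sub_sub]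
      · obtain ⟨y, hy, hyv⟩ := hnet (v - hi) ⟨by linarith, by linarith [hv.2]⟩
        refine ⟨t₁, Or.inr rfl, y, hy, ?_⟩
        rwa [← sub_sub]
    refine ⟨.bin r y, ?_, ?_⟩
    · rcases hr with rfl | rfl <;> simp [hy]
    · change |S.phi v - S.phi ((S.val r).1 + (S.val y).1)| ≤ _
      have hsum : |S.phi v - S.phi ((S.val r).1 + (S.val y).1)| ≤
          6 / 5 * d * |v - ((S.val r).1 + (S.val y).1)| := by
        refine S.abs_phi_sub_le fun u hu => ?_
        have hrA : r ∈ A := by rcases hr with rfl | rfl <;> assumption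
        have e0 := abs_lt.1 (hA r hrA).1
        have e1 := abs_lt.1 (hA y hy).1
        have e2 := abs_lt.1 (hA t₀ h0).1
        have e3 := abs_lt.1 (hA t₁ h1).1
        have hu' : u ∈ Ioo (2 * s - η) (2 * s + η) := by
          refine (ordConnected_Ioo.uIcc_subset ?_ ?_) hu
          · exact ⟨by linarith [hv.1], by linarith [hv.2]⟩
          · exact ⟨by linarith, by linarith⟩
        have : dist u (2 * s) < η := by
          rw [Real.dist_eq, abs_lt]
          constructor <;> linarith [hu'.1, hu'.2]
        have := hηd this
        rw [Real.dist_eq, abs_lt] at this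
        linarith
      calc _ ≤ 6 / 5 * d * |v - ((S.val r).1 + (S.val y).1)| := hsum
        _ ≤ 6 / 5 * d * (q * (hi - lo)) := by gcongr
        _ = 3 / 4 * q * (4 / 5 * d * (2 * hi - 2 * lo)) := by ring
        _ ≤ _ := by gcongr

theorem exists_hasNets (R : S.Region) (hb : S.phi S.base.1 ≠ S.base.1) {q : ℝ} (hq : 0 < q) :
    ∃ s, S.HasNets q s := by
  have h : ∀ n : ℕ, ∃ s, S.HasNets ((3 / 4) ^ n) s := by
    intro n
    induction n with
    | zero =>
      obtain ⟨s, -, hs⟩ := exists_hasNets_one R hb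
      exact ⟨s, by simpa using hs⟩
    | succ n ih =>
      obtain ⟨s, hs⟩ := ih
      exact ⟨_, by rw [pow_succ']; exact hs.step (by positivity)⟩
  obtain ⟨n, hn⟩ := exists_pow_lt_of_lt_one hq (by norm_num : (3 / 4 : ℝ) < 1)
  obtain ⟨s, hs⟩ := h n
  refine ⟨s, fun δ hδ => ?_⟩
  obtain ⟨A, t₀, t₁, h0, h1, hlt, hclose, hnet⟩ := hs δ hδ
  refine ⟨A, t₀, t₁, h0, h1, hlt, hclose, fun x hx => ?_⟩
  obtain ⟨t, ht, hle⟩ := hnet x hx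
  exact ⟨t, ht, hle.trans (mul_le_mul_of_nonneg_right hn.le (by linarith))⟩

/-- The maps `x ↦ phi (x + u)`, for the logarithmic fields `u` of the gadgets in `A`, cover the
interval `[z - h, z + h]` by images of `[z - h / 2, z + h / 2]`. -/
structure Cover (R : S.Region) where
  A : List Gad
  z : ℝ
  h : ℝ
  h_pos : 0 < h
  lower : 2 * R.l - R.U ≤ z - h
  upper : z + h ≤ 2 * R.U - R.l
  covers : ∀ t ∈ Icc (z - h) (z + h), ∃ e ∈ A, ∃ y, S.phi y = t ∧ |y - (S.val e).1 - z| ≤ h / 2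

theorem nonempty_cover (R : S.Region) (hb : S.phi S.base.1 ≠ S.base.1) : Nonempty (Cover R) := by
  obtain ⟨s, hs⟩ := exists_hasNets R hb (q := R.k₀ / 4) (by linarith [R.k₀_pos])
  obtain ⟨A, t₀, t₁, h0, h1, hlt, -, hnet⟩ := hs 1 one_pos
  have m0 := R.val_mem t₀
  have m1 := R.val_mem t₁
  set lo := (S.val t₀).1
  set hi := (S.val t₁).1
  obtain ⟨z, hz, hfix⟩ := R.exists_fixed (e := (lo + hi) / 2)
    ⟨by linarith [m0.1, m1.1], by linarith [m0.2, m1.2]⟩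
  have hk := R.k₀_pos
  have hk1 : R.k₀ ≤ 1 := by
    have h := R.bound 0
      ⟨by linarith [R.l_nonpos, R.U_nonneg], by linarith [R.l_nonpos, R.U_nonneg]⟩
    linarith [R.k₁_lt_one]
  have hh : R.k₀ * (hi - lo) / 2 ≤ (hi - lo) / 2 := by nlinarith
  refine ⟨⟨A, z, R.k₀ * (hi - lo) / 2, by nlinarith, ?_, ?_, fun t ht => ?_⟩⟩
  · linarith [hz.1, hz.2, m0.1, m0.2, m1.1, m1.2]
  · linarith [hz.1, hz.2, m0.1, m0.2, m1.1, m1.2]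
  · have hdom : ∀ u ∈ Icc (z + lo) (z + hi), u ∈ Icc (3 * R.l - R.U - 1) (3 * R.U - R.l + 1) :=
      fun u hu => ⟨by linarith [hu.1, hz.1, m0.1, R.l_nonpos, R.U_nonneg],
        by linarith [hu.2, hz.2, m1.2, R.l_nonpos, R.U_nonneg]⟩
    have e1 := (S.phi_sub_phi_mem (x := z + lo) (y := z + (lo + hi) / 2) (by linarith)
      fun u hu => R.bound u (hdom u ⟨hu.1, by linarith [hu.2]⟩)).1
    have e2 := (S.phi_sub_phi_mem (x := z + (lo + hi) / 2) (y := z + hi) (by linarith)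
      fun u hu => R.bound u (hdom u ⟨by linarith [hu.1], hu.2⟩)).1
    rw [hfix] at e1 e2
    obtain ⟨y, hy, hyt⟩ := intermediate_value_Icc' (show z + lo ≤ z + hi by linarith)
      S.continuous_phi.continuousOn
      (show t ∈ Icc (S.phi (z + hi)) (S.phi (z + lo)) from
        ⟨by linarith [ht.1], by linarith [ht.2]⟩)
    obtain ⟨e, he, hle⟩ := hnet (y - z) ⟨by linarith [hy.1], by linarith [hy.2]⟩
    refine ⟨e, he, y, hyt, ?_⟩
    rw [sub_right_comm]
    linarith

end TwoSpin

section

/-! ### The gap is not a function of the field -/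

open Set Filter Topology

/-- A bounded function on an interval with the midpoint property is affine. -/
theorem eq_affine_of_midpoint {h : ℝ → ℝ} {p q M : ℝ} (hpq : p < q)
    (hM : ∀ x ∈ Icc p q, |h x| ≤ M)
    (hmid : ∀ x ∈ Icc p q, ∀ y ∈ Icc p q, h x + h y = 2 * h ((x + y) / 2)) :
    ∀ x ∈ Icc p q, h x = h p + (x - p) * ((h q - h p) / (q - p)) := by
  have hpq' := sub_pos.2 hpq
  set g : ℝ → ℝ := fun x => h x - (h p + (x - p) * ((h q - h p) / (q - p))) with hg
  have hgp : g p = 0 := by simp [hg]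
  have hgq : g q = 0 := by
    simp only [hg]
    field_simp
    ring
  have hgmid : ∀ x ∈ Icc p q, ∀ y ∈ Icc p q, g x + g y = 2 * g ((x + y) / 2) := by
    intro x hx y hy
    have := hmid x hx y hy
    simp only [hg]
    linear_combination this
  have hstep : ∀ B, (∀ x ∈ Icc p q, |g x| ≤ B) → ∀ x ∈ Icc p q, |g x| ≤ B / 2 := by
    intro B hB x hx
    rcases le_total x ((p + q) / 2) with hle | hle
    · have hy : 2 * x - p ∈ Icc p q := ⟨by linarith [hx.1], by linarith⟩
      have h1 := hgmid p (left_mem_Icc.2 hpq.le) _ hy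
      rw [hgp, show (p + (2 * x - p)) / 2 = x by ring, zero_add] at h1
      have h2 := hB _ hy
      rw [h1, abs_mul, abs_two] at h2
      linarith
    · have hy : 2 * x - q ∈ Icc p q := ⟨by linarith, by linarith [hx.2]⟩
      have h1 := hgmid q (right_mem_Icc.2 hpq.le) _ hy
      rw [hgq, show (q + (2 * x - q)) / 2 = x by ring, zero_add] at h1
      have h2 := hB _ hy
      rw [h1, abs_mul, abs_two] at h2
      linarith
  obtain ⟨B, hB⟩ : ∃ B, ∀ x ∈ Icc p q, |g x| ≤ B := by
    refine ⟨M + (|h p| + (q - p) * |(h q - h p) / (q - p)|), fun x hx => ?_⟩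
    refine (abs_sub _ _).trans (add_le_add (hM x hx) ((abs_add_le _ _).trans ?_))
    rw [abs_mul, abs_of_nonneg (sub_nonneg.2 hx.1)]
    gcongr
    exact hx.2
  have hall : ∀ n : ℕ, ∀ x ∈ Icc p q, |g x| ≤ B * (1 / 2) ^ n := by
    intro n
    induction n with
    | zero => simpa using hB
    | succ n ih =>
      intro x hx
      have := hstep _ ih x hx
      rw [pow_succ]
      linarith
  intro x hx
  have hlim : Tendsto (fun n : ℕ => B * (1 / 2 : ℝ) ^ n) atTop (𝓝 0) := by
    simpa using (tendsto_pow_atTop_nhds_zero_of_lt_one (by norm_num : (0 : ℝ) ≤ 1 / 2)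
      (by norm_num)).const_mul B
  have h0 : |g x| ≤ 0 := ge_of_tendsto' hlim fun n => hall n x hx
  have := abs_nonpos_iff.1 h0
  simp only [hg] at this
  linarith

namespace TwoSpin

variable (S : TwoSpin)

/-- The functional equation for a gap which is an affine function of the logarithmic field. -/
def AffineEq (A B A' B' x : ℝ) : Prop :=
  S.dphi x * (A + B * x + S.a) + S.eps x = A' + B' * S.phi x

variable {S}

theorem affineEq_of_interval {A B A' B' p q : ℝ} (hpq : p < q)
    (h : ∀ x ∈ Icc p q, S.AffineEq A B A' B' x) (x : ℝ) : S.AffineEq A B A' B' x := by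
  have hact : AnalyticOnNhd ℝ S.act univ := by
    unfold act
    exact analyticOnNhd_const.mul analyticOnNhd_rexp
  have hnum : AnalyticOnNhd ℝ (fun x => 1 + S.γ * S.act x) univ :=
    analyticOnNhd_const.add (analyticOnNhd_const.mul hact)
  have hden : AnalyticOnNhd ℝ (fun x => S.β + S.act x) univ := analyticOnNhd_const.add hact
  have hid : AnalyticOnNhd ℝ (fun x : ℝ => x) univ := analyticOnNhd_id
  have hdphi : AnalyticOnNhd ℝ S.dphi univ :=
    ((analyticOnNhd_const.mul hact).div (hden.mul hnum)
      fun x _ => (mul_pos (S.den_pos x) (S.num_pos x)).ne').neg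
  have heps : AnalyticOnNhd ℝ S.eps univ :=
    (analyticOnNhd_const.div hden fun x _ => (S.den_pos x).ne').add
      ((analyticOnNhd_const.mul hact).div hnum fun x _ => (S.num_pos x).ne')
  have hphi : AnalyticOnNhd ℝ S.phi univ := by
    have : S.phi = fun x => Real.log (1 + S.γ * S.act x) - Real.log (S.β + S.act x) :=
      funext S.phi_eq
    rw [this]
    exact (hnum.log fun x _ => S.num_pos x).sub (hden.log fun x _ => S.den_pos x)
  have hl : AnalyticOnNhd ℝ (fun x => S.dphi x * (A + B * x + S.a) + S.eps x) univ :=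
    (hdphi.mul ((analyticOnNhd_const.add (analyticOnNhd_const.mul hid)).add
      analyticOnNhd_const)).add heps
  have hr : AnalyticOnNhd ℝ (fun x => A' + B' * S.phi x) univ :=
    analyticOnNhd_const.add (analyticOnNhd_const.mul hphi)
  have hev : (fun x => S.dphi x * (A + B * x + S.a) + S.eps x) =ᶠ[𝓝 ((p + q) / 2)]
      fun x => A' + B' * S.phi x := by
    filter_upwards [Icc_mem_nhds (show p < (p + q) / 2 by linarith)
      (show (p + q) / 2 < q by linarith)] with x hx
    exact h x hx
  exact congrFun (hl.eq_of_eventuallyEq hr hev) x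

theorem slope_eq_zero_aux (hβ : 0 < S.β) {A B A' B' : ℝ}
    (h : ∀ x, S.AffineEq A B A' B' x) : B = 0 := by
  set Θ : ℝ → ℝ := fun y => A' + B' * (Real.log (1 + S.γ * y) - Real.log (S.β + y)) +
    S.b * S.β / (S.β + y) - S.c * S.γ * y / (1 + S.γ * y) with hΘ
  have hlam := S.lam_pos
  have hone := S.one_sub_pos
  have hkey : ∀ y, 0 < y → Θ y * ((S.β + y) * (1 + S.γ * y)) =
      -(1 - S.β * S.γ) * (y * (A + S.a + B * (Real.log y - Real.log S.lam))) := by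
    intro y hy
    have hx := h (Real.log y - Real.log S.lam)
    have hact : S.act (Real.log y - Real.log S.lam) = y := by
      rw [act, Real.exp_sub, Real.exp_log hy, Real.exp_log hlam]
      field_simp
    have h1 := S.num_pos (Real.log y - Real.log S.lam)
    have h2 := S.den_pos (Real.log y - Real.log S.lam)
    unfold AffineEq at hx
    rw [phi_eq, dphi, eps] at hx
    rw [hact] at hx h1 h2
    have : Θ y = -((1 - S.β * S.γ) * y / ((S.β + y) * (1 + S.γ * y))) *
        (A + B * (Real.log y - Real.log S.lam) + S.a) := by
      simp only [hΘ]
      have e : -S.b * S.β / (S.β + y) = -(S.b * S.β / (S.β + y)) := by ring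
      rw [e] at hx
      linarith
    rw [this]
    field_simp
    ring
  have hdiff : DifferentiableAt ℝ Θ 0 := by
    have h1 : (1 + S.γ * (0 : ℝ)) ≠ 0 := by simp
    have h2 : (S.β + (0 : ℝ)) ≠ 0 := by simpa using hβ.ne'
    simp only [hΘ]
    fun_prop (disch := assumption)
  have hlog : Tendsto (fun y : ℝ => y * (A + S.a + B * (Real.log y - Real.log S.lam)))
      (𝓝[>] 0) (𝓝 0) := by
    have e1 : Tendsto (fun y : ℝ => y * Real.log y) (𝓝[>] 0) (𝓝 0) := by
      have := Real.continuous_mul_log.tendsto 0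
      simp only [zero_mul] at this
      exact this.mono_left nhdsWithin_le_nhds
    have e2 : Tendsto (fun y : ℝ => y) (𝓝[>] 0) (𝓝 0) := nhdsWithin_le_nhds
    have := (e2.mul_const (A + S.a - B * Real.log S.lam)).add (e1.const_mul B)
    simp only [zero_mul, mul_zero, add_zero] at this
    refine this.congr fun y => ?_
    ring
  have hΘ0 : Θ 0 = 0 := by
    have e1 : Tendsto (fun y => Θ y * ((S.β + y) * (1 + S.γ * y))) (𝓝[>] 0)
        (𝓝 (Θ 0 * ((S.β + 0) * (1 + S.γ * 0)))) := by
      have : ContinuousAt (fun y => Θ y * ((S.β + y) * (1 + S.γ * y))) 0 :=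
        hdiff.continuousAt.mul (by fun_prop)
      exact this.tendsto.mono_left nhdsWithin_le_nhds
    have e2 : Tendsto (fun y => Θ y * ((S.β + y) * (1 + S.γ * y))) (𝓝[>] 0) (𝓝 0) := by
      have := hlog.const_mul (-(1 - S.β * S.γ))
      rw [mul_zero] at this
      refine this.congr' ?_
      filter_upwards [self_mem_nhdsWithin] with y hy
      exact (hkey y hy).symm
    have := tendsto_nhds_unique e1 e2
    simpa [hβ.ne'] using this
  have hslope : Tendsto (fun y => y⁻¹ * Θ y * ((S.β + y) * (1 + S.γ * y))) (𝓝[>] 0)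
      (𝓝 (deriv Θ 0 * ((S.β + 0) * (1 + S.γ * 0)))) := by
    have e1 := hdiff.hasDerivAt.tendsto_slope_zero_right
    simp only [zero_add, hΘ0, sub_zero, smul_eq_mul] at e1
    refine e1.mul ?_
    have : ContinuousAt (fun y => (S.β + y) * (1 + S.γ * y)) 0 := by fun_prop
    exact this.tendsto.mono_left nhdsWithin_le_nhds
  by_contra hB
  have hfin : Tendsto (fun y : ℝ => Real.log y) (𝓝[>] 0)
      (𝓝 ((deriv Θ 0 * ((S.β + 0) * (1 + S.γ * 0)) / (-(1 - S.β * S.γ)) - (A + S.a)) / B +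
        Real.log S.lam)) := by
    refine ((((hslope.div_const (-(1 - S.β * S.γ))).sub_const (A + S.a)).div_const B).add_const
      (Real.log S.lam)).congr' ?_
    filter_upwards [self_mem_nhdsWithin] with y hy
    have hy' : (y : ℝ) ≠ 0 := (show (0 : ℝ) < y from hy).ne'
    rw [mul_assoc, hkey y hy]
    have := hone.ne'
    have h3 : -(1 - S.β * S.γ) ≠ 0 := neg_ne_zero.2 this
    field_simp
    ring
  exact not_tendsto_nhds_of_tendsto_atBot Real.tendsto_log_nhdsGT_zero _ hfin

variable (S) in
/-- The system with the two spins exchanged. -/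
noncomputable def swap : TwoSpin where
  β := S.γ
  γ := S.β
  lam := S.lam⁻¹
  a := S.a
  b := -S.c
  c := -S.b
  base := S.base
  β_nonneg := S.γ_nonneg
  γ_nonneg := S.β_nonneg
  mul_lt_one := by rw [mul_comm]; exact S.mul_lt_one
  ne_zero := S.ne_zero.symm
  lam_pos := inv_pos.2 S.lam_pos

theorem swap_act (x : ℝ) : S.swap.act (-x) = (S.act x)⁻¹ := by
  simp [act, swap, Real.exp_neg, mul_comm]

theorem swap_dphi (x : ℝ) : S.swap.dphi (-x) = S.dphi x := by
  have h1 := S.num_pos x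
  have h2 := S.den_pos x
  have h3 := S.act_pos x
  have h1' := S.swap.num_pos (-x)
  have h2' := S.swap.den_pos (-x)
  rw [swap_act] at h1' h2'
  change 0 < 1 + S.β * (S.act x)⁻¹ at h1'
  change 0 < S.γ + (S.act x)⁻¹ at h2'
  rw [dphi, swap_act, dphi]
  change -((1 - S.γ * S.β) * (S.act x)⁻¹ /
    ((S.γ + (S.act x)⁻¹) * (1 + S.β * (S.act x)⁻¹))) = _
  have e1 : S.γ + (S.act x)⁻¹ = (1 + S.γ * S.act x) / S.act x := by field_simp; ring
  have e2 : 1 + S.β * (S.act x)⁻¹ = (S.β + S.act x) / S.act x := by field_simp; ring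
  rw [e1, e2]
  field_simp

theorem swap_eps (x : ℝ) : S.swap.eps (-x) = S.eps x := by
  have h1 := S.num_pos x
  have h2 := S.den_pos x
  have h3 := S.act_pos x
  have h1' := S.swap.num_pos (-x)
  have h2' := S.swap.den_pos (-x)
  rw [swap_act] at h1' h2'
  change 0 < 1 + S.β * (S.act x)⁻¹ at h1'
  change 0 < S.γ + (S.act x)⁻¹ at h2'
  rw [eps, swap_act, eps]
  change -(-S.c) * S.γ / (S.γ + (S.act x)⁻¹) + -S.b * S.β * (S.act x)⁻¹ /
    (1 + S.β * (S.act x)⁻¹) = _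
  have e1 : S.γ + (S.act x)⁻¹ = (1 + S.γ * S.act x) / S.act x := by field_simp; ring
  have e2 : 1 + S.β * (S.act x)⁻¹ = (S.β + S.act x) / S.act x := by field_simp; ring
  rw [e1, e2]
  field_simp
  ring

theorem swap_phi (x : ℝ) : S.swap.phi (-x) = -S.phi x := by
  have h1 := S.num_pos x
  have h2 := S.den_pos x
  have h3 := S.act_pos x
  rw [phi, swap_act, phi, ← Real.log_inv]
  change Real.log ((1 + S.β * (S.act x)⁻¹) / (S.γ + (S.act x)⁻¹)) = _
  have e1 : S.γ + (S.act x)⁻¹ = (1 + S.γ * S.act x) / S.act x := by field_simp; ring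
  have e2 : 1 + S.β * (S.act x)⁻¹ = (S.β + S.act x) / S.act x := by field_simp; ring
  rw [e1, e2]
  congr 1
  field_simp

theorem slope_eq_zero {A B A' B' : ℝ} (h : ∀ x, S.AffineEq A B A' B' x) : B = 0 := by
  rcases S.ne_zero with hβ | hγ
  · exact slope_eq_zero_aux (lt_of_le_of_ne S.β_nonneg (Ne.symm hβ)) h
  · have : ∀ x, S.swap.AffineEq A (-B) A' (-B') x := by
      intro x
      have hx := h (-x)
      have e1 := S.swap_dphi (-x)
      have e2 := S.swap_eps (-x)
      have e3 := S.swap_phi (-x)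
      rw [neg_neg] at e1 e2 e3
      unfold AffineEq at hx ⊢
      rw [e1, e2, e3]
      change S.dphi (-x) * (A + -B * x + S.a) + _ = _
      linear_combination hx
    have := slope_eq_zero_aux (S := S.swap) (lt_of_le_of_ne S.γ_nonneg (Ne.symm hγ)) this
    linarith

theorem const_eq {A A' : ℝ} (h : ∀ x, S.AffineEq A 0 A' 0 x) :
    A' = -(A + S.a) ∧ (0 < S.β → A' = -S.b) ∧ (0 < S.γ → A' = S.c) := by
  have hlam := S.lam_pos
  have key : ∀ y, 0 < y → -(1 - S.β * S.γ) * y * (A + S.a) - S.b * S.β * (1 + S.γ * y) +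
      S.c * S.γ * y * (S.β + y) = A' * ((S.β + y) * (1 + S.γ * y)) := by
    intro y hy
    have hx := h (Real.log y - Real.log S.lam)
    have hact : S.act (Real.log y - Real.log S.lam) = y := by
      rw [act, Real.exp_sub, Real.exp_log hy, Real.exp_log hlam]
      field_simp
    have h1 := S.num_pos (Real.log y - Real.log S.lam)
    have h2 := S.den_pos (Real.log y - Real.log S.lam)
    unfold AffineEq at hx
    rw [dphi, eps] at hx
    rw [hact] at hx h1 h2
    simp only [zero_mul, add_zero] at hx
    rw [← hx]
    field_simp
    ring
  have k1 := key 1 one_pos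
  have k2 := key 2 two_pos
  have k3 := key 3 three_pos
  have c0 : S.β * (A' + S.b) = 0 := by linear_combination (-3) * k1 + 3 * k2 - k3
  have c2 : S.γ * (A' - S.c) = 0 := by
    linear_combination (-(1 : ℝ) / 2) * k1 + k2 - (1 / 2 : ℝ) * k3
  have c1 : (1 - S.β * S.γ) * (A + S.a) + S.b * S.β * S.γ - S.c * S.γ * S.β +
      A' * (1 + S.β * S.γ) = 0 := by
    linear_combination (5 / 2 : ℝ) * k1 - 4 * k2 + (3 / 2 : ℝ) * k3
  have d1 : (1 - S.β * S.γ) * (A' + (A + S.a)) = 0 := by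
    linear_combination c1 - S.γ * c0 - S.β * c2
  have hone := S.one_sub_pos
  refine ⟨?_, fun hβ => ?_, fun hγ => ?_⟩
  · rcases mul_eq_zero.1 d1 with h | h <;> linarith
  · rcases mul_eq_zero.1 c0 with h | h <;> linarith
  · rcases mul_eq_zero.1 c2 with h | h <;> linarith

variable (S)

/-- The closure of the set of the pairs of logarithmic field and gap of gadgets. -/
def limitSet : Set (ℝ × ℝ) := closure (range S.val)

variable {S}

theorem step_mem_limitSet {p : ℝ × ℝ} (hp : p ∈ S.limitSet) : S.step p ∈ S.limitSet := by
  refine map_mem_closure S.continuous_step hp ?_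
  rintro _ ⟨t, rfl⟩
  exact ⟨.un t, rfl⟩

theorem step_add_mem_limitSet {p q : ℝ × ℝ} (hp : p ∈ S.limitSet) (hq : q ∈ S.limitSet) :
    S.step (p + q) ∈ S.limitSet := by
  refine map_mem_closure₂ (f := fun p q => S.step (p + q))
    (S.continuous_step.comp continuous_add) hp hq ?_
  rintro _ ⟨t, rfl⟩ _ ⟨t', rfl⟩
  exact ⟨.bin t t', rfl⟩

variable (S)

/-- On the interval `[p, q]` the pairs `(x, A + B x)` are limits of pairs of gadgets. -/
def Attained (p q A B : ℝ) : Prop := ∀ x ∈ Icc p q, ((x, A + B * x) : ℝ × ℝ) ∈ S.limitSet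

variable {S}

theorem exists_attained
    (hfun : ∀ u o o', ((u, o) : ℝ × ℝ) ∈ S.limitSet → ((u, o') : ℝ × ℝ) ∈ S.limitSet → o = o')
    {p q M : ℝ} (hpq : p < q)
    (h : ∀ x ∈ Icc p q, ∃ o, |o| ≤ M ∧ ((x, o) : ℝ × ℝ) ∈ S.limitSet) :
    ∃ A B, S.Attained p q A B := by
  choose! g hg using h
  have hmid : ∀ x ∈ Icc p q, ∀ y ∈ Icc p q, g x + g y = 2 * g ((x + y) / 2) := by
    intro x hx y hy
    have hm : (x + y) / 2 ∈ Icc p q := ⟨by linarith [hx.1, hy.1], by linarith [hx.2, hy.2]⟩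
    have h1 := step_add_mem_limitSet (hg x hx).2 (hg y hy).2
    have h2 := step_add_mem_limitSet (hg _ hm).2 (hg _ hm).2
    have e1 : ((x, g x) + (y, g y) : ℝ × ℝ) = (x + y, g x + g y) := rfl
    have e2 : (((x + y) / 2, g ((x + y) / 2)) + ((x + y) / 2, g ((x + y) / 2)) : ℝ × ℝ) =
        (x + y, 2 * g ((x + y) / 2)) := by
      ext
      · simp
      · simp [two_mul]
    rw [e1] at h1
    rw [e2] at h2
    have := hfun _ _ _ h1 h2
    have hd := (S.dphi_neg (x + y)).ne
    have h3 : S.dphi (x + y) * (g x + g y - 2 * g ((x + y) / 2)) = 0 := by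
      linear_combination this
    rcases mul_eq_zero.1 h3 with h3 | h3
    · exact absurd h3 hd
    · linarith
  have haff := eq_affine_of_midpoint hpq (fun x hx => (hg x hx).1) hmid
  refine ⟨g p - p * ((g q - g p) / (q - p)), (g q - g p) / (q - p), fun x hx => ?_⟩
  have := (hg x hx).2
  rw [haff x hx] at this
  convert this using 2
  ring

theorem exists_image
    (hfun : ∀ u o o', ((u, o) : ℝ × ℝ) ∈ S.limitSet → ((u, o') : ℝ × ℝ) ∈ S.limitSet → o = o')
    {p q A B : ℝ} (hpq : p < q)
    (h : ∀ x ∈ Icc p q, S.step (x, A + B * x) ∈ S.limitSet) :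
    ∃ A' B', S.Attained (S.phi q) (S.phi p) A' B' ∧ ∀ x, S.AffineEq A B A' B' x := by
  have hlt : S.phi q < S.phi p := S.phi_strictAnti hpq
  have hcont : ContinuousOn (fun x => (S.step (x, A + B * x)).2) (Icc p q) :=
    (continuous_snd.comp (S.continuous_step.comp (by fun_prop))).continuousOn
  obtain ⟨M, hM⟩ := isCompact_Icc.exists_bound_of_continuousOn hcont
  have hphi : ∀ v ∈ Icc (S.phi q) (S.phi p), ∃ x ∈ Icc p q, S.phi x = v := fun v hv =>
    intermediate_value_Icc' hpq.le S.continuous_phi.continuousOn hv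
  obtain ⟨A', B', hatt⟩ := exists_attained hfun hlt (M := M) (by
    intro v hv
    obtain ⟨x, hx, rfl⟩ := hphi v hv
    exact ⟨_, hM x hx, h x hx⟩)
  refine ⟨A', B', hatt, affineEq_of_interval hpq fun x hx => ?_⟩
  exact hfun _ _ _ (h x hx) (hatt _ ⟨S.phi_strictAnti.antitone hx.2, S.phi_strictAnti.antitone hx.1⟩)

/-- The observable is zero on all the gadgets. -/
def IsTrivial (S : TwoSpin) : Prop :=
  S.a = 0 ∧ (S.β = 0 ∨ S.b = 0) ∧ (S.γ = 0 ∨ S.c = 0)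

theorem isTrivial_of_functional
    (hfun : ∀ u o o', ((u, o) : ℝ × ℝ) ∈ S.limitSet → ((u, o') : ℝ × ℝ) ∈ S.limitSet → o = o')
    {p q M : ℝ} (hpq : p < q)
    (h : ∀ x ∈ Icc p q, ∃ o, |o| ≤ M ∧ ((x, o) : ℝ × ℝ) ∈ S.limitSet) : S.IsTrivial := by
  have himg : ∀ {p q A B : ℝ}, p < q → S.Attained p q A B →
      B = 0 ∧ ∃ A' B', S.Attained (S.phi q) (S.phi p) A' B' ∧ ∀ x, S.AffineEq A B A' B' x := by
    intro p q A B hpq h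
    obtain ⟨A', B', h1, h2⟩ := exists_image hfun hpq fun x hx => step_mem_limitSet (h x hx)
    exact ⟨slope_eq_zero h2, A', B', h1, h2⟩
  obtain ⟨A₀, B₀, h₀⟩ := exists_attained hfun hpq h
  obtain ⟨rfl, A₁, B₁, h₁, e₁⟩ := himg hpq h₀
  obtain ⟨rfl, A₂, B₂, h₂, e₂⟩ := himg (S.phi_strictAnti hpq) h₁
  obtain ⟨rfl, -⟩ := himg (S.phi_strictAnti (S.phi_strictAnti hpq)) h₂
  obtain ⟨A₃, B₃, h₃, e₃⟩ := exists_image hfun (p := 2 * p) (q := 2 * q) (A := 2 * A₀) (B := 0)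
    (by linarith) (by
      intro x hx
      have hx' : x / 2 ∈ Icc p q := ⟨by linarith [hx.1], by linarith [hx.2]⟩
      have := step_add_mem_limitSet (h₀ _ hx') (h₀ _ hx')
      convert this using 2
      ext
      · simp
      · simp [two_mul])
  obtain ⟨rfl, -⟩ := himg (S.phi_strictAnti (show 2 * p < 2 * q by linarith)) h₃
  obtain ⟨a1, b1, c1⟩ := const_eq e₁
  obtain ⟨a2, b2, c2⟩ := const_eq e₂
  obtain ⟨a3, b3, c3⟩ := const_eq e₃
  have hβ : S.β = 0 ∨ 0 < S.β := S.β_nonneg.eq_or_lt.imp_left Eq.symm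
  have hγ : S.γ = 0 ∨ 0 < S.γ := S.γ_nonneg.eq_or_lt.imp_left Eq.symm
  have hA : A₁ = A₂ ∧ A₂ = A₃ := by
    rcases S.ne_zero with h | h
    · have := hβ.resolve_left h
      exact ⟨(b1 this).trans (b2 this).symm, (b2 this).trans (b3 this).symm⟩
    · have := hγ.resolve_left h
      exact ⟨(c1 this).trans (c2 this).symm, (c2 this).trans (c3 this).symm⟩
  refine ⟨by linarith [hA.1, hA.2], hβ.imp_right fun h => ?_, hγ.imp_right fun h => ?_⟩
  · linarith [b1 h, hA.1, hA.2]
  · linarith [c1 h, hA.1, hA.2]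

end TwoSpin

end

section

/-! ### Chains of gadgets -/

open Set Filter Topology

/-- The chain with the gadgets of `w` attached along a path which ends in `t`. -/
def Gad.chain (w : List Gad) (t : Gad) : Gad := w.foldr Gad.bin t

@[simp] theorem Gad.chain_nil (t : Gad) : Gad.chain [] t = t := rfl

@[simp] theorem Gad.chain_cons (e : Gad) (w : List Gad) (t : Gad) :
    Gad.chain (e :: w) t = .bin e (Gad.chain w t) := rfl

theorem Gad.chain_append (w w' : List Gad) (t : Gad) :
    Gad.chain (w ++ w') t = Gad.chain w (Gad.chain w' t) := List.foldr_append

namespace TwoSpin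

variable (S : TwoSpin)

/-- The logarithmic field of a chain, as a function of that of its end. -/
noncomputable def through (w : List Gad) (x : ℝ) : ℝ :=
  w.foldr (fun e y => S.phi ((S.val e).1 + y)) x

variable {S}

@[simp] theorem through_nil (x : ℝ) : S.through [] x = x := rfl

@[simp] theorem through_cons (e : Gad) (w : List Gad) (x : ℝ) :
    S.through (e :: w) x = S.phi ((S.val e).1 + S.through w x) := rfl

theorem val_chain_fst (w : List Gad) (t : Gad) :
    (S.val (Gad.chain w t)).1 = S.through w (S.val t).1 := by
  induction w with
  | nil => rfl
  | cons e w ih => rw [through_cons, ← ih]; rfl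

theorem continuous_through (w : List Gad) : Continuous (S.through w) := by
  induction w with
  | nil => exact continuous_id
  | cons e w ih => exact S.continuous_phi.comp (continuous_const.add ih)

theorem through_injective (w : List Gad) : Function.Injective (S.through w) := by
  induction w with
  | nil => exact Function.injective_id
  | cons e w ih => exact fun x y h => ih (add_left_cancel (S.phi_strictAnti.injective h))

theorem abs_through_sub_le (w : List Gad) (x y : ℝ) :
    |S.through w x - S.through w y| ≤ |x - y| := by
  induction w with
  | nil => exact le_rfl
  | cons e w ih =>
    refine (S.abs_phi_sub_le_abs_sub _ _).trans ?_
    rwa [add_sub_add_left_eq_sub]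

theorem exists_bound_list (A : List Gad) (f : Gad → ℝ) : ∃ M, 0 ≤ M ∧ ∀ e ∈ A, f e ≤ M := by
  obtain ⟨M, hM⟩ := ((A.finite_toSet).image f).bddAbove
  exact ⟨max 0 M, le_max_left _ _, fun e he => (hM ⟨e, he, rfl⟩).trans (le_max_right _ _)⟩

theorem exists_gap_bound (R : S.Region) (A : List Gad) :
    ∃ M, 0 ≤ M ∧ ∀ w : List Gad, (∀ e ∈ w, e ∈ A) → |(S.val (Gad.chain w .leaf)).2| ≤ M := by
  obtain ⟨N, hN0, hN⟩ := exists_bound_list A fun e => |(S.val e).2|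
  have hk := R.k₁_lt_one
  have hk' := R.k₁_pos
  have h1k : 0 < 1 - R.k₁ := by linarith
  set M := max |(S.val .leaf).2| ((N + |S.a| + (|S.b| + |S.c|)) / (1 - R.k₁)) with hM
  have hM1 : |(S.val .leaf).2| ≤ M := le_max_left _ _
  have hM2 : (N + |S.a| + (|S.b| + |S.c|)) / (1 - R.k₁) ≤ M := le_max_right _ _
  have hM0 : 0 ≤ M := (abs_nonneg _).trans hM1
  rw [div_le_iff₀ h1k] at hM2
  refine ⟨M, hM0, fun w => ?_⟩
  induction w with
  | nil => exact fun _ => hM1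
  | cons e w ih =>
    intro hw
    have ih' := ih fun x hx => hw x (List.mem_cons_of_mem _ hx)
    have he := hN e (hw e List.mem_cons_self)
    set v := S.val (Gad.chain w .leaf)
    change |S.dphi ((S.val e).1 + v.1) * ((S.val e).2 + v.2 + S.a) +
      S.eps ((S.val e).1 + v.1)| ≤ M
    have hd : |S.dphi ((S.val e).1 + v.1)| ≤ R.k₁ := by
      rw [abs_of_neg (S.dphi_neg _)]
      exact (R.bound _ (R.mem_domain (R.mem_wide (R.val_mem e)) (R.val_mem _))).2
    have h3 : |(S.val e).2 + v.2 + S.a| ≤ N + M + |S.a| :=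
      (abs_add_le _ _).trans (add_le_add ((abs_add_le _ _).trans (add_le_add he ih')) le_rfl)
    have h4 := S.abs_eps_le ((S.val e).1 + v.1)
    refine (abs_add_le _ _).trans ?_
    rw [abs_mul]
    have h5 : |S.dphi ((S.val e).1 + v.1)| * |(S.val e).2 + v.2 + S.a| ≤
        R.k₁ * (N + M + |S.a|) := by gcongr
    have h6 : R.k₁ * (N + |S.a|) ≤ N + |S.a| := by
      have := abs_nonneg S.a
      nlinarith
    nlinarith

theorem Cover.exists_limit {R : S.Region} (C : Cover R) :
    ∃ M, ∀ x ∈ Icc (C.z - C.h) (C.z + C.h), ∃ o, |o| ≤ M ∧ ((x, o) : ℝ × ℝ) ∈ S.limitSet := by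
  obtain ⟨M, hM0, hM⟩ := exists_gap_bound R C.A
  have hk' := R.k₁_pos
  have happrox : ∀ n : ℕ, ∀ x ∈ Icc (C.z - C.h) (C.z + C.h), ∃ w : List Gad,
      (∀ e ∈ w, e ∈ C.A) ∧
      |(S.val (Gad.chain w .leaf)).1 - x| ≤ R.k₁ ^ n * (3 * (R.U - R.l)) := by
    intro n
    induction n with
    | zero =>
      intro x hx
      refine ⟨[], by simp, ?_⟩
      have h1 := R.val_mem .leaf
      have h2 := C.lower
      have h3 := C.upper
      have h4 := R.l_nonpos
      have h5 := R.U_nonneg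
      rw [pow_zero, one_mul, Gad.chain_nil, abs_le]
      constructor <;> linarith [h1.1, h1.2, hx.1, hx.2]
    | succ n ih =>
      intro x hx
      obtain ⟨e, he, y, rfl, hy⟩ := C.covers x hx
      have hh := C.h_pos
      have hy' := abs_le.1 hy
      have hmem : y - (S.val e).1 ∈ Icc (C.z - C.h) (C.z + C.h) :=
        ⟨by linarith, by linarith⟩
      obtain ⟨w, hw, hle⟩ := ih _ hmem
      refine ⟨e :: w, by simpa [he] using hw, ?_⟩
      change |S.phi ((S.val e).1 + (S.val (Gad.chain w .leaf)).1) - S.phi y| ≤ _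
      have d1 : (S.val e).1 + (S.val (Gad.chain w .leaf)).1 ∈ _ :=
        R.mem_domain (R.mem_wide (R.val_mem e)) (R.val_mem _)
      have d2 : y ∈ Icc (3 * R.l - R.U - 1) (3 * R.U - R.l + 1) := by
        have := R.mem_domain (x := y - (S.val e).1)
          ⟨by linarith [C.lower, hmem.1], by linarith [C.upper, hmem.2]⟩ (R.val_mem e)
        simpa using this
      refine (R.abs_phi_sub_le d1 d2).trans ?_
      have e1 : (S.val e).1 + (S.val (Gad.chain w .leaf)).1 - y =
        (S.val (Gad.chain w .leaf)).1 - (y - (S.val e).1) := by ring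
      rw [e1, pow_succ', mul_assoc]
      gcongr
  refine ⟨M, fun x hx => ?_⟩
  choose w hw hle using fun n => happrox n x hx
  obtain ⟨o, ho, φ, hφ, hlim⟩ := isCompact_Icc.tendsto_subseq (x := fun n =>
    (S.val (Gad.chain (w n) .leaf)).2) (s := Icc (-M) M) fun n => abs_le.1 (hM _ (hw n))
  refine ⟨o, abs_le.2 ho, ?_⟩
  have hu : Tendsto (fun n => (S.val (Gad.chain (w n) .leaf)).1) atTop (𝓝 x) := by
    rw [tendsto_iff_dist_tendsto_zero]
    refine squeeze_zero (fun _ => dist_nonneg) (fun n => hle n) ?_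
    simpa using (tendsto_pow_atTop_nhds_zero_of_lt_one R.k₁_pos.le R.k₁_lt_one).mul_const
      (3 * (R.U - R.l))
  refine mem_closure_of_tendsto ((hu.comp hφ.tendsto_atTop).prodMk_nhds hlim)
    (Eventually.of_forall fun n => ⟨Gad.chain (w (φ n)) .leaf, rfl⟩)

theorem exists_step_lipschitz (R : S.Region) (M : ℝ) :
    ∃ Λ, 0 ≤ Λ ∧ ∀ p q : ℝ × ℝ, p.1 ∈ Icc (3 * R.l - R.U - 1) (3 * R.U - R.l + 1) →
      q.1 ∈ Icc (3 * R.l - R.U - 1) (3 * R.U - R.l + 1) → |q.2| ≤ M →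
      |(S.step p).2 - (S.step q).2| ≤ R.k₁ * |p.2 - q.2| + Λ * |p.1 - q.1| := by
  have hlip : ∀ f : ℝ → ℝ, ContDiff ℝ ⊤ f → ∃ K : NNReal,
      LipschitzOnWith K f (Icc (3 * R.l - R.U - 1) (3 * R.U - R.l + 1)) := by
    intro f hf
    exact LocallyLipschitzOn.exists_lipschitzOnWith_of_compact isCompact_Icc
      ((hf.of_le le_top).locallyLipschitz.locallyLipschitzOn)
  obtain ⟨K, hK⟩ := hlip _ S.contDiff_dphi
  obtain ⟨K', hK'⟩ := hlip _ S.contDiff_eps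
  refine ⟨K * (|M| + |S.a|) + K', by positivity, fun p q hp hq hM => ?_⟩
  have h1 := hK.dist_le_mul _ hp _ hq
  have h2 := hK'.dist_le_mul _ hp _ hq
  rw [Real.dist_eq, Real.dist_eq] at h1 h2
  have h3 : |S.dphi p.1| ≤ R.k₁ := by
    rw [abs_of_neg (S.dphi_neg _)]
    exact (R.bound _ hp).2
  have h4 : |q.2 + S.a| ≤ |M| + |S.a| :=
    (abs_add_le _ _).trans (add_le_add (hM.trans (le_abs_self M)) le_rfl)
  have e : (S.step p).2 - (S.step q).2 = S.dphi p.1 * (p.2 - q.2) +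
      ((S.dphi p.1 - S.dphi q.1) * (q.2 + S.a) + (S.eps p.1 - S.eps q.1)) := by
    simp only [step]
    ring
  rw [e]
  refine (abs_add_le _ _).trans (add_le_add ?_ ((abs_add_le _ _).trans ?_))
  · rw [abs_mul]
    gcongr
  · rw [abs_mul]
    have : |S.dphi p.1 - S.dphi q.1| * |q.2 + S.a| ≤
        (K * |p.1 - q.1|) * (|M| + |S.a|) := by gcongr
    nlinarith

/-- A long common beginning determines the field and the gap of a chain. -/
theorem exists_chain_close (R : S.Region) (A : List Gad) {e : Gad} (he : e ∈ A) {η : ℝ}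
    (hη : 0 < η) : ∃ n : ℕ, ∀ w : List Gad, (∀ x ∈ w, x ∈ A) →
      |(S.val (Gad.chain (List.replicate n e ++ w) .leaf)).1 -
        (S.val (Gad.chain (List.replicate n e) .leaf)).1| ≤ η ∧
      |(S.val (Gad.chain (List.replicate n e ++ w) .leaf)).2 -
        (S.val (Gad.chain (List.replicate n e) .leaf)).2| ≤ η := by
  obtain ⟨M, hM0, hM⟩ := exists_gap_bound R A
  obtain ⟨Λ, hΛ0, hΛ⟩ := exists_step_lipschitz R (|(S.val e).2| + M)
  have hk := R.k₁_lt_one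
  have hk' := R.k₁_pos
  set k := (1 + R.k₁) / 2 with hkdef
  have hkk : 0 < k - R.k₁ := by rw [hkdef]; linarith
  have hk1 : k < 1 := by rw [hkdef]; linarith
  set W := Λ / (k - R.k₁) + 1 with hW
  have hW1 : 1 ≤ W := by
    have : 0 ≤ Λ / (k - R.k₁) := by positivity
    linarith
  have hWΛ : Λ + W * R.k₁ ≤ k * W := by
    have : Λ = (W - 1) * (k - R.k₁) := by
      rw [hW]
      field_simp
      ring
    nlinarith
  have hdist : ∀ n : ℕ, ∀ w : List Gad, (∀ x ∈ w, x ∈ A) →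
      |(S.val (Gad.chain (List.replicate n e ++ w) .leaf)).2 -
        (S.val (Gad.chain (List.replicate n e) .leaf)).2| +
      W * |(S.val (Gad.chain (List.replicate n e ++ w) .leaf)).1 -
        (S.val (Gad.chain (List.replicate n e) .leaf)).1| ≤
      k ^ n * (2 * M + W * (R.U - R.l)) := by
    intro n w hw
    induction n with
    | zero =>
      rw [pow_zero, one_mul, List.replicate_zero, List.nil_append]
      have h1 := hM w hw
      have h2 := hM [] (by simp)
      have h3 := R.val_mem (Gad.chain w .leaf)
      have h4 := R.val_mem (Gad.chain [] .leaf)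
      refine add_le_add ((abs_sub _ _).trans (by linarith)) ?_
      gcongr
      rw [abs_le]
      constructor <;> linarith [h3.1, h3.2, h4.1, h4.2]
    | succ n ih =>
      have hrep : ∀ x ∈ List.replicate n e, x ∈ A := fun x hx => by
        rw [List.eq_of_mem_replicate hx]
        exact he
      have hMq := hM (List.replicate n e) hrep
      rw [List.replicate_succ, List.cons_append, Gad.chain_cons, Gad.chain_cons]
      have m1 := R.val_mem (Gad.chain (List.replicate n e ++ w) .leaf)
      have m2 := R.val_mem (Gad.chain (List.replicate n e) .leaf)
      set p := S.val (Gad.chain (List.replicate n e ++ w) .leaf)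
      set q := S.val (Gad.chain (List.replicate n e) .leaf)
      have d1 := R.mem_domain (R.mem_wide (R.val_mem e)) m1
      have d2 := R.mem_domain (R.mem_wide (R.val_mem e)) m2
      have h1 := hΛ (S.val e + p) (S.val e + q) d1 d2
        ((abs_add_le _ _).trans (add_le_add le_rfl hMq))
      have h2 : |(S.step (S.val e + p)).1 - (S.step (S.val e + q)).1| ≤ R.k₁ * |p.1 - q.1| := by
        have := R.abs_phi_sub_le d1 d2
        rwa [add_sub_add_left_eq_sub] at this
      simp only [Prod.snd_add, Prod.fst_add, add_sub_add_left_eq_sub] at h1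
      rw [val_bin, val_bin, pow_succ', mul_assoc]
      have a1 := abs_nonneg (p.1 - q.1)
      have a2 := abs_nonneg (p.2 - q.2)
      have hW0 : 0 ≤ W := by linarith
      calc _ ≤ (R.k₁ * |p.2 - q.2| + Λ * |p.1 - q.1|) + W * (R.k₁ * |p.1 - q.1|) := by gcongr
        _ ≤ k * (|p.2 - q.2| + W * |p.1 - q.1|) := by nlinarith
        _ ≤ _ := by
          have : 0 ≤ k := by linarith
          gcongr
  have hlim : Tendsto (fun n => k ^ n * (2 * M + W * (R.U - R.l))) atTop (𝓝 0) := by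
    simpa using (tendsto_pow_atTop_nhds_zero_of_lt_one (by linarith : 0 ≤ k) hk1).mul_const
      (2 * M + W * (R.U - R.l))
  obtain ⟨n, hn⟩ := (hlim.eventually_lt_const hη).exists
  refine ⟨n, fun w hw => ?_⟩
  have h := (hdist n w hw).trans hn.le
  have a1 := abs_nonneg ((S.val (Gad.chain (List.replicate n e ++ w) .leaf)).1 -
        (S.val (Gad.chain (List.replicate n e) .leaf)).1)
  have a2 := abs_nonneg ((S.val (Gad.chain (List.replicate n e ++ w) .leaf)).2 -
        (S.val (Gad.chain (List.replicate n e) .leaf)).2)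
  constructor <;> nlinarith

theorem exists_prefixes {R : S.Region} (C : Cover R) (hnt : ¬ S.IsTrivial) :
    ∃ (p₁ p₂ : List Gad) (V : ℚ) (O : ℝ), 0 < V ∧ 0 < O ∧
      (∀ p ∈ ({p₁, p₂} : Set (List Gad)), ∃ x, |x - C.z| ≤ C.h / 2 ∧
        S.through p x = Real.log V) ∧
      ∀ w₁ w₂ : List Gad, (∀ e ∈ w₁, e ∈ C.A) → (∀ e ∈ w₂, e ∈ C.A) →
        O ≤ |(S.val (Gad.chain (p₁ ++ w₁) .leaf)).2 - (S.val (Gad.chain (p₂ ++ w₂) .leaf)).2| := by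
  have hh := C.h_pos
  obtain ⟨u, o₁, o₂, h₁, h₂, hne⟩ : ∃ u o₁ o₂, ((u, o₁) : ℝ × ℝ) ∈ S.limitSet ∧
      ((u, o₂) : ℝ × ℝ) ∈ S.limitSet ∧ o₁ ≠ o₂ := by
    by_contra! hcon
    obtain ⟨M, hM⟩ := C.exists_limit
    exact hnt (isTrivial_of_functional hcon (show C.z - C.h < C.z + C.h by linarith) hM)
  have hu : u ∈ Icc R.l R.U := by
    have : S.limitSet ⊆ Prod.fst ⁻¹' Icc R.l R.U :=
      closure_minimal (by rintro _ ⟨t, rfl⟩; exact R.val_mem t)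
        (isClosed_Icc.preimage continuous_fst)
    exact this h₁
  obtain ⟨e, he, -⟩ := C.covers C.z ⟨by linarith, by linarith⟩
  obtain ⟨M, hM0, hM⟩ := exists_gap_bound R C.A
  obtain ⟨Λ, hΛ0, hΛ⟩ := exists_step_lipschitz R (max |o₁| |o₂| + M)
  set Δ := R.k₀ * |o₁ - o₂| with hΔ
  have hΔ0 : 0 < Δ := mul_pos R.k₀_pos (abs_pos.2 (sub_ne_zero.2 hne))
  set η := Δ / (8 * (1 + Λ)) with hηdef
  have hη : 0 < η := by positivity
  have hηΔ : (1 + Λ) * (2 * η) = Δ / 4 := by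
    rw [hηdef]
    field_simp
    ring
  obtain ⟨n, hn⟩ := exists_chain_close R C.A he hη
  set f := S.through (List.replicate n e) with hf
  have hfne : S.phi (u + f (C.z - C.h / 2)) ≠ S.phi (u + f (C.z + C.h / 2)) := by
    intro h
    have := through_injective _ (add_left_cancel (S.phi_strictAnti.injective h))
    linarith
  obtain ⟨V, hV0, hV⟩ : ∃ V : ℚ, 0 < V ∧ (S.phi (u + f (C.z - C.h / 2)) - Real.log V) *
      (S.phi (u + f (C.z + C.h / 2)) - Real.log V) < 0 := by
    rcases lt_or_gt_of_ne hfne with h | h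
    · obtain ⟨V, hV1, hV2⟩ := exists_rat_btwn (Real.exp_lt_exp.2 h)
      have hV : (0 : ℝ) < V := (Real.exp_pos _).trans hV1
      refine ⟨V, by exact_mod_cast hV, mul_neg_of_neg_of_pos ?_ ?_⟩
      · have := (Real.lt_log_iff_exp_lt hV).2 hV1
        linarith
      · have := (Real.log_lt_iff_lt_exp hV).2 hV2
        linarith
    · obtain ⟨V, hV1, hV2⟩ := exists_rat_btwn (Real.exp_lt_exp.2 h)
      have hV : (0 : ℝ) < V := (Real.exp_pos _).trans hV1
      refine ⟨V, by exact_mod_cast hV, mul_neg_of_pos_of_neg ?_ ?_⟩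
      · have := (Real.log_lt_iff_lt_exp hV).2 hV2
        linarith
      · have := (Real.lt_log_iff_exp_lt hV).2 hV1
        linarith
  have hnear : ∀ o, ((u, o) : ℝ × ℝ) ∈ S.limitSet → ∃ t, (S.phi ((S.val t).1 + f (C.z - C.h / 2)) -
      Real.log V) * (S.phi ((S.val t).1 + f (C.z + C.h / 2)) - Real.log V) < 0 ∧
      |(S.val t).1 - u| < η ∧ |(S.val t).2 - o| < η := by
    intro o ho
    have hopen : IsOpen {p : ℝ × ℝ | (S.phi (p.1 + f (C.z - C.h / 2)) - Real.log V) *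
        (S.phi (p.1 + f (C.z + C.h / 2)) - Real.log V) < 0 ∧ |p.1 - u| < η ∧ |p.2 - o| < η} := by
      have hc := S.continuous_phi
      have c1 : Continuous fun p : ℝ × ℝ => (S.phi (p.1 + f (C.z - C.h / 2)) - Real.log V) *
        (S.phi (p.1 + f (C.z + C.h / 2)) - Real.log V) := by fun_prop
      have c2 : Continuous fun p : ℝ × ℝ => |p.1 - u| := by fun_prop
      have c3 : Continuous fun p : ℝ × ℝ => |p.2 - o| := by fun_prop
      rw [ofPred_and, ofPred_and]
      exact (isOpen_lt c1 continuous_const).inter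
        ((isOpen_lt c2 continuous_const).inter (isOpen_lt c3 continuous_const))
    obtain ⟨_, hp, ⟨t, rfl⟩⟩ := mem_closure_iff.1 ho _ hopen ⟨hV, by simpa using hη,
      by simpa using hη⟩
    exact ⟨t, hp⟩
  obtain ⟨t₁, a₁, b₁, c₁⟩ := hnear _ h₁
  obtain ⟨t₂, a₂, b₂, c₂⟩ := hnear _ h₂
  have hx : ∀ t, (S.phi ((S.val t).1 + f (C.z - C.h / 2)) -
      Real.log V) * (S.phi ((S.val t).1 + f (C.z + C.h / 2)) - Real.log V) < 0 →
      ∃ x, |x - C.z| ≤ C.h / 2 ∧ S.through (t :: List.replicate n e) x = Real.log V := by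
    intro t ht
    have hc : Continuous fun x => S.phi ((S.val t).1 + f x) :=
      S.continuous_phi.comp (continuous_const.add (continuous_through _))
    have hmem : Real.log V ∈ uIcc (S.phi ((S.val t).1 + f (C.z - C.h / 2)))
        (S.phi ((S.val t).1 + f (C.z + C.h / 2))) := by
      rw [mem_uIcc]
      rcases mul_neg_iff.1 ht with h | h
      · exact Or.inr ⟨by linarith, by linarith⟩
      · exact Or.inl ⟨by linarith, by linarith⟩
    obtain ⟨x, hx, hx'⟩ := intermediate_value_uIcc hc.continuousOn hmem
    rw [uIcc_of_le (by linarith)] at hx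
    exact ⟨x, abs_le.2 ⟨by linarith [hx.1], by linarith [hx.2]⟩, hx'⟩
  refine ⟨t₁ :: List.replicate n e, t₂ :: List.replicate n e, V, Δ / 2, hV0, by positivity, ?_, ?_⟩
  · rintro p (rfl | rfl)
    · exact hx _ a₁
    · exact hx _ a₂
  · intro w₁ w₂ hw₁ hw₂
    set P := S.val (Gad.chain (List.replicate n e) .leaf) with hP
    have hPM : |P.2| ≤ M := hM _ fun x hx => by
      rw [List.eq_of_mem_replicate hx]
      exact he
    have hPu : P.1 ∈ Icc R.l R.U := R.val_mem _
    have hclose : ∀ t o w, |o| ≤ max |o₁| |o₂| → |(S.val t).1 - u| < η → |(S.val t).2 - o| < η →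
        (∀ x ∈ w, x ∈ C.A) →
        |(S.val (Gad.chain (t :: List.replicate n e ++ w) .leaf)).2 - (S.step ((u, o) + P)).2| ≤
          Δ / 4 := by
      intro t o w ho h1 h2 hw
      obtain ⟨h3, h4⟩ := hn w hw
      rw [List.cons_append, Gad.chain_cons, val_bin]
      set X := S.val (Gad.chain (List.replicate n e ++ w) .leaf) with hX
      have := hΛ (S.val t + X) ((u, o) + P)
        (R.mem_domain (R.mem_wide (R.val_mem t)) (R.val_mem _))
        (R.mem_domain (R.mem_wide hu) hPu) ((abs_add_le _ _).trans (add_le_add ho hPM))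
      refine this.trans ?_
      rw [← hηΔ]
      have e1 : |(S.val t + X).2 - ((u, o) + P : ℝ × ℝ).2| ≤ 2 * η := by
        have : (S.val t + X).2 - ((u, o) + P : ℝ × ℝ).2 = ((S.val t).2 - o) + (X.2 - P.2) := by
          simp only [Prod.snd_add]
          ring
        rw [this]
        exact (abs_add_le _ _).trans (by linarith)
      have e2 : |(S.val t + X).1 - ((u, o) + P : ℝ × ℝ).1| ≤ 2 * η := by
        have : (S.val t + X).1 - ((u, o) + P : ℝ × ℝ).1 = ((S.val t).1 - u) + (X.1 - P.1) := by
          simp only [Prod.fst_add]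
          ring
        rw [this]
        exact (abs_add_le _ _).trans (by linarith)
      have hk := R.k₁_lt_one
      have hk' := R.k₁_pos
      have e3 : R.k₁ * |(S.val t + X).2 - ((u, o) + P : ℝ × ℝ).2| ≤ 1 * (2 * η) := by gcongr
      have e4 : Λ * |(S.val t + X).1 - ((u, o) + P : ℝ × ℝ).1| ≤ Λ * (2 * η) := by gcongr
      linarith
    have f1 := hclose t₁ o₁ w₁ (le_max_left _ _) b₁ c₁ hw₁
    have f2 := hclose t₂ o₂ w₂ (le_max_right _ _) b₂ c₂ hw₂
    have f3 : Δ ≤ |(S.step ((u, o₁) + P)).2 - (S.step ((u, o₂) + P)).2| := by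
      have : (S.step ((u, o₁) + P)).2 - (S.step ((u, o₂) + P)).2 =
          S.dphi (u + P.1) * (o₁ - o₂) := by
        simp only [step, Prod.fst_add, Prod.snd_add]
        ring
      rw [this, abs_mul, hΔ, abs_of_neg (S.dphi_neg _)]
      gcongr
      exact (R.bound _ (R.mem_domain (R.mem_wide hu) hPu)).1
    set T₁ := (S.val (Gad.chain (t₁ :: List.replicate n e ++ w₁) .leaf)).2
    set T₂ := (S.val (Gad.chain (t₂ :: List.replicate n e ++ w₂) .leaf)).2
    set Q₁ := (S.step ((u, o₁) + P)).2
    set Q₂ := (S.step ((u, o₂) + P)).2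
    have f4 : |Q₁ - Q₂| ≤ |T₁ - Q₁| + |T₁ - T₂| + |T₂ - Q₂| := by
      have : Q₁ - Q₂ = -(T₁ - Q₁) + (T₁ - T₂) + (T₂ - Q₂) := by ring
      rw [this]
      refine (abs_add_le _ _).trans (add_le_add ((abs_add_le _ _).trans ?_) le_rfl)
      rw [abs_neg]
    linarith

end TwoSpin

end

section

/-! ### Expressions approximating real functions -/

section Bits

theorem bitLen_le_of_natAbs_lt {z : ℤ} {m : ℕ} (h : z.natAbs < 2 ^ m) : bitLen z ≤ m :=
  Nat.size_le.2 h

theorem bitLen_le_natAbs (z : ℤ) : bitLen z ≤ z.natAbs :=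
  bitLen_le_of_natAbs_lt Nat.lt_two_pow_self

theorem bitLen_le_of_abs_le {z : ℤ} {C : ℝ} {N : ℕ} (h : |(z : ℝ)| ≤ C * 2 ^ N) :
    (bitLen z : ℝ) ≤ (C + 2) * (N + 1) := by
  have hC : 0 ≤ C := by
    by_contra hneg
    have h1 : C * 2 ^ N < 0 := mul_neg_of_neg_of_pos (not_le.1 hneg) (by positivity)
    exact absurd ((abs_nonneg _).trans h) (not_le.2 h1)
  have h1 : z.natAbs < 2 ^ (⌈C⌉₊ + N) := by
    have h2 : (z.natAbs : ℝ) ≤ ⌈C⌉₊ * 2 ^ N := by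
      rw [Nat.cast_natAbs, Int.cast_abs]
      exact h.trans (by gcongr; exact Nat.le_ceil C)
    have h3 : z.natAbs ≤ ⌈C⌉₊ * 2 ^ N := by exact_mod_cast h2
    rw [pow_add]
    exact h3.trans_lt (Nat.mul_lt_mul_of_pos_right Nat.lt_two_pow_self (by positivity))
  have h4 : (bitLen z : ℝ) ≤ ⌈C⌉₊ + N := by exact_mod_cast bitLen_le_of_natAbs_lt h1
  have h5 := (Nat.ceil_lt_add_one hC).le
  have hN : (0 : ℝ) ≤ N := Nat.cast_nonneg N
  nlinarith

theorem abs_intDiv_sub_le (a : ℤ) {b : ℤ} (hb : 0 < b) : |((a / b : ℤ) : ℝ) - a / b| ≤ 1 := by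
  have hb' : (0 : ℝ) < b := by exact_mod_cast hb
  have h1 : ((a / b : ℤ) : ℝ) * b ≤ a := by exact_mod_cast Int.ediv_mul_le a hb.ne'
  have h2 : (a : ℝ) < (((a / b : ℤ) : ℝ) + 1) * b := by
    exact_mod_cast Int.lt_ediv_add_one_mul_self a hb
  rw [abs_le]
  constructor
  · have : (a : ℝ) / b < ((a / b : ℤ) : ℝ) + 1 := (div_lt_iff₀ hb').2 h2
    linarith
  · have : ((a / b : ℤ) : ℝ) ≤ (a : ℝ) / b := (le_div_iff₀ hb').2 h1
    linarith

end Bits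

variable {k : ℕ}

/-- The content of the cell with number `i`. -/
abbrev RamExpr.cell (i : ℤ) : RamExpr k := .load (.const i)

/-- With `2 ^ N` in cell `2`, `N` in cell `3` and a number `T` with `T / 2 ^ N` in `D` in cell `4`,
the expression `e` approximates `2 ^ N * F (T / 2 ^ N)` with a bounded error, at a cost which is
linear in `N`. -/
def Approx (x : Fin k → ℝ) (D : Set ℝ) (F : ℝ → ℝ) (e : RamExpr k) : Prop :=
  ∃ (C : ℝ) (N₀ : ℕ), 0 ≤ C ∧ (∀ t ∈ D, |F t| ≤ C) ∧
    ∀ name, IsName x name → ∀ N ≥ N₀, ∀ mem : ℤ → ℤ, mem 2 = 2 ^ N → mem 3 = N →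
      (mem 4 : ℝ) / 2 ^ N ∈ D →
      |(e.eval name mem : ℝ) - 2 ^ N * F (mem 4 / 2 ^ N)| ≤ C ∧
        (e.cost name mem : ℝ) ≤ C * (N + 1)

namespace Approx

variable {x : Fin k → ℝ} {D : Set ℝ} {F G : ℝ → ℝ} {e f : RamExpr k}

theorem abs_eval_le {z : ℤ} {C r : ℝ} {N : ℕ} (hr : |r| ≤ C) (h : |(z : ℝ) - 2 ^ N * r| ≤ C) :
    |(z : ℝ)| ≤ (2 * C) * 2 ^ N := by
  have h1 : |(2 : ℝ) ^ N * r| ≤ 2 ^ N * C := by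
    rw [abs_mul, abs_of_pos (by positivity : (0 : ℝ) < 2 ^ N)]
    gcongr
  have h2 : (1 : ℝ) ≤ 2 ^ N := one_le_pow₀ (by norm_num)
  have hC : 0 ≤ C := (abs_nonneg _).trans hr
  have h3 : |(z : ℝ)| ≤ |(z : ℝ) - 2 ^ N * r| + |(2 : ℝ) ^ N * r| := by
    have := abs_add_le ((z : ℝ) - 2 ^ N * r) (2 ^ N * r)
    rwa [sub_add_cancel] at this
  nlinarith

theorem bitLen_two_pow (N : ℕ) : bitLen ((2 : ℤ) ^ N) ≤ N + 1 := by
  refine bitLen_le_of_natAbs_lt ?_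
  rw [Int.natAbs_pow]
  exact Nat.pow_lt_pow_right (by norm_num) (Nat.lt_succ_self N)

theorem bitLen_natCast_le (N : ℕ) : bitLen (N : ℤ) ≤ N := by
  simpa using bitLen_le_natAbs (N : ℤ)

theorem cost_cell_two {name : Fin k → ℕ → ℤ} {mem : ℤ → ℤ} {N : ℕ} (h : mem 2 = 2 ^ N) :
    (((RamExpr.cell 2 : RamExpr k).cost name mem : ℕ) : ℝ) ≤ 7 * (N + 1) := by
  have h1 := bitLen_two_pow N
  have h2 : bitLen 2 = 2 := by decide
  have : (RamExpr.cell 2 : RamExpr k).cost name mem ≤ 7 * (N + 1) := by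
    simp only [RamExpr.cost, RamExpr.eval, h, h2]
    omega
  exact_mod_cast this

theorem cost_cell_three {name : Fin k → ℕ → ℤ} {mem : ℤ → ℤ} {N : ℕ} (h : mem 3 = N) :
    (RamExpr.cell 3 : RamExpr k).cost name mem ≤ 7 * (N + 1) := by
  have h1 := bitLen_natCast_le N
  have h2 : bitLen 3 = 2 := by decide
  simp only [RamExpr.cost, RamExpr.eval, h, h2]
  omega

theorem query (j : Fin k) : Approx x D (fun _ => x j) (.query j (.cell 3)) := by
  refine ⟨|x j| * 2 + 30, 0, by positivity, fun t _ => by linarith [abs_nonneg (x j)],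
    fun name hname N _ mem h2 h3 _ => ⟨?_, ?_⟩⟩
  · have := hname j N
    simp only [RamExpr.eval, h3, Int.toNat_natCast]
    linarith [abs_nonneg (x j)]
  · have h4 := cost_cell_three (name := name) h3
    have h5 : |(name j N : ℝ)| ≤ (2 * (|x j| + 1)) * 2 ^ N :=
      abs_eval_le (r := x j) (by linarith) ((hname j N).trans (by linarith [abs_nonneg (x j)]))
    have h6 := bitLen_le_of_abs_le h5
    have h7 : ((RamExpr.query j (.cell 3) : RamExpr k).cost name mem : ℝ) ≤
        7 * (N + 1) + 1 + N + bitLen (name j N) := by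
      have : (RamExpr.query j (.cell 3) : RamExpr k).cost name mem ≤
          7 * (N + 1) + 1 + N + bitLen (name j N) := by
        rw [RamExpr.cost]
        simp only [RamExpr.eval, h3, Int.toNat_natCast, Int.natAbs_natCast]
        omega
      exact_mod_cast this
    have hN : (0 : ℝ) ≤ N := Nat.cast_nonneg N
    have := abs_nonneg (x j)
    nlinarith

theorem ratCast (q : ℚ) : Approx x D (fun _ => (q : ℝ))
    (.div (.mul (.const q.num) (.cell 2)) (.const q.den)) := by
  have hden : (0 : ℤ) < q.den := by exact_mod_cast q.den_pos
  refine ⟨|(q : ℝ)| + |(q.num : ℝ)| + 2 * bitLen q.num + 2 * bitLen q.den + 30, 0,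
    by positivity, fun t _ => ?_, fun name hname N _ mem h2 h3 _ => ⟨?_, ?_⟩⟩
  · have h1 : (0 : ℝ) ≤ bitLen q.num := Nat.cast_nonneg _
    have h2 : (0 : ℝ) ≤ bitLen q.den := Nat.cast_nonneg _
    linarith [abs_nonneg (q.num : ℝ)]
  · simp only [RamExpr.eval, h2]
    have h := abs_intDiv_sub_le (q.num * 2 ^ N) hden
    have e : ((q.num * 2 ^ N : ℤ) : ℝ) / ((q.den : ℤ) : ℝ) = 2 ^ N * (q : ℝ) := by
      rw [Rat.cast_def]
      push_cast
      ring
    rw [e] at h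
    have h1 : (0 : ℝ) ≤ bitLen q.num := Nat.cast_nonneg _
    have h2 : (0 : ℝ) ≤ bitLen q.den := Nat.cast_nonneg _
    linarith [abs_nonneg (q.num : ℝ), abs_nonneg (q : ℝ)]
  · have h4 := cost_cell_two (name := name) h2
    have h5 : (bitLen ((2 : ℤ) ^ N) : ℝ) ≤ N + 1 := by exact_mod_cast bitLen_two_pow N
    have h6 : (bitLen (q.num * 2 ^ N) : ℝ) ≤ (|(q.num : ℝ)| + 2) * (N + 1) := by
      refine bitLen_le_of_abs_le (le_of_eq ?_)
      push_cast
      rw [abs_mul, abs_of_pos (by positivity : (0 : ℝ) < 2 ^ N)]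
    have hN : (0 : ℝ) ≤ N := Nat.cast_nonneg N
    have h7 : (0 : ℝ) ≤ bitLen q.num := Nat.cast_nonneg _
    have h8 : (0 : ℝ) ≤ bitLen q.den := Nat.cast_nonneg _
    have h9 : ((RamExpr.div (.mul (.const q.num) (.cell 2)) (.const q.den) : RamExpr k).cost
        name mem : ℝ) = (1 + bitLen q.num) + ((RamExpr.cell 2 : RamExpr k).cost name mem : ℝ) + 1 +
        bitLen q.num + bitLen ((2 : ℤ) ^ N) + (1 + bitLen q.den) + 1 + bitLen (q.num * 2 ^ N) +
        bitLen (q.den : ℤ) := by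
      simp only [RamExpr.cost, RamExpr.eval, h2]
      push_cast
      ring
    rw [h9]
    have := abs_nonneg (q : ℝ)
    nlinarith

theorem id {B : ℝ} (hB : ∀ t ∈ D, |t| ≤ B) : Approx x D (fun t => t) (.cell 4) := by
  refine ⟨|B| + 20, 0, by positivity, fun t ht => by linarith [hB t ht, le_abs_self B],
    fun name hname N _ mem h2 h3 h4 => ⟨?_, ?_⟩⟩
  · have : (2 : ℝ) ^ N * (mem 4 / 2 ^ N) = mem 4 := by field_simp
    simp only [RamExpr.eval, this, sub_self, abs_zero]
    positivity
  · have h5 := hB _ h4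
    have hp : (0 : ℝ) < 2 ^ N := by positivity
    rw [abs_div, abs_of_pos hp, div_le_iff₀ hp] at h5
    have h5' : |(mem 4 : ℝ)| ≤ |B| * 2 ^ N := h5.trans (by gcongr; exact le_abs_self B)
    have h6 := bitLen_le_of_abs_le h5'
    have h7 : bitLen 4 = 3 := by decide
    have h8 : ((RamExpr.cell 4 : RamExpr k).cost name mem : ℝ) = 8 + bitLen (mem 4) := by
      simp only [RamExpr.cost, RamExpr.eval, h7]
      push_cast
      ring
    rw [h8]
    have hN : (0 : ℝ) ≤ N := Nat.cast_nonneg N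
    nlinarith [abs_nonneg B]

/-- A bound for the cost of a binary operation. -/
theorem cost_binary_le {c c₁ c₂ z₁ z₂ : ℤ} {C₁ C₂ : ℝ} {N : ℕ}
    (hc : c = c₁ + c₂ + 1 + bitLen z₁ + bitLen z₂) (h₁ : (c₁ : ℝ) ≤ C₁ * (N + 1))
    (h₂ : (c₂ : ℝ) ≤ C₂ * (N + 1)) (hz₁ : |(z₁ : ℝ)| ≤ (2 * C₁) * 2 ^ N)
    (hz₂ : |(z₂ : ℝ)| ≤ (2 * C₂) * 2 ^ N) : (c : ℝ) ≤ (3 * C₁ + 3 * C₂ + 5) * (N + 1) := by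
  have b₁ := bitLen_le_of_abs_le hz₁
  have b₂ := bitLen_le_of_abs_le hz₂
  have hN : (0 : ℝ) ≤ N := Nat.cast_nonneg N
  rw [hc]
  push_cast
  nlinarith

theorem add (h : Approx x D F e) (h' : Approx x D G f) :
    Approx x D (fun t => F t + G t) (.add e f) := by
  obtain ⟨C, N₀, hC, hF, h⟩ := h
  obtain ⟨C', N₀', hC', hG, h'⟩ := h'
  refine ⟨3 * C + 3 * C' + 5, max N₀ N₀', by positivity, fun t ht => ?_,
    fun name hname N hN mem h2 h3 h4 => ?_⟩
  · exact (abs_add_le _ _).trans (by linarith [hF t ht, hG t ht])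
  · obtain ⟨a1, a2⟩ := h name hname N ((le_max_left _ _).trans hN) mem h2 h3 h4
    obtain ⟨b1, b2⟩ := h' name hname N ((le_max_right _ _).trans hN) mem h2 h3 h4
    constructor
    · simp only [RamExpr.eval]
      push_cast
      have : (e.eval name mem : ℝ) + f.eval name mem - 2 ^ N * (F (mem 4 / 2 ^ N) +
          G (mem 4 / 2 ^ N)) = (e.eval name mem - 2 ^ N * F (mem 4 / 2 ^ N)) +
          (f.eval name mem - 2 ^ N * G (mem 4 / 2 ^ N)) := by ring
      rw [this]
      exact (abs_add_le _ _).trans (by linarith)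
    · have := cost_binary_le (c := (RamExpr.add e f).cost name mem) (c₁ := e.cost name mem)
        (c₂ := f.cost name mem) (by simp [RamExpr.cost]) (by exact_mod_cast a2)
        (by exact_mod_cast b2) (abs_eval_le (hF _ h4) a1) (abs_eval_le (hG _ h4) b1)
      exact_mod_cast this

theorem sub (h : Approx x D F e) (h' : Approx x D G f) :
    Approx x D (fun t => F t - G t) (.sub e f) := by
  obtain ⟨C, N₀, hC, hF, h⟩ := h
  obtain ⟨C', N₀', hC', hG, h'⟩ := h'
  refine ⟨3 * C + 3 * C' + 5, max N₀ N₀', by positivity, fun t ht => ?_,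
    fun name hname N hN mem h2 h3 h4 => ?_⟩
  · exact (abs_sub _ _).trans (by linarith [hF t ht, hG t ht])
  · obtain ⟨a1, a2⟩ := h name hname N ((le_max_left _ _).trans hN) mem h2 h3 h4
    obtain ⟨b1, b2⟩ := h' name hname N ((le_max_right _ _).trans hN) mem h2 h3 h4
    constructor
    · simp only [RamExpr.eval]
      push_cast
      have : (e.eval name mem : ℝ) - f.eval name mem - 2 ^ N * (F (mem 4 / 2 ^ N) -
          G (mem 4 / 2 ^ N)) = (e.eval name mem - 2 ^ N * F (mem 4 / 2 ^ N)) -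
          (f.eval name mem - 2 ^ N * G (mem 4 / 2 ^ N)) := by ring
      rw [this]
      exact (abs_sub _ _).trans (by linarith)
    · have := cost_binary_le (c := (RamExpr.sub e f).cost name mem) (c₁ := e.cost name mem)
        (c₂ := f.cost name mem) (by simp [RamExpr.cost]) (by exact_mod_cast a2)
        (by exact_mod_cast b2) (abs_eval_le (hF _ h4) a1) (abs_eval_le (hG _ h4) b1)
      exact_mod_cast this

theorem mul (h : Approx x D F e) (h' : Approx x D G f) :
    Approx x D (fun t => F t * G t) (.div (.mul e f) (.cell 2)) := by
  obtain ⟨C, N₀, hC, hF, h⟩ := h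
  obtain ⟨C', N₀', hC', hG, h'⟩ := h'
  refine ⟨8 * (C * C') + 3 * C + 3 * C' + 30, max N₀ N₀', by positivity, fun t ht => ?_,
    fun name hname N hN mem h2 h3 h4 => ?_⟩
  · rw [abs_mul]
    have : |F t| * |G t| ≤ C * C' := by
      have := hF t ht
      have := hG t ht
      gcongr
    nlinarith [mul_nonneg hC hC']
  · obtain ⟨a1, a2⟩ := h name hname N ((le_max_left _ _).trans hN) mem h2 h3 h4
    obtain ⟨b1, b2⟩ := h' name hname N ((le_max_right _ _).trans hN) mem h2 h3 h4
    have hp : (1 : ℝ) ≤ 2 ^ N := one_le_pow₀ (by norm_num)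
    have hp0 : (0 : ℝ) < 2 ^ N := by positivity
    have hFt := hF _ h4
    have hGt := hG _ h4
    have z1 := abs_eval_le hFt a1
    have z2 := abs_eval_le hGt b1
    have hCC := mul_nonneg hC hC'
    constructor
    · simp only [RamExpr.eval, h2]
      have hdiv := abs_intDiv_sub_le (e.eval name mem * f.eval name mem)
        (show (0 : ℤ) < 2 ^ N by positivity)
      generalize e.eval name mem * f.eval name mem / 2 ^ N = q at hdiv ⊢
      set u := F (mem 4 / 2 ^ N)
      set v := G (mem 4 / 2 ^ N)
      set a : ℝ := ((e.eval name mem : ℤ) : ℝ)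
      set b : ℝ := ((f.eval name mem : ℤ) : ℝ)
      push_cast at hdiv
      have e1 : a * b / 2 ^ N - 2 ^ N * (u * v) =
          (a - 2 ^ N * u) * v + u * (b - 2 ^ N * v) +
            (a - 2 ^ N * u) * (b - 2 ^ N * v) / 2 ^ N := by
        field_simp
        ring
      have e2 : |a * b / 2 ^ N - 2 ^ N * (u * v)| ≤ 3 * (C * C') := by
        rw [e1]
        have t1 : |(a - 2 ^ N * u) * v| ≤ C * C' := by rw [abs_mul]; gcongr
        have t2 : |u * (b - 2 ^ N * v)| ≤ C * C' := by rw [abs_mul]; gcongr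
        have t3 : |(a - 2 ^ N * u) * (b - 2 ^ N * v) / 2 ^ N| ≤ C * C' := by
          rw [abs_div, abs_mul, abs_of_pos hp0, div_le_iff₀ hp0]
          calc _ ≤ C * C' := by gcongr
            _ ≤ C * C' * 2 ^ N := le_mul_of_one_le_right hCC hp
        exact (abs_add_three _ _ _).trans (by linarith)
      have e3 := abs_add_le ((q : ℝ) - a * b / 2 ^ N) (a * b / 2 ^ N - 2 ^ N * (u * v))
      rw [sub_add_sub_cancel] at e3
      linarith
    · have c1 := cost_binary_le (c := (RamExpr.mul e f).cost name mem) (c₁ := e.cost name mem)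
        (c₂ := f.cost name mem) (by simp [RamExpr.cost]) (by exact_mod_cast a2)
        (by exact_mod_cast b2) z1 z2
      have c2 := cost_cell_two (name := name) h2
      have c3 : (bitLen ((2 : ℤ) ^ N) : ℝ) ≤ N + 1 := by exact_mod_cast bitLen_two_pow N
      have c4 : |((e.eval name mem * f.eval name mem : ℤ) : ℝ)| ≤
          (4 * (C * C')) * 2 ^ (N + N) := by
        push_cast
        rw [abs_mul, pow_add]
        calc _ ≤ ((2 * C) * 2 ^ N) * ((2 * C') * 2 ^ N) := by gcongr
          _ = _ := by ring
      have c5 := bitLen_le_of_abs_le c4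
      have c6 : ((RamExpr.div (.mul e f) (.cell 2) : RamExpr k).cost name mem : ℝ) =
          ((RamExpr.mul e f).cost name mem : ℝ) + (RamExpr.cell 2 : RamExpr k).cost name mem + 1 +
            bitLen (e.eval name mem * f.eval name mem) + bitLen ((2 : ℤ) ^ N) := by
        simp only [RamExpr.cost, RamExpr.eval, h2]
        push_cast
        ring
      rw [c6]
      push_cast at c1 c5
      have hN0 : (0 : ℝ) ≤ N := Nat.cast_nonneg N
      nlinarith

theorem div (h : Approx x D F e) (h' : Approx x D G f) {δ : ℝ} (hδ : 0 < δ)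
    (hG' : ∀ t ∈ D, δ ≤ G t) :
    Approx x D (fun t => F t / G t) (.div (.mul e (.cell 2)) f) := by
  obtain ⟨C, N₀, hC, hF, h⟩ := h
  obtain ⟨C', N₀', hC', hG, h'⟩ := h'
  obtain ⟨N₁, hN₁⟩ : ∃ N₁ : ℕ, 2 * C' / δ ≤ 2 ^ N₁ :=
    (pow_unbounded_of_one_lt (2 * C' / δ) (by norm_num : (1 : ℝ) < 2)).imp fun _ h => h.le
  refine ⟨C / δ + 4 * (C * C') / δ ^ 2 + 8 * C + 3 * C' + 30, max N₁ (max N₀ N₀'), by positivity,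
    fun t ht => ?_, fun name hname N hN mem h2 h3 h4 => ?_⟩
  · have hpos := hδ.trans_le (hG' t ht)
    rw [abs_div, abs_of_pos hpos]
    have : |F t| / G t ≤ C / δ := by
      have := hF t ht
      have := hG' t ht
      gcongr
    have h0 : 0 ≤ 4 * (C * C') / δ ^ 2 := by positivity
    linarith
  · have hNN := (le_max_right N₁ _).trans hN
    obtain ⟨a1, a2⟩ := h name hname N ((le_max_left _ _).trans hNN) mem h2 h3 h4
    obtain ⟨b1, b2⟩ := h' name hname N ((le_max_right _ _).trans hNN) mem h2 h3 h4
    have hp : (1 : ℝ) ≤ 2 ^ N := one_le_pow₀ (by norm_num)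
    have hp0 : (0 : ℝ) < 2 ^ N := by positivity
    have hFt := hF _ h4
    have hGt := hG _ h4
    have hGt' := hG' _ h4
    have z1 := abs_eval_le hFt a1
    have z2 := abs_eval_le hGt b1
    have hCC := mul_nonneg hC hC'
    have q0 : 0 ≤ C / δ := by positivity
    have q1 : 0 ≤ 4 * (C * C') / δ ^ 2 := by positivity
    constructor
    · simp only [RamExpr.eval, h2]
      set u := F (mem 4 / 2 ^ N)
      set v := G (mem 4 / 2 ^ N)
      set a : ℝ := ((e.eval name mem : ℤ) : ℝ) with ha
      set b : ℝ := ((f.eval name mem : ℤ) : ℝ) with hb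
      have hvpos : 0 < v := hδ.trans_le hGt'
      have hbig : 2 * C' ≤ δ * 2 ^ N := by
        have h5 : 2 * C' / δ ≤ 2 ^ N :=
          hN₁.trans (pow_le_pow_right₀ (by norm_num) ((le_max_left _ _).trans hN))
        rw [div_le_iff₀ hδ] at h5
        linarith
      have hblow : δ * 2 ^ N / 2 ≤ b := by
        have h5 := (abs_le.1 b1).1
        have h6 : δ * 2 ^ N ≤ 2 ^ N * v := by nlinarith
        linarith
      have hbpos : 0 < b := lt_of_lt_of_le (by positivity) hblow
      have hbpos' : (0 : ℤ) < f.eval name mem := Int.cast_pos.1 hbpos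
      have hdiv := abs_intDiv_sub_le (e.eval name mem * 2 ^ N) hbpos'
      generalize e.eval name mem * 2 ^ N / f.eval name mem = q at hdiv ⊢
      push_cast at hdiv
      rw [← ha, ← hb] at hdiv
      have e1 : a * 2 ^ N / b - 2 ^ N * (u / v) =
          2 ^ N * ((a - 2 ^ N * u) * v - (b - 2 ^ N * v) * u) / (b * v) := by
        field_simp
        ring
      have e2 : |a * 2 ^ N / b - 2 ^ N * (u / v)| ≤ 4 * (C * C') / δ ^ 2 := by
        rw [e1, abs_div, abs_of_pos (mul_pos hbpos hvpos), abs_mul, abs_of_pos hp0,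
          div_le_div_iff₀ (mul_pos hbpos hvpos) (by positivity)]
        have t1 : |(a - 2 ^ N * u) * v - (b - 2 ^ N * v) * u| ≤ 2 * (C * C') := by
          refine (abs_sub _ _).trans ?_
          have t1 : |(a - 2 ^ N * u) * v| ≤ C * C' := by rw [abs_mul]; gcongr
          have t2 : |(b - 2 ^ N * v) * u| ≤ C' * C := by rw [abs_mul]; gcongr
          linarith
        have t2 : δ * 2 ^ N / 2 * δ ≤ b * v := by gcongr
        calc 2 ^ N * |(a - 2 ^ N * u) * v - (b - 2 ^ N * v) * u| * δ ^ 2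
            ≤ 2 ^ N * (2 * (C * C')) * δ ^ 2 := by gcongr
          _ = 4 * (C * C') * (δ * 2 ^ N / 2 * δ) := by ring
          _ ≤ _ := by gcongr
      have e3 := abs_add_le ((q : ℝ) - a * 2 ^ N / b) (a * 2 ^ N / b - 2 ^ N * (u / v))
      rw [sub_add_sub_cancel] at e3
      linarith
    · have c2 := cost_cell_two (name := name) h2
      have c3 : (bitLen ((2 : ℤ) ^ N) : ℝ) ≤ N + 1 := by exact_mod_cast bitLen_two_pow N
      have c4 : |((e.eval name mem * 2 ^ N : ℤ) : ℝ)| ≤ (2 * C) * 2 ^ (N + N) := by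
        push_cast
        rw [abs_mul, pow_add, abs_of_pos hp0, ← mul_assoc]
        gcongr
      have c5 := bitLen_le_of_abs_le c4
      have c7 := bitLen_le_of_abs_le z1
      have c8 := bitLen_le_of_abs_le z2
      have c6 : ((RamExpr.div (.mul e (.cell 2)) f : RamExpr k).cost name mem : ℝ) =
          (e.cost name mem : ℝ) + (RamExpr.cell 2 : RamExpr k).cost name mem + 1 +
            bitLen (e.eval name mem) + bitLen ((2 : ℤ) ^ N) + f.cost name mem + 1 +
            bitLen (e.eval name mem * 2 ^ N) + bitLen (f.eval name mem) := by
        simp only [RamExpr.cost, RamExpr.eval, h2]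
        push_cast
        ring
      rw [c6]
      push_cast at c5
      have hN0 : (0 : ℝ) ≤ N := Nat.cast_nonneg N
      nlinarith

end Approx

end

section

/-! ### Digits of a cover -/

open Set

namespace TwoSpin

variable (S : TwoSpin)

/-- The real parameters available to an algorithm. -/
abbrev params : Fin 3 → ℝ := ![S.β, S.γ, S.lam]

/-- The number `r` can be approximated by an expression. -/
def Computable (r : ℝ) : Prop := ∀ D : Set ℝ, ∃ e, Approx S.params D (fun _ => r) e

variable {S}

namespace Computable

variable {r s : ℝ}

theorem β : S.Computable S.β := fun _ => ⟨_, Approx.query 0⟩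

theorem γ : S.Computable S.γ := fun _ => ⟨_, Approx.query 1⟩

theorem lam : S.Computable S.lam := fun _ => ⟨_, Approx.query 2⟩

theorem ratCast (q : ℚ) : S.Computable q := fun _ => ⟨_, Approx.ratCast q⟩

theorem one : S.Computable 1 := by simpa using ratCast (S := S) 1

theorem add (hr : S.Computable r) (hs : S.Computable s) : S.Computable (r + s) := fun D =>
  ⟨_, (hr D).choose_spec.add (hs D).choose_spec⟩

theorem sub (hr : S.Computable r) (hs : S.Computable s) : S.Computable (r - s) := fun D =>
  ⟨_, (hr D).choose_spec.sub (hs D).choose_spec⟩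

theorem mul (hr : S.Computable r) (hs : S.Computable s) : S.Computable (r * s) := fun D =>
  ⟨_, (hr D).choose_spec.mul (hs D).choose_spec⟩

theorem div (hr : S.Computable r) (hs : S.Computable s) (h : 0 < s) : S.Computable (r / s) :=
  fun D => ⟨_, (hr D).choose_spec.div (hs D).choose_spec h fun _ _ => le_rfl⟩

theorem sq (hr : S.Computable r) : S.Computable (r ^ 2) := by
  rw [pow_two]
  exact hr.mul hr

theorem exp_phi {u : ℝ} (h : S.Computable (Real.exp u)) : S.Computable (Real.exp (S.phi u)) := by
  rw [S.exp_phi, fieldStep]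
  exact (one.add (γ.mul (lam.mul h))).div (β.add (lam.mul h)) (S.den_pos u)

theorem exp_val (h : S.Computable (Real.exp S.base.1)) (t : Gad) :
    S.Computable (Real.exp (S.val t).1) := by
  induction t with
  | leaf => exact h.exp_phi
  | un t ih => exact ih.exp_phi
  | bin s t ih ih' =>
    refine exp_phi (u := (S.val s).1 + (S.val t).1) ?_
    rw [Real.exp_add]
    exact ih.mul ih'

end Computable

theorem gamma_lt_exp_phi (u : ℝ) : S.γ < Real.exp (S.phi u) := by
  rw [S.exp_phi, fieldStep, lt_div_iff₀ (show 0 < S.β + S.lam * Real.exp u from S.den_pos u)]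
  have h1 := S.mul_lt_one
  have : S.γ * (S.β + S.lam * Real.exp u) = S.β * S.γ + S.γ * (S.lam * Real.exp u) := by ring
  linarith

/-- Solving `phi (u + y) = v` for `exp y`. -/
theorem exp_eq_of_phi_eq {u y v : ℝ} (h : S.phi (u + y) = v) :
    Real.exp y = (1 - S.β * Real.exp v) / ((Real.exp v - S.γ) * (S.lam * Real.exp u)) := by
  have h1 := S.gamma_lt_exp_phi (u + y)
  have h2 := S.exp_phi (u + y)
  rw [h] at h1 h2
  have h3 : 0 < Real.exp v - S.γ := sub_pos.2 h1
  have h4 := S.lam_pos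
  have h5 := Real.exp_pos u
  rw [eq_div_iff (by positivity)]
  rw [fieldStep, eq_div_iff (show S.β + S.lam * Real.exp (u + y) ≠ 0 from (S.den_pos _).ne'),
    Real.exp_add] at h2
  linear_combination h2

theorem Computable.exp_of_through (h : S.Computable (Real.exp S.base.1)) (p : List Gad) :
    ∀ {x v : ℝ}, S.Computable (Real.exp v) → S.through p x = v → S.Computable (Real.exp x) := by
  induction p with
  | nil =>
    rintro x v hv rfl
    exact hv
  | cons e p ih =>
    intro x v hv hx
    rw [through_cons] at hx
    refine ih ?_ rfl
    have h3 : 0 < Real.exp v - S.γ := sub_pos.2 (hx ▸ S.gamma_lt_exp_phi _)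
    have h4 := S.lam_pos
    have h5 := Real.exp_pos (S.val e).1
    rw [S.exp_eq_of_phi_eq hx]
    exact (one.sub (β.mul hv)).div ((hv.sub γ).mul (lam.mul (h.exp_val e))) (by positivity)

theorem abs_log_sub_log_le {s t δ : ℝ} (hδ : 0 < δ) (hs : δ ≤ s) (ht : δ ≤ t) :
    |Real.log s - Real.log t| ≤ |s - t| / δ := by
  wlog hst : t ≤ s generalizing s t
  · rw [abs_sub_comm, abs_sub_comm s]
    exact this ht hs (le_of_not_ge hst)
  have ht0 := hδ.trans_le ht
  have hs0 := hδ.trans_le hs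
  rw [abs_of_nonneg (sub_nonneg.2 (Real.log_le_log ht0 hst)), abs_of_nonneg (sub_nonneg.2 hst),
    ← Real.log_div hs0.ne' ht0.ne']
  refine (Real.log_le_sub_one_of_pos (div_pos hs0 ht0)).trans ?_
  have : s / t - 1 = (s - t) / t := by field_simp
  rw [this]
  have := sub_nonneg.2 hst
  gcongr

namespace Cover

variable {R : S.Region} (C : Cover R)

/-- The fields whose logarithm is covered. -/
abbrev dom : Set ℝ := Icc (Real.exp (C.z - C.h)) (Real.exp (C.z + C.h))

theorem dom_pos {t : ℝ} (ht : t ∈ C.dom) : 0 < t := (Real.exp_pos _).trans_le ht.1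

theorem log_mem {t : ℝ} (ht : t ∈ C.dom) : Real.log t ∈ Icc (C.z - C.h) (C.z + C.h) :=
  ⟨(Real.le_log_iff_exp_le (C.dom_pos ht)).2 ht.1, (Real.log_le_iff_le_exp (C.dom_pos ht)).2 ht.2⟩

theorem exists_phi_eq {t : ℝ} (ht : t ∈ C.dom) : ∃ y, Real.exp (S.phi y) = t := by
  obtain ⟨e, -, y, h, -⟩ := C.covers _ (C.log_mem ht)
  exact ⟨y, by rw [h, Real.exp_log (C.dom_pos ht)]⟩

/-- The field which has to be continued with after the gadget `e`. -/
noncomputable def next (S : TwoSpin) (e : Gad) (t : ℝ) : ℝ :=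
  (1 - S.β * t) / ((t - S.γ) * (S.lam * Real.exp (S.val e).1))

theorem next_eq (e : Gad) {y t : ℝ} (h : Real.exp (S.phi y) = t) :
    next S e t = Real.exp (y - (S.val e).1) := by
  rw [S.exp_eq_of_phi_eq (u := (S.val e).1) (v := Real.log t), next,
    Real.exp_log (h ▸ Real.exp_pos _)]
  rw [add_sub_cancel, ← h, Real.log_exp]

theorem approx_next (h : S.Computable (Real.exp S.base.1)) (e : Gad) :
    ∃ f, Approx S.params C.dom (next S e) f := by
  have hm : Real.exp (C.z - C.h) ∈ C.dom :=
    ⟨le_rfl, Real.exp_le_exp.2 (by linarith [C.h_pos])⟩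
  obtain ⟨y, hy⟩ := C.exists_phi_eq hm
  have h3 : 0 < Real.exp (C.z - C.h) - S.γ := sub_pos.2 (hy ▸ S.gamma_lt_exp_phi _)
  have h4 := S.lam_pos
  have h5 := Real.exp_pos (S.val e).1
  have hid : Approx S.params C.dom (fun t => t) (.cell 4) :=
    Approx.id (B := Real.exp (C.z + C.h)) fun t ht => by
      rw [abs_of_pos (C.dom_pos ht)]
      exact ht.2
  obtain ⟨e1, he1⟩ := Computable.one (S := S) C.dom
  obtain ⟨eβ, hβ⟩ := Computable.β (S := S) C.dom
  obtain ⟨eγ, hγ⟩ := Computable.γ (S := S) C.dom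
  obtain ⟨ev, hv⟩ := (Computable.lam.mul (h.exp_val e)) C.dom
  refine ⟨_, (he1.sub (hβ.mul hid)).div ((hid.sub hγ).mul hv)
    (δ := (Real.exp (C.z - C.h) - S.γ) * (S.lam * Real.exp (S.val e).1)) (by positivity)
    fun t ht => ?_⟩
  have := ht.1
  gcongr

/-- Expressions for the continuations and the tests of a search for digits. -/
structure Search (f g : Gad → RamExpr 3) where
  K : ℝ
  N₀ : ℕ
  K_nonneg : 0 ≤ K
  complete : ∀ name, IsName S.params name → ∀ N ≥ N₀, ∀ mem : ℤ → ℤ, mem 2 = 2 ^ N → mem 3 = N →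
    (mem 4 : ℝ) / 2 ^ N ∈ C.dom → ∃ e ∈ C.A, 0 < (g e).eval name mem
  sound : ∀ name, IsName S.params name → ∀ N ≥ N₀, ∀ mem : ℤ → ℤ, mem 2 = 2 ^ N → mem 3 = N →
    (mem 4 : ℝ) / 2 ^ N ∈ C.dom → ∀ e ∈ C.A, 0 < (g e).eval name mem →
      ((f e).eval name mem : ℝ) / 2 ^ N ∈ C.dom ∧
      |Real.log (mem 4 / 2 ^ N) -
        S.phi ((S.val e).1 + Real.log ((f e).eval name mem / 2 ^ N))| ≤ K / 2 ^ N
  cost : ∀ name, IsName S.params name → ∀ N ≥ N₀, ∀ mem : ℤ → ℤ, mem 2 = 2 ^ N → mem 3 = N →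
    (mem 4 : ℝ) / 2 ^ N ∈ C.dom → ∀ e ∈ C.A,
      ((f e).cost name mem : ℝ) ≤ K * (N + 1) ∧ ((g e).cost name mem : ℝ) ≤ K * (N + 1)

theorem exists_search (h : S.Computable (Real.exp S.base.1)) :
    ∃ f g, Nonempty (C.Search f g) := by
  have hh := C.h_pos
  obtain ⟨P, hP, hP'⟩ := exists_rat_btwn
    (Real.exp_lt_exp.2 (by linarith : C.z - C.h < C.z - C.h / 2))
  obtain ⟨Q, hQ, hQ'⟩ := exists_rat_btwn
    (Real.exp_lt_exp.2 (by linarith : C.z + C.h / 2 < C.z + C.h))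
  have hPQ : (P : ℝ) < Q := hP'.trans
    ((Real.exp_lt_exp.2 (by linarith : C.z - C.h / 2 < C.z + C.h / 2)).trans hQ)
  obtain ⟨eP, heP⟩ := Computable.ratCast (S := S) P C.dom
  obtain ⟨eQ, heQ⟩ := Computable.ratCast (S := S) Q C.dom
  choose f hf using C.approx_next h
  have hg : ∀ e, ∃ g, Approx S.params C.dom (fun t => (next S e t - P) * (Q - next S e t)) g :=
    fun e => ⟨_, ((hf e).sub heP).mul (heQ.sub (hf e))⟩
  choose g hg using hg
  choose c n hc _ hf using hf
  choose c' n' hc' _ hg using hg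
  obtain ⟨M₁, hM₁, hcM₁⟩ := exists_bound_list C.A c
  obtain ⟨M₂, hM₂, hcM₂⟩ := exists_bound_list C.A c'
  obtain ⟨M₃, hM₃, hnM₃⟩ := exists_bound_list C.A fun e => n e
  obtain ⟨M₄, hM₄, hnM₄⟩ := exists_bound_list C.A fun e => n' e
  set M := max M₁ M₂ with hM
  have hM0 : 0 ≤ M := hM₁.trans (le_max_left _ _)
  set η := (Real.exp (C.z - C.h / 2) - P) * (Q - Real.exp (C.z + C.h / 2)) with hη
  have hη0 : 0 < η := mul_pos (sub_pos.2 hP') (sub_pos.2 hQ)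
  set θ := min (P - Real.exp (C.z - C.h)) (Real.exp (C.z + C.h) - Q) with hθ
  have hθ0 : 0 < θ := lt_min (sub_pos.2 hP) (sub_pos.2 hQ')
  set δ := Real.exp (C.z - C.h) with hδ
  have hδ0 : 0 < δ := Real.exp_pos _
  have hdiff := sub_pos.2 hPQ
  obtain ⟨n₀, hn₀⟩ := pow_unbounded_of_one_lt
    ((M + 1) / η + M / (θ / 2) + M / (θ / 2 * (Q - P))) (by norm_num : (1 : ℝ) < 2)
  have hbig : ∀ N ≥ n₀, (M + 1) / η + M / (θ / 2) + M / (θ / 2 * (Q - P)) ≤ 2 ^ N := fun N hN =>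
    hn₀.le.trans (pow_le_pow_right₀ (by norm_num) hN)
  have hle : ∀ N ≥ max n₀ (⌈M₃⌉₊ + ⌈M₄⌉₊), n₀ ≤ N ∧ ∀ e ∈ C.A, n e ≤ N ∧ n' e ≤ N := by
    intro N hN
    refine ⟨(le_max_left _ _).trans hN, fun e he => ?_⟩
    have h1 := (le_max_right _ _).trans hN
    have h2 : n e ≤ ⌈M₃⌉₊ := by exact_mod_cast (hnM₃ e he).trans (Nat.le_ceil _)
    have h3 : n' e ≤ ⌈M₄⌉₊ := by exact_mod_cast (hnM₄ e he).trans (Nat.le_ceil _)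
    omega
  have hcM : ∀ e ∈ C.A, c e ≤ M ∧ c' e ≤ M := fun e he =>
    ⟨(hcM₁ e he).trans (le_max_left _ _), (hcM₂ e he).trans (le_max_right _ _)⟩
  have q1 : 0 ≤ (M + 1) / η := by positivity
  have q2 : 0 ≤ M / (θ / 2) := by positivity
  have q3 : 0 ≤ M / (θ / 2 * (Q - P)) := by positivity
  have hpos : ∀ N : ℕ, (0 : ℝ) < 2 ^ N := fun N => by positivity
  refine ⟨f, g, ⟨⟨M + M / δ, max n₀ (⌈M₃⌉₊ + ⌈M₄⌉₊), by positivity, ?_, ?_, ?_⟩⟩⟩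
  · intro name hname N hN mem h2 h3 h4
    obtain ⟨hN0, hNe⟩ := hle N hN
    obtain ⟨e, he, y, hy, hyz⟩ := C.covers _ (C.log_mem h4)
    refine ⟨e, he, ?_⟩
    have hG := next_eq e (y := y) (t := mem 4 / 2 ^ N)
      (by rw [hy, Real.exp_log (C.dom_pos h4)])
    have h5 := (hg e name hname N (hNe e he).2 mem h2 h3 h4).1
    beta_reduce at h5
    rw [hG] at h5
    have h6 := abs_le.1 hyz
    have h7 : η ≤ (Real.exp (y - (S.val e).1) - P) * (Q - Real.exp (y - (S.val e).1)) := by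
      have i1 : Real.exp (C.z - C.h / 2) ≤ Real.exp (y - (S.val e).1) :=
        Real.exp_le_exp.2 (by linarith [h6.1])
      have i2 : Real.exp (y - (S.val e).1) ≤ Real.exp (C.z + C.h / 2) :=
        Real.exp_le_exp.2 (by linarith [h6.2])
      have i3 := sub_pos.2 hP'
      have i4 := sub_pos.2 hQ
      exact mul_le_mul (by linarith) (by linarith) i4.le (by linarith)
    have h8 : (M + 1) / η ≤ 2 ^ N := by linarith [hbig N hN0]
    rw [div_le_iff₀ hη0] at h8
    have h9 := (abs_le.1 h5).1
    have h10 : (2 : ℝ) ^ N * η ≤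
        2 ^ N * ((Real.exp (y - (S.val e).1) - P) * (Q - Real.exp (y - (S.val e).1))) :=
      mul_le_mul_of_nonneg_left h7 (hpos N).le
    have h11 := (hcM e he).2
    have h12 : (0 : ℝ) < (g e).eval name mem := by linarith
    exact Int.cast_pos.1 h12
  · intro name hname N hN mem h2 h3 h4 e he hpass
    obtain ⟨hN0, hNe⟩ := hle N hN
    obtain ⟨y, hy⟩ := C.exists_phi_eq h4
    have hG := next_eq e hy
    have h5 := (hg e name hname N (hNe e he).2 mem h2 h3 h4).1
    have h6 := (hf e name hname N (hNe e he).1 mem h2 h3 h4).1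
    have hpass' : (0 : ℝ) < _ := Int.cast_pos.2 hpass
    have b1 := hbig N hN0
    have b2 : M / (θ / 2) ≤ 2 ^ N := by linarith
    have b3 : M / (θ / 2 * (Q - P)) ≤ 2 ^ N := by linarith
    rw [div_le_iff₀ (by positivity)] at b2 b3
    set G := next S e (mem 4 / 2 ^ N) with hGdef
    have h7 : _ ≤ c' e := (abs_le.1 h5).2
    obtain ⟨m1, m2⟩ := hcM e he
    have h8 : -(θ / 2 * (Q - P)) < (G - P) * (Q - G) := by
      have h8 : -M < 2 ^ N * ((G - P) * (Q - G)) := by linarith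
      by_contra hcon
      have h9 := mul_le_mul_of_nonneg_left (not_lt.1 hcon) (hpos N).le
      linarith
    have hG1 : P - θ / 2 ≤ G := by
      by_contra hcon
      rw [not_le] at hcon
      nlinarith
    have hG2 : G ≤ Q + θ / 2 := by
      by_contra hcon
      rw [not_le] at hcon
      nlinarith
    set T : ℝ := (((f e).eval name mem : ℤ) : ℝ) with hT
    have hTG : |T / 2 ^ N - G| ≤ M / 2 ^ N := by
      have : T / 2 ^ N - G = (T - 2 ^ N * G) / 2 ^ N := by field_simp
      rw [this, abs_div, abs_of_pos (hpos N)]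
      gcongr
      exact h6.trans m1
    have hMN : M / 2 ^ N ≤ θ / 2 := by
      rw [div_le_iff₀ (hpos N)]
      linarith
    have hTG' := abs_le.1 (hTG.trans hMN)
    have t1 : θ ≤ P - δ := min_le_left _ _
    have t2 : θ ≤ Real.exp (C.z + C.h) - Q := min_le_right _ _
    refine ⟨⟨by linarith [hTG'.1], by linarith [hTG'.2]⟩, ?_⟩
    have hlog : Real.log (mem 4 / 2 ^ N) = S.phi ((S.val e).1 + Real.log G) := by
      rw [hG, Real.log_exp, add_sub_cancel, ← hy, Real.log_exp]
    rw [hlog]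
    refine (S.abs_phi_sub_le_abs_sub _ _).trans ?_
    rw [add_sub_add_left_eq_sub, abs_sub_comm]
    refine (abs_log_sub_log_le hδ0 (by linarith [hTG'.1]) (by linarith)).trans ?_
    have : |T / 2 ^ N - G| / δ ≤ M / 2 ^ N / δ := by gcongr
    refine this.trans ?_
    rw [div_right_comm]
    gcongr
    linarith
  · intro name hname N hN mem h2 h3 h4 e he
    obtain ⟨hN0, hNe⟩ := hle N hN
    obtain ⟨m1, m2⟩ := hcM e he
    have hMδ : 0 ≤ M / δ := by positivity
    have hN' : (0 : ℝ) ≤ (N : ℝ) + 1 := by positivity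
    exact ⟨(hf e name hname N (hNe e he).1 mem h2 h3 h4).2.trans (by gcongr; linarith),
      (hg e name hname N (hNe e he).2 mem h2 h3 h4).2.trans (by gcongr; linarith)⟩

end Cover

end TwoSpin

end

/-! ### Programs which write gadgets -/

section Cost

theorem natAbs_lt_two_pow_bitLen (z : ℤ) : z.natAbs < 2 ^ bitLen z := Nat.lt_size_self _

theorem bitLen_add_le_of (x y z : ℤ) (h : z.natAbs ≤ x.natAbs + y.natAbs) :
    bitLen z ≤ bitLen x + bitLen y + 1 := by
  refine bitLen_le_of_natAbs_lt ?_
  have h1 := natAbs_lt_two_pow_bitLen x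
  have h2 := natAbs_lt_two_pow_bitLen y
  have h3 : 2 ^ bitLen x ≤ 2 ^ (bitLen x + bitLen y) := Nat.pow_le_pow_right (by norm_num) (by omega)
  have h4 : 2 ^ bitLen y ≤ 2 ^ (bitLen x + bitLen y) := Nat.pow_le_pow_right (by norm_num) (by omega)
  rw [pow_succ]
  omega

theorem bitLen_add_le (x y : ℤ) : bitLen (x + y) ≤ bitLen x + bitLen y + 1 :=
  bitLen_add_le_of x y _ (Int.natAbs_add_le x y)

theorem bitLen_sub_le (x y : ℤ) : bitLen (x - y) ≤ bitLen x + bitLen y + 1 :=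
  bitLen_add_le_of x y _ (Int.natAbs_sub_le x y)

theorem bitLen_mul_le (x y : ℤ) : bitLen (x * y) ≤ bitLen x + bitLen y := by
  refine bitLen_le_of_natAbs_lt ?_
  rw [Int.natAbs_mul, pow_add]
  exact Nat.mul_lt_mul'' (natAbs_lt_two_pow_bitLen x) (natAbs_lt_two_pow_bitLen y)

variable {k : ℕ}

/-- The value and the cost of `e` have linear size in the length of the contents of the
cells in `I`. -/
def LinCost (I : Set ℤ) (e : RamExpr k) : Prop :=
  ∃ A : ℕ, ∀ (name : Fin k → ℕ → ℤ) (mem : ℤ → ℤ) (L : ℕ), 1 ≤ L →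
    (∀ i ∈ I, bitLen (mem i) ≤ L) →
    bitLen (e.eval name mem) ≤ A * L ∧ e.cost name mem ≤ A * L

namespace LinCost

variable {I : Set ℤ} {e f : RamExpr k}

theorem const (z : ℤ) : LinCost I (.const z : RamExpr k) := by
  refine ⟨bitLen z + 1, fun name mem L hL _ => ?_⟩
  simp only [RamExpr.eval, RamExpr.cost]
  constructor <;> nlinarith

theorem cell {i : ℤ} (hi : i ∈ I) : LinCost I (.cell i : RamExpr k) := by
  refine ⟨2 * bitLen i + 3, fun name mem L hL h => ?_⟩
  have := h i hi
  simp only [RamExpr.eval, RamExpr.cost]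
  constructor <;> nlinarith

theorem add (he : LinCost I e) (hf : LinCost I f) : LinCost I (.add e f) := by
  obtain ⟨A, he⟩ := he
  obtain ⟨A', hf⟩ := hf
  refine ⟨2 * A + 2 * A' + 1, fun name mem L hL h => ?_⟩
  obtain ⟨h1, h2⟩ := he name mem L hL h
  obtain ⟨h3, h4⟩ := hf name mem L hL h
  have := bitLen_add_le (e.eval name mem) (f.eval name mem)
  simp only [RamExpr.eval, RamExpr.cost]
  constructor <;> nlinarith

theorem sub (he : LinCost I e) (hf : LinCost I f) : LinCost I (.sub e f) := by
  obtain ⟨A, he⟩ := he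
  obtain ⟨A', hf⟩ := hf
  refine ⟨2 * A + 2 * A' + 1, fun name mem L hL h => ?_⟩
  obtain ⟨h1, h2⟩ := he name mem L hL h
  obtain ⟨h3, h4⟩ := hf name mem L hL h
  have := bitLen_sub_le (e.eval name mem) (f.eval name mem)
  simp only [RamExpr.eval, RamExpr.cost]
  constructor <;> nlinarith

theorem mul (he : LinCost I e) (hf : LinCost I f) : LinCost I (.mul e f) := by
  obtain ⟨A, he⟩ := he
  obtain ⟨A', hf⟩ := hf
  refine ⟨2 * A + 2 * A' + 1, fun name mem L hL h => ?_⟩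
  obtain ⟨h1, h2⟩ := he name mem L hL h
  obtain ⟨h3, h4⟩ := hf name mem L hL h
  have := bitLen_mul_le (e.eval name mem) (f.eval name mem)
  simp only [RamExpr.eval, RamExpr.cost]
  constructor <;> nlinarith

end LinCost

/-- Started in `s`, the program `P` halts in `s'` within time `T`. -/
def RunsIn (name : Fin k → ℕ → ℤ) (P : RamProg k) (s s' : RamState) (T : ℕ) : Prop :=
  ∃ t ≤ T, RamExec name P s s' t

namespace RunsIn

variable {name : Fin k → ℕ → ℤ} {P Q : RamProg k} {e : RamExpr k} {s s' s'' : RamState} {T T' : ℕ}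

theorem mono (h : RunsIn name P s s' T) (hT : T ≤ T') : RunsIn name P s s' T' :=
  let ⟨t, ht, h⟩ := h
  ⟨t, ht.trans hT, h⟩

theorem seq (h : RunsIn name P s s' T) (h' : RunsIn name Q s' s'' T') :
    RunsIn name (.seq P Q) s s'' (T + T') :=
  let ⟨_, ht, h⟩ := h
  let ⟨_, ht', h'⟩ := h'
  ⟨_, add_le_add ht ht', .seq _ _ _ _ _ _ _ h h'⟩

theorem skip : RunsIn name .skip s s 1 := ⟨1, le_rfl, .skip s⟩

theorem store (i : ℤ) (h : e.cost name s.mem ≤ T) :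
    RunsIn name (.store (.const i) e) s ⟨Function.update s.mem i (e.eval name s.mem), s.out⟩
      (T + bitLen i + 2) :=
  ⟨_, by rw [RamExpr.cost]; omega, .store (.const i) e s⟩

theorem iteTrue (he : 0 < e.eval name s.mem) (h : RunsIn name P s s' T)
    (hc : e.cost name s.mem + 1 ≤ T') : RunsIn name (.ite e P Q) s s' (T' + T) :=
  let ⟨_, ht, h⟩ := h
  ⟨_, add_le_add hc ht, .iteTrue _ _ _ _ _ _ he h⟩

theorem iteFalse (he : e.eval name s.mem ≤ 0) (h : RunsIn name Q s s' T)
    (hc : e.cost name s.mem + 1 ≤ T') : RunsIn name (.ite e P Q) s s' (T' + T) :=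
  let ⟨_, ht, h⟩ := h
  ⟨_, add_le_add hc ht, .iteFalse _ _ _ _ _ _ he h⟩

theorem loopTrue (he : 0 < e.eval name s.mem) (h : RunsIn name P s s' T)
    (h' : RunsIn name (.loop e P) s' s'' T') :
    RunsIn name (.loop e P) s s'' (e.cost name s.mem + 1 + T + T') :=
  let ⟨_, ht, h⟩ := h
  let ⟨_, ht', h'⟩ := h'
  ⟨_, by omega, .loopTrue _ _ _ _ _ _ _ he h h'⟩

theorem loopFalse (he : e.eval name s.mem ≤ 0) :
    RunsIn name (.loop e P) s s (e.cost name s.mem + 1) :=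
  ⟨_, le_rfl, .loopFalse _ _ _ he⟩

end RunsIn

/-- The program which writes the values of a list of expressions. -/
def emitAll (es : List (RamExpr k)) : RamProg k := es.foldr (fun e P => .seq (.emit e) P) .skip

theorem exists_emitAll {I : Set ℤ} (es : List (RamExpr k)) (h : ∀ e ∈ es, LinCost I e) :
    ∃ A : ℕ, ∀ (name : Fin k → ℕ → ℤ) (s : RamState) (L : ℕ), 1 ≤ L →
      (∀ i ∈ I, bitLen (s.mem i) ≤ L) →
      ∃ s', RunsIn name (emitAll es) s s' (A * L) ∧ s'.mem = s.mem ∧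
        s'.out = s.out ++ es.map (·.eval name s.mem) := by
  induction es with
  | nil =>
    exact ⟨1, fun name s L hL _ => ⟨s, RunsIn.skip.mono (by omega), rfl, by simp⟩⟩
  | cons e es ih =>
    obtain ⟨A, hA⟩ := ih fun e he => h e (List.mem_cons_of_mem _ he)
    obtain ⟨A', hA'⟩ := h e List.mem_cons_self
    refine ⟨A + A' + 1, fun name s L hL hI => ?_⟩
    have h1 := (hA' name s.mem L hL hI).2
    have h2 : RunsIn name (.emit e) s ⟨s.mem, s.out ++ [e.eval name s.mem]⟩ (A' * L + 1) :=
      ⟨_, by omega, .emit e s⟩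
    obtain ⟨s', h3, h4, h5⟩ := hA name ⟨s.mem, s.out ++ [e.eval name s.mem]⟩ L hL hI
    exact ⟨s', (h2.seq h3).mono (by nlinarith), h4, by rw [h5]; simp⟩

end Cost

section Writing

variable {k : ℕ}

/-- The content of the cell `7`, increased by `c`. -/
abbrev RamExpr.fresh (c : ℕ) : RamExpr k := .add (.cell 7) (.const c)

/-- The expressions for a list of edges with shifted vertices. -/
def edgeExprs (E : List (ℕ × ℕ)) : List (RamExpr k) := E.flatMap fun e => [.fresh e.1, .fresh e.2]

theorem linCost_fresh (c : ℕ) : LinCost {6, 7} (.fresh c : RamExpr k) :=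
  (LinCost.cell (by simp)).add (LinCost.const _)

theorem linCost_edgeExprs (E : List (ℕ × ℕ)) : ∀ e ∈ edgeExprs (k := k) E, LinCost {6, 7} e := by
  intro e he
  simp only [edgeExprs, List.mem_flatMap, List.mem_cons, List.not_mem_nil, or_false] at he
  obtain ⟨d, -, rfl | rfl⟩ := he <;> exact linCost_fresh _

theorem eval_edgeExprs (name : Fin k → ℕ → ℤ) (mem : ℤ → ℤ) {v : ℕ} (h : mem 7 = v)
    (E : List (ℕ × ℕ)) : (edgeExprs E).map (·.eval name mem) =
      edgeListing (E.map fun e => (v + e.1, v + e.2)) := by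
  rw [edgeExprs, edgeListing, List.map_flatMap, List.flatMap_map]
  simp [RamExpr.eval, h]

variable (B : NumberedGraph)

/-- The program which writes the gadget `e` as a child of a path with end in cell `6` and next
vertex in cell `7`. -/
def advance (e : Gad) : RamProg k :=
  .seq (emitAll ([.cell 6, .cell 7] ++ edgeExprs ((0, 1) ::
      (e.graph B).numEdges.map fun d => (1 + d.1, 1 + d.2))))
    (.seq (.store (.const 6) (.cell 7)) (.store (.const 7) (.fresh (e.size B.size + 1))))

theorem exists_advance (e : Gad) : ∃ A : ℕ, ∀ (name : Fin k → ℕ → ℤ) (s : RamState) (p v : ℕ),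
    p ≤ v → s.mem 6 = p → s.mem 7 = v → ∃ s', RunsIn name (advance B e) s s' (A * (v + 1)) ∧
      s'.mem 6 = v ∧ s'.mem 7 = ((v + e.size B.size + 1 : ℕ) : ℤ) ∧
      (∀ i, i ≠ 6 → i ≠ 7 → s'.mem i = s.mem i) ∧
      s'.out = s.out ++ edgeListing ((p, v) :: e.code B.size B.numEdges v (v + 1)) := by
  obtain ⟨A, hA⟩ := exists_emitAll (k := k) (I := {6, 7}) ([.cell 6, .cell 7] ++ edgeExprs ((0, 1) ::
      (e.graph B).numEdges.map fun d => (1 + d.1, 1 + d.2))) (by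
    intro f hf
    rw [List.mem_append] at hf
    rcases hf with hf | hf
    · simp only [List.mem_cons, List.not_mem_nil, or_false] at hf
      rcases hf with rfl | rfl <;> exact LinCost.cell (by simp)
    · exact linCost_edgeExprs _ f hf)
  obtain ⟨A₁, hA₁⟩ := LinCost.cell (k := k) (I := {6, 7}) (i := 7) (by simp)
  obtain ⟨A₂, hA₂⟩ := linCost_fresh (k := k) (e.size B.size + 1)
  refine ⟨A + A₁ + 2 * A₂ + 20, fun name s p v hpv h6 h7 => ?_⟩
  have hI : ∀ i ∈ ({6, 7} : Set ℤ), bitLen (s.mem i) ≤ v + 1 := by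
    have h1 := bitLen_le_natAbs (p : ℤ)
    have h2 := bitLen_le_natAbs (v : ℤ)
    rintro i (rfl | rfl)
    · rw [h6]; simp at h1; omega
    · rw [h7]; simp at h2; omega
  obtain ⟨s₁, r1, hm, ho⟩ := hA name s (v + 1) (by omega) hI
  rw [← hm] at hI h6 h7
  have r2 := RunsIn.store (name := name) (s := s₁) 6 (hA₁ name s₁.mem (v + 1) (by omega) hI).2
  have hI' : ∀ i ∈ ({6, 7} : Set ℤ),
      bitLen (Function.update s₁.mem 6 ((.cell 7 : RamExpr k).eval name s₁.mem) i) ≤ v + 1 := by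
    rintro i (rfl | rfl)
    · simpa [RamExpr.eval] using hI 7 (by simp)
    · simpa using hI 7 (by simp)
  have r3 := RunsIn.store (name := name)
    (s := ⟨Function.update s₁.mem 6 ((.cell 7 : RamExpr k).eval name s₁.mem), s₁.out⟩) 7
    (hA₂ name _ (v + 1) (by omega) hI').2
  have b6 : bitLen 6 = 3 := by decide
  have b7 : bitLen 7 = 3 := by decide
  refine ⟨_, (r1.seq (r2.seq r3)).mono ?_, ?_, ?_, ?_, ?_⟩
  · rw [b6, b7]
    nlinarith
  · simp [RamExpr.eval, h7]
  · simp [RamExpr.eval, h7]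
    ring
  · intro i h h'
    simp [Function.update_of_ne, h, h', hm]
  · rw [hm] at h6 h7
    rw [ho]
    simp only [List.map_append, List.map_cons, List.map_nil, eval_edgeExprs name s.mem h7,
      Gad.code_eq]
    simp [edgeListing, RamExpr.eval, h6, h7, List.flatMap_map, add_assoc]

/-- The edges of a path with gadgets attached. -/
def Gad.spine (n : ℕ) (E : List (ℕ × ℕ)) : List Gad → ℕ → ℕ → List (ℕ × ℕ)
  | [], _, _ => []
  | e :: w, p, v => (p, v) :: (e.code n E v (v + 1) ++ Gad.spine n E w v (v + e.size n + 1))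

/-- The end of a path with gadgets attached, and the next vertex. -/
def Gad.spineEnd (n : ℕ) : List Gad → ℕ → ℕ → ℕ × ℕ
  | [], p, v => (p, v)
  | e :: w, _, v => Gad.spineEnd n w v (v + e.size n + 1)

theorem Gad.spine_append (n : ℕ) (E : List (ℕ × ℕ)) (w w' : List Gad) (p v : ℕ) :
    spine n E (w ++ w') p v =
      spine n E w p v ++ spine n E w' (spineEnd n w p v).1 (spineEnd n w p v).2 := by
  induction w generalizing p v with
  | nil => rfl
  | cons e w ih => simp [spine, spineEnd, ih]

theorem Gad.spineEnd_append (n : ℕ) (w w' : List Gad) (p v : ℕ) :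
    spineEnd n (w ++ w') p v = spineEnd n w' (spineEnd n w p v).1 (spineEnd n w p v).2 := by
  induction w generalizing p v with
  | nil => rfl
  | cons e w ih => simp [spineEnd, ih]

theorem Gad.code_chain (n : ℕ) (E : List (ℕ × ℕ)) (w : List Gad) (t : Gad) (p v : ℕ) :
    (chain w t).code n E p v =
      spine n E w p v ++ t.code n E (spineEnd n w p v).1 (spineEnd n w p v).2 := by
  induction w generalizing p v with
  | nil => rfl
  | cons e w ih => simp [spine, spineEnd, code, ih]

theorem Gad.size_chain (n : ℕ) (w : List Gad) (t : Gad) (p v : ℕ) :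
    (spineEnd n w p v).2 + t.size n = v + (chain w t).size n := by
  induction w generalizing p v with
  | nil => rfl
  | cons e w ih =>
    simp only [spineEnd, ih, chain_cons, size]
    omega

theorem Gad.spineEnd_le (n : ℕ) (w : List Gad) {p v : ℕ} (h : p ≤ v) :
    (spineEnd n w p v).1 ≤ (spineEnd n w p v).2 := by
  induction w generalizing p v with
  | nil => exact h
  | cons e w ih => exact ih (by omega)

theorem Gad.spineEnd_le_add {n M : ℕ} (w : List Gad) (hw : ∀ e ∈ w, e.size n + 1 ≤ M) (p v : ℕ) :
    (spineEnd n w p v).2 ≤ v + w.length * M := by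
  induction w generalizing p v with
  | nil => simp [spineEnd]
  | cons e w ih =>
    refine (ih (fun x hx => hw x (List.mem_cons_of_mem _ hx)) _ _).trans ?_
    have := hw e List.mem_cons_self
    rw [List.length_cons]
    nlinarith

/-- The program which writes a list of gadgets along a path. -/
def advanceAll (w : List Gad) : RamProg k := w.foldr (fun e P => .seq (advance B e) P) .skip

theorem exists_advanceAll (w : List Gad) : ∃ A : ℕ, ∀ (name : Fin k → ℕ → ℤ) (s : RamState)
    (p v : ℕ), p ≤ v → s.mem 6 = p → s.mem 7 = v →
      ∃ s', RunsIn name (advanceAll B w) s s' (A * (v + 1)) ∧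
        s'.mem 6 = (Gad.spineEnd B.size w p v).1 ∧ s'.mem 7 = (Gad.spineEnd B.size w p v).2 ∧
        (∀ i, i ≠ 6 → i ≠ 7 → s'.mem i = s.mem i) ∧
        s'.out = s.out ++ edgeListing (Gad.spine B.size B.numEdges w p v) := by
  induction w with
  | nil =>
    exact ⟨1, fun name s p v _ h6 h7 => ⟨s, RunsIn.skip.mono (by omega), h6, h7, fun _ _ _ => rfl,
      by simp [Gad.spine, edgeListing]⟩⟩
  | cons e w ih =>
    obtain ⟨A, hA⟩ := ih
    obtain ⟨A', hA'⟩ := exists_advance (k := k) B e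
    refine ⟨A' + A * (e.size B.size + 2), fun name s p v hpv h6 h7 => ?_⟩
    obtain ⟨s₁, r1, k6, k7, km, ko⟩ := hA' name s p v hpv h6 h7
    obtain ⟨s₂, r2, l6, l7, lm, lo⟩ := hA name s₁ v (v + e.size B.size + 1) (by omega) k6 k7
    refine ⟨s₂, (r1.seq r2).mono ?_, l6, l7, fun i h h' => (lm i h h').trans (km i h h'), ?_⟩
    · have : v + e.size B.size + 1 + 1 ≤ (e.size B.size + 2) * (v + 1) := by nlinarith
      nlinarith [Nat.mul_le_mul_left A this]
    · rw [lo, ko, Gad.spine]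
      simp [edgeListing]

/-- The program which writes the leaf at the end of a path, and the end of the listing. -/
def finish : RamProg k :=
  emitAll ([.cell 6, .cell 7] ++ (edgeExprs B.numEdges ++ [.const (-1), .fresh B.size, .const 0]))

theorem exists_finish : ∃ A : ℕ, ∀ (name : Fin k → ℕ → ℤ) (s : RamState) (p v : ℕ),
    p ≤ v → s.mem 6 = p → s.mem 7 = v →
      ∃ s', RunsIn name (finish B) s s' (A * (v + 1)) ∧ s'.mem = s.mem ∧
        s'.out = s.out ++ (edgeListing (Gad.leaf.code B.size B.numEdges p v) ++
          [-1, ((v + B.size : ℕ) : ℤ), 0]) := by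
  obtain ⟨A, hA⟩ := exists_emitAll (k := k) (I := {6, 7})
    ([.cell 6, .cell 7] ++ (edgeExprs B.numEdges ++ [.const (-1), .fresh B.size, .const 0])) (by
    intro f hf
    simp only [List.mem_append, List.mem_cons, List.not_mem_nil, or_false] at hf
    rcases hf with (rfl | rfl) | hf | rfl | rfl | rfl
    · exact LinCost.cell (by simp)
    · exact LinCost.cell (by simp)
    · exact linCost_edgeExprs _ f hf
    · exact LinCost.const _
    · exact linCost_fresh _
    · exact LinCost.const _)
  refine ⟨A, fun name s p v hpv h6 h7 => ?_⟩
  have hI : ∀ i ∈ ({6, 7} : Set ℤ), bitLen (s.mem i) ≤ v + 1 := by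
    have h1 := bitLen_le_natAbs (p : ℤ)
    have h2 := bitLen_le_natAbs (v : ℤ)
    rintro i (rfl | rfl)
    · rw [h6]; simp at h1; omega
    · rw [h7]; simp at h2; omega
  obtain ⟨s', r, hm, ho⟩ := hA name s (v + 1) (by omega) hI
  refine ⟨s', r, hm, ?_⟩
  rw [ho]
  simp only [List.map_append, List.map_cons, List.map_nil, eval_edgeExprs name s.mem h7, Gad.code]
  simp [edgeListing, RamExpr.eval, h6, h7]

end Writing

section

/-! ### The search for a chain -/

open Set

namespace TwoSpin

namespace Cover

variable {S : TwoSpin} {R : S.Region} (C : Cover R) (B : NumberedGraph) {f g : Gad → RamExpr 3}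

/-- The precision `N` and a covered field in the memory. -/
structure Ready (N : ℕ) (s : RamState) : Prop where
  two : s.mem 2 = 2 ^ N
  three : s.mem 3 = N
  four : (s.mem 4 : ℝ) / 2 ^ N ∈ C.dom

variable {C}

theorem Ready.congr {N : ℕ} {s s' : RamState} (h : C.Ready N s) (h2 : s'.mem 2 = s.mem 2)
    (h3 : s'.mem 3 = s.mem 3) (h4 : s'.mem 4 = s.mem 4) : C.Ready N s' :=
  ⟨h2.trans h.two, h3.trans h.three, by rw [h4]; exact h.four⟩

/-- The program which writes the first gadget of a list which passes the test. -/
def select (B : NumberedGraph) (f g : Gad → RamExpr 3) (l : List Gad) : RamProg 3 :=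
  l.foldr (fun e P => .ite (g e) (.seq (.store (.const 4) (f e)) (advance B e)) P) .skip

theorem exists_select (hs : C.Search f g) (l : List Gad) (hl : ∀ e ∈ l, e ∈ C.A) :
    ∃ K : ℕ, ∀ name, IsName S.params name → ∀ N ≥ hs.N₀, ∀ (s : RamState) (p v : ℕ),
      C.Ready N s → p ≤ v → s.mem 6 = p → s.mem 7 = v → (∃ e ∈ l, 0 < (g e).eval name s.mem) →
      ∃ e ∈ l, ∃ s', RunsIn name (select B f g l) s s' (K * (N + v + 1)) ∧ C.Ready N s' ∧
        |Real.log (s.mem 4 / 2 ^ N) - S.phi ((S.val e).1 + Real.log (s'.mem 4 / 2 ^ N))| ≤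
          hs.K / 2 ^ N ∧
        s'.mem 5 = s.mem 5 ∧ s'.mem 6 = v ∧ s'.mem 7 = ((v + e.size B.size + 1 : ℕ) : ℤ) ∧
        s'.out = s.out ++ edgeListing ((p, v) :: e.code B.size B.numEdges v (v + 1)) := by
  induction l with
  | nil =>
    refine ⟨0, fun name _ N _ s p v _ _ _ _ h => ?_⟩
    simp at h
  | cons e l ih =>
    obtain ⟨K, hK⟩ := ih fun x hx => hl x (List.mem_cons_of_mem _ hx)
    obtain ⟨A, hA⟩ := exists_advance (k := 3) B e
    refine ⟨K + A + 2 * ⌈hs.K⌉₊ + 10, fun name hname N hN s p v hr hpv h6 h7 hex => ?_⟩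
    have hcost := hs.cost name hname N hN s.mem hr.two hr.three hr.four e (hl e List.mem_cons_self)
    have hceil : ∀ c : ℕ, (c : ℝ) ≤ hs.K * (N + 1) → c ≤ ⌈hs.K⌉₊ * (N + 1) := by
      intro c hc
      have : (c : ℝ) ≤ ⌈hs.K⌉₊ * (N + 1) := hc.trans (by gcongr; exact Nat.le_ceil _)
      exact_mod_cast this
    have hcf := hceil _ hcost.1
    have hcg := hceil _ hcost.2
    by_cases hpos : 0 < (g e).eval name s.mem
    · obtain ⟨hdom, hlog⟩ := hs.sound name hname N hN s.mem hr.two hr.three hr.four e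
        (hl e List.mem_cons_self) hpos
      have r1 := RunsIn.store (name := name) (s := s) 4 hcf
      obtain ⟨s', r2, k6, k7, km, ko⟩ := hA name
        ⟨Function.update s.mem 4 ((f e).eval name s.mem), s.out⟩ p v hpv
        (by simpa using h6) (by simpa using h7)
      have k4 : s'.mem 4 = (f e).eval name s.mem := by
        rw [km 4 (by norm_num) (by norm_num)]
        simp
      refine ⟨e, List.mem_cons_self, s', (RunsIn.iteTrue hpos (r1.seq r2)
        (show _ ≤ ⌈hs.K⌉₊ * (N + 1) + 1 by omega)).mono ?_,
        ⟨?_, ?_, by rw [k4]; exact hdom⟩, by rw [k4]; exact hlog, ?_, k6, k7, ko⟩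
      · have : bitLen 4 = 3 := by decide
        rw [this]
        nlinarith
      · rw [km 2 (by norm_num) (by norm_num)]
        simpa using hr.two
      · rw [km 3 (by norm_num) (by norm_num)]
        simpa using hr.three
      · rw [km 5 (by norm_num) (by norm_num)]
        simp
    · have hex' : ∃ e ∈ l, 0 < (g e).eval name s.mem := by
        obtain ⟨x, hx, hx'⟩ := hex
        rcases List.mem_cons.1 hx with rfl | hx
        · exact absurd hx' hpos
        · exact ⟨x, hx, hx'⟩
      obtain ⟨x, hx, s', r, h⟩ := hK name hname N hN s p v hr hpv h6 h7 hex'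
      exact ⟨x, List.mem_cons_of_mem _ hx, s', (RunsIn.iteFalse (not_lt.1 hpos) r
        (show _ ≤ ⌈hs.K⌉₊ * (N + 1) + 1 by omega)).mono (by nlinarith), h⟩

/-- The program which writes as many gadgets as the content of cell `5` tells. -/
def search (C : Cover R) (B : NumberedGraph) (f g : Gad → RamExpr 3) : RamProg 3 :=
  .loop (.cell 5) (.seq (.store (.const 5) (.sub (.cell 5) (.const 1))) (select B f g C.A))

theorem exists_size_bound (n : ℕ) (A : List Gad) : ∃ M, 1 ≤ M ∧ ∀ e ∈ A, e.size n + 1 ≤ M := by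
  induction A with
  | nil => exact ⟨1, le_rfl, by simp⟩
  | cons e A ih =>
    obtain ⟨M, h1, h2⟩ := ih
    refine ⟨M + e.size n, by omega, fun x hx => ?_⟩
    rcases List.mem_cons.1 hx with rfl | hx
    · omega
    · have := h2 x hx
      omega

theorem log_dom_mem {t : ℝ} (ht : t ∈ C.dom) :
    Real.log t ∈ Icc (2 * R.l - R.U - 1) (2 * R.U - R.l + 1) := by
  have := C.log_mem ht
  exact ⟨by linarith [this.1, C.lower], by linarith [this.2, C.upper]⟩

theorem exists_search_run (hs : C.Search f g) :
    ∃ K : ℕ, ∀ name, IsName S.params name → ∀ N ≥ hs.N₀, ∀ (m : ℕ) (s : RamState) (p v : ℕ),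
      C.Ready N s → p ≤ v → s.mem 5 = m → s.mem 6 = p → s.mem 7 = v →
      ∃ w : List Gad, w.length = m ∧ (∀ e ∈ w, e ∈ C.A) ∧ ∃ s',
        RunsIn name (search C B f g) s s' (K * (m + 1) * (N + v + m + 1)) ∧
        s'.mem 2 = 2 ^ N ∧ s'.mem 3 = N ∧
        s'.mem 6 = (Gad.spineEnd B.size w p v).1 ∧ s'.mem 7 = (Gad.spineEnd B.size w p v).2 ∧
        s'.out = s.out ++ edgeListing (Gad.spine B.size B.numEdges w p v) ∧
        |Real.log (s.mem 4 / 2 ^ N) - S.through w (S.val .leaf).1| ≤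
          R.k₁ ^ m * (2 * (R.U - R.l) + 1) + hs.K / (1 - R.k₁) / 2 ^ N := by
  obtain ⟨K₀, hK₀⟩ := exists_select B hs C.A fun _ h => h
  obtain ⟨A₁, hA₁⟩ := LinCost.cell (k := 3) (I := {5}) (i := 5) (by simp)
  obtain ⟨A₂, hA₂⟩ := (LinCost.cell (k := 3) (I := {5}) (i := 5) (by simp)).sub (LinCost.const 1)
  obtain ⟨M, hM1, hM⟩ := exists_size_bound B.size C.A
  have h1k : 0 < 1 - R.k₁ := by linarith [R.k₁_lt_one]
  suffices H : ∀ name, IsName S.params name → ∀ N ≥ hs.N₀, ∀ (m : ℕ) (s : RamState) (p v : ℕ),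
      C.Ready N s → p ≤ v → s.mem 5 = m → s.mem 6 = p → s.mem 7 = v →
      ∃ w : List Gad, w.length = m ∧ (∀ e ∈ w, e ∈ C.A) ∧ ∃ s',
        RunsIn name (search C B f g) s s'
          ((K₀ + A₁ + A₂ + 10) * (m + 1) * (N + v + m * M + 1)) ∧
        s'.mem 2 = 2 ^ N ∧ s'.mem 3 = N ∧
        s'.mem 6 = (Gad.spineEnd B.size w p v).1 ∧ s'.mem 7 = (Gad.spineEnd B.size w p v).2 ∧
        s'.out = s.out ++ edgeListing (Gad.spine B.size B.numEdges w p v) ∧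
        |Real.log (s.mem 4 / 2 ^ N) - S.through w (S.val .leaf).1| ≤
          R.k₁ ^ m * (2 * (R.U - R.l) + 1) + hs.K / (1 - R.k₁) / 2 ^ N by
    refine ⟨(K₀ + A₁ + A₂ + 10) * M, fun name hname N hN m s p v hr hpv h5 h6 h7 => ?_⟩
    obtain ⟨w, hw, hwA, s', hr', h⟩ := H name hname N hN m s p v hr hpv h5 h6 h7
    refine ⟨w, hw, hwA, s', hr'.mono ?_, h⟩
    have : N + v + m * M + 1 ≤ M * (N + v + m + 1) := by nlinarith
    calc _ ≤ (K₀ + A₁ + A₂ + 10) * (m + 1) * (M * (N + v + m + 1)) := Nat.mul_le_mul_left _ this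
      _ = _ := by ring
  intro name hname N hN m
  induction m with
  | zero =>
    intro s p v hr hpv h5 h6 h7
    have h5' : (RamExpr.cell 5 : RamExpr 3).eval name s.mem = 0 := by simpa [RamExpr.eval] using h5
    have hc := (hA₁ name s.mem 1 le_rfl (by
      rintro i rfl
      rw [h5]
      decide)).2
    refine ⟨[], rfl, by simp, s, (RunsIn.loopFalse h5'.le).mono ?_, hr.two, hr.three, h6, h7,
      by simp [Gad.spine, edgeListing], ?_⟩
    · nlinarith
    · have q1 := log_dom_mem hr.four
      have q2 := R.val_mem .leaf
      have q3 : 0 ≤ hs.K / (1 - R.k₁) / 2 ^ N := by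
        have := hs.K_nonneg
        positivity
      rw [through_nil, pow_zero, one_mul]
      refine le_trans (abs_le.2 ⟨?_, ?_⟩) (le_add_of_nonneg_right q3)
      · linarith [q1.1, q2.2]
      · linarith [q1.2, q2.1]
  | succ m ih =>
    intro s p v hr hpv h5 h6 h7
    have h5' : 0 < (RamExpr.cell 5 : RamExpr 3).eval name s.mem := by
      simp only [RamExpr.eval, h5]
      positivity
    have hI : ∀ i ∈ ({5} : Set ℤ), bitLen (s.mem i) ≤ m + 1 := by
      rintro i rfl
      rw [h5]
      exact Approx.bitLen_natCast_le (m + 1)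
    have hc := (hA₁ name s.mem (m + 1) (by omega) hI).2
    have r1 := RunsIn.store (name := name) (s := s) 5
      (hA₂ name s.mem (m + 1) (by omega) hI).2
    set s₁ : RamState := ⟨Function.update s.mem 5
      ((RamExpr.sub (.cell 5) (.const 1) : RamExpr 3).eval name s.mem), s.out⟩ with hs₁
    have k5 : s₁.mem 5 = m := by
      simp [hs₁, RamExpr.eval, h5]
    have kr : C.Ready N s₁ := hr.congr (by simp [hs₁]) (by simp [hs₁]) (by simp [hs₁])
    have k4 : s₁.mem 4 = s.mem 4 := by simp [hs₁]
    obtain ⟨e, he, s₂, r2, lr, llog, l5, l6, l7, lo⟩ := hK₀ name hname N hN s₁ p v kr hpv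
      (by simpa [hs₁] using h6) (by simpa [hs₁] using h7)
      (hs.complete name hname N hN s₁.mem kr.two kr.three kr.four)
    obtain ⟨w, hw, hwA, s₃, r3, n2, n3, n6, n7, no, nlog⟩ := ih s₂ v (v + e.size B.size + 1) lr
      (by omega) (l5.trans k5) l6 l7
    refine ⟨e :: w, by simp [hw], ?_, s₃, (RunsIn.loopTrue h5' (r1.seq r2) r3).mono ?_, n2, n3,
      n6, n7, ?_, ?_⟩
    · intro x hx
      rcases List.mem_cons.1 hx with rfl | hx
      · exact he
      · exact hwA x hx
    · have b5 : bitLen 5 = 3 := by decide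
      have hMe := hM e he
      rw [b5]
      have t1 : N + (v + e.size B.size + 1) + m * M + 1 ≤ N + v + (m + 1) * M + 1 := by
        nlinarith
      have t2 := Nat.mul_le_mul_left ((K₀ + A₁ + A₂ + 10) * (m + 1)) t1
      have t3 : m + 1 ≤ (m + 1) * M := Nat.le_mul_of_pos_right _ hM1
      have t4 : A₁ * (m + 1) ≤ A₁ * (N + v + (m + 1) * M + 1) := Nat.mul_le_mul_left _ (by omega)
      have t5 : A₂ * (m + 1) ≤ A₂ * (N + v + (m + 1) * M + 1) := Nat.mul_le_mul_left _ (by omega)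
      have t6 : K₀ * (N + v + 1) ≤ K₀ * (N + v + (m + 1) * M + 1) :=
        Nat.mul_le_mul_left _ (by omega)
      have t7 : (K₀ + A₁ + A₂ + 10) * (m + 1 + 1) * (N + v + (m + 1) * M + 1) =
          (K₀ + A₁ + A₂ + 10) * (m + 1) * (N + v + (m + 1) * M + 1) +
            (K₀ * (N + v + (m + 1) * M + 1) + A₁ * (N + v + (m + 1) * M + 1) +
              A₂ * (N + v + (m + 1) * M + 1) + 10 * (N + v + (m + 1) * M + 1)) := by ring
      rw [t7]
      linarith
    · rw [no, lo, Gad.spine]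
      simp [hs₁, edgeListing]
    · rw [k4] at llog
      rw [through_cons]
      have q1 := log_dom_mem lr.four
      have q2 := R.val_mem e
      have q3 := R.val_mem (Gad.chain w .leaf)
      rw [val_chain_fst] at q3
      have q4 := R.abs_phi_sub_le (R.mem_domain q1 q2) (R.mem_domain (R.mem_wide q3) q2)
      rw [add_comm, add_comm (S.through _ _), add_sub_add_left_eq_sub] at q4
      have q5 := abs_sub_le (Real.log (s.mem 4 / 2 ^ N))
        (S.phi ((S.val e).1 + Real.log (s₂.mem 4 / 2 ^ N)))
        (S.phi ((S.val e).1 + S.through w (S.val .leaf).1))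
      have q6 := mul_le_mul_of_nonneg_left nlog R.k₁_pos.le
      have q7 : hs.K / (1 - R.k₁) / 2 ^ N = hs.K / 2 ^ N + R.k₁ * (hs.K / (1 - R.k₁) / 2 ^ N) := by
        field_simp
        ring
      rw [pow_succ]
      linarith

end Cover

end TwoSpin

end

section

/-! ### The algorithm -/

open Set

section Init

/-- The program which stores in cell `3` a number `N` with `2 ^ (-N) ≤ 2 ^ (-n) r`, and `2 ^ N` in
cell `2`. -/
def initPrecision (n : ℕ) : RamProg 3 :=
  .seq (.store (.const 2) (.const 1))
    (.seq (.loop (.sub (.cell 1) (.mul (.cell 2) (.cell 0)))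
      (.seq (.store (.const 2) (.mul (.cell 2) (.const 2)))
        (.store (.const 3) (.add (.cell 3) (.const 1)))))
      (.seq (.store (.const 2) (.mul (.cell 2) (.const (2 ^ n))))
        (.store (.const 3) (.add (.cell 3) (.const n)))))

/-- The input `r` together with the precision `i`. -/
structure HasPrecision (r : ℚ) (i : ℕ) (s : RamState) : Prop where
  zero : s.mem 0 = r.num
  one : s.mem 1 = r.den
  two : s.mem 2 = 2 ^ i
  three : s.mem 3 = i
  out : s.out = []

theorem HasPrecision.bitLen_le {r : ℚ} {i : ℕ} {s : RamState} (h : HasPrecision r i s)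
    (hi : i ≤ ratBits r) : ∀ j ∈ ({0, 1, 2, 3} : Set ℤ), bitLen (s.mem j) ≤ ratBits r + 1 := by
  have h0 : bitLen r.num ≤ ratBits r := Nat.le_add_right _ _
  have h1 : bitLen (r.den : ℤ) ≤ ratBits r := Nat.le_add_left _ _
  rintro j (rfl | rfl | rfl | rfl)
  · rw [h.zero]; omega
  · rw [h.one]; omega
  · rw [h.two]; exact (Approx.bitLen_two_pow i).trans (by omega)
  · rw [h.three]; exact (Approx.bitLen_natCast_le i).trans (by omega)

theorem exists_store_two (i j : ℤ) (hij : i ≠ j) {I : Set ℤ} {e f : RamExpr 3} (he : LinCost I e)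
    (hf : LinCost I f) (hi : i ∈ I) : ∃ A : ℕ, ∀ (name : Fin 3 → ℕ → ℤ) (s : RamState) (L : ℕ),
      1 ≤ L → (∀ j ∈ I, bitLen (s.mem j) ≤ L) →
      (f.eval name (Function.update s.mem i (e.eval name s.mem)) = f.eval name s.mem) →
      ∃ s', RunsIn name (.seq (.store (.const i) e) (.store (.const j) f)) s s' (A * L) ∧
        s'.mem i = e.eval name s.mem ∧ s'.mem j = f.eval name s.mem ∧
        (∀ x, x ≠ i → x ≠ j → s'.mem x = s.mem x) ∧ s'.out = s.out := by
  obtain ⟨A, hA⟩ := he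
  obtain ⟨A', hA'⟩ := hf
  refine ⟨A + A' * (A + 1) + bitLen i + bitLen j + 4, fun name s L hL hI hfe => ?_⟩
  obtain ⟨h1, h2⟩ := hA name s.mem L hL hI
  have r1 := RunsIn.store (name := name) (s := s) i h2
  have hI' : ∀ x ∈ I, bitLen (Function.update s.mem i (e.eval name s.mem) x) ≤ (A + 1) * L := by
    intro x hx
    by_cases hxi : x = i
    · subst hxi
      rw [Function.update_self]
      nlinarith
    · rw [Function.update_of_ne hxi]
      have := hI x hx
      nlinarith
  have r2 := RunsIn.store (name := name)
    (s := ⟨Function.update s.mem i (e.eval name s.mem), s.out⟩) j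
    (hA' name _ ((A + 1) * L) (by nlinarith) hI').2
  refine ⟨_, (r1.seq r2).mono ?_, ?_, ?_, ?_, rfl⟩
  · have : (A + A' * (A + 1) + bitLen i + bitLen j + 4) * L =
      A * L + A' * ((A + 1) * L) + bitLen i * L + bitLen j * L + 4 * L := by ring
    rw [this]
    have := Nat.le_mul_of_pos_right (bitLen i) hL
    have := Nat.le_mul_of_pos_right (bitLen j) hL
    linarith
  · simp [Function.update_of_ne hij]
  · simpa using hfe
  · intro x h h'
    simp [Function.update_of_ne, h, h']

theorem exists_initPrecision (n : ℕ) : ∃ K : ℕ, ∀ (name : Fin 3 → ℕ → ℤ) (r : ℚ), 0 < r →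
    ∃ (i : ℕ) (s : RamState), RunsIn name (initPrecision n) (ratInput r) s
        (K * (ratBits r + 1) ^ 2) ∧
      i ≤ ratBits r ∧ (r.den : ℤ) ≤ 2 ^ i * r.num ∧
      (i = 0 ∨ 2 ^ (i - 1) * r.num < r.den) ∧
      s.mem 2 = 2 ^ (i + n) ∧ s.mem 3 = ((i + n : ℕ) : ℤ) ∧ s.out = [] := by
  have c0 : LinCost (k := 3) {0, 1, 2, 3} (.cell 0) := .cell (by simp)
  have c1 : LinCost (k := 3) {0, 1, 2, 3} (.cell 1) := .cell (by simp)
  have c2 : LinCost (k := 3) {0, 1, 2, 3} (.cell 2) := .cell (by simp)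
  have c3 : LinCost (k := 3) {0, 1, 2, 3} (.cell 3) := .cell (by simp)
  obtain ⟨A, hA⟩ := c1.sub (c2.mul c0)
  obtain ⟨A₁, hA₁⟩ := exists_store_two 2 3 (by norm_num) (c2.mul (.const 2)) (c3.add (.const 1))
    (by simp)
  obtain ⟨A₂, hA₂⟩ := exists_store_two 2 3 (by norm_num) (c2.mul (.const (2 ^ n)))
    (c3.add (.const n)) (by simp)
  have hloop : ∀ (name : Fin 3 → ℕ → ℤ) (r : ℚ), 0 < r → ∀ (m i : ℕ) (s : RamState),
      i + m = ratBits r → HasPrecision r i s → (i = 0 ∨ 2 ^ (i - 1) * r.num < r.den) →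
      ∃ (j : ℕ) (s' : RamState), RunsIn name (.loop (.sub (.cell 1) (.mul (.cell 2) (.cell 0)))
      (.seq (.store (.const 2) (.mul (.cell 2) (.const 2)))
        (.store (.const 3) (.add (.cell 3) (.const 1))))) s s'
          ((A + A₁ + 1) * (m + 1) * (ratBits r + 1)) ∧ j ≤ ratBits r ∧
        HasPrecision r j s' ∧ (r.den : ℤ) ≤ 2 ^ j * r.num ∧
        (j = 0 ∨ 2 ^ (j - 1) * r.num < r.den) := by
    intro name r hr m
    have hnum : 0 < r.num := Rat.num_pos.2 hr
    induction m with
    | zero =>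
      intro i s hi hs hlow
      have hc := (hA name s.mem (ratBits r + 1) (by omega) (hs.bitLen_le (by omega))).2
      have h1 : (r.den : ℤ) ≤ 2 ^ i * r.num := by
        have h2 := natAbs_lt_two_pow_bitLen (r.den : ℤ)
        have h3 : bitLen (r.den : ℤ) ≤ i := by
          rw [show i = ratBits r by omega]
          exact Nat.le_add_left _ _
        have h4 : r.den < 2 ^ i :=
          lt_of_lt_of_le (by simpa using h2) (Nat.pow_le_pow_right (by norm_num) h3)
        have h5 : (r.den : ℤ) < 2 ^ i := by exact_mod_cast h4
        nlinarith
      refine ⟨i, s, (RunsIn.loopFalse ?_).mono (by nlinarith), by omega, hs, h1, hlow⟩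
      simp only [RamExpr.eval, hs.zero, hs.one, hs.two]
      linarith
    | succ m ih =>
      intro i s hi hs hlow
      have hb := hs.bitLen_le (by omega)
      have hc := (hA name s.mem (ratBits r + 1) (by omega) hb).2
      by_cases h1 : (r.den : ℤ) ≤ 2 ^ i * r.num
      · have hle : (A + A₁ + 1) * 1 * (ratBits r + 1) ≤
            (A + A₁ + 1) * (m + 1 + 1) * (ratBits r + 1) := by gcongr; omega
        refine ⟨i, s, (RunsIn.loopFalse ?_).mono (by nlinarith), by omega, hs, h1, hlow⟩
        simp only [RamExpr.eval, hs.zero, hs.one, hs.two]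
        linarith
      · rw [not_le] at h1
        obtain ⟨s₁, r1, k2, k3, km, ko⟩ := hA₁ name s (ratBits r + 1) (by omega) hb
          (by simp [RamExpr.eval])
        obtain ⟨j, s', r2, h⟩ := ih (i + 1) s₁ (by omega)
          ⟨(km 0 (by norm_num) (by norm_num)).trans hs.zero,
            (km 1 (by norm_num) (by norm_num)).trans hs.one,
            by rw [k2]; simp [RamExpr.eval, hs.two, pow_succ],
            by rw [k3]; simp [RamExpr.eval, hs.three], ko.trans hs.out⟩ (Or.inr (by simpa using h1))
        refine ⟨j, s', (RunsIn.loopTrue ?_ r1 r2).mono (by nlinarith), h⟩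
        simp only [RamExpr.eval, hs.zero, hs.one, hs.two]
        linarith
  refine ⟨A + A₁ + A₂ + 10, fun name r hr => ?_⟩
  have r0 := RunsIn.store (name := name) (e := .const 1) (s := ratInput r) 2 le_rfl
  have hp : HasPrecision r 0 ⟨Function.update (ratInput r).mem 2
      ((RamExpr.const 1 : RamExpr 3).eval name (ratInput r).mem), (ratInput r).out⟩ := by
    constructor <;> simp [ratInput, RamExpr.eval]
  obtain ⟨j, s₁, r1, hj, hs₁, hden, hlow⟩ := hloop name r hr (ratBits r) 0 _ (by simp) hp
    (Or.inl rfl)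
  obtain ⟨s₂, r2, k2, k3, km, ko⟩ := hA₂ name s₁ (ratBits r + 1) (by omega) (hs₁.bitLen_le hj)
    (by simp [RamExpr.eval])
  refine ⟨j, s₂, (r0.seq (r1.seq r2)).mono ?_, hj, hden, hlow, ?_, ?_, ko.trans hs₁.out⟩
  · have b1 : bitLen 1 = 1 := by decide
    have b2 : bitLen 2 = 2 := by decide
    have h1 : (A + A₁ + A₂ + 10) * (ratBits r + 1) ^ 2 =
        (A + A₁ + 1) * (ratBits r + 1) * (ratBits r + 1) +
          A₂ * (ratBits r + 1) * (ratBits r + 1) + 9 * (ratBits r + 1) ^ 2 := by ring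
    have h2 := Nat.le_mul_of_pos_right (A₂ * (ratBits r + 1)) (Nat.succ_pos (ratBits r))
    have h3 := Nat.one_le_pow 2 (ratBits r + 1) (Nat.succ_pos _)
    rw [Nat.succ_eq_add_one] at h2
    rw [h1]
    simp only [RamExpr.cost, b1, b2]
    linarith
  · rw [k2]
    simp [RamExpr.eval, hs₁.two, pow_add]
  · rw [k3]
    simp [RamExpr.eval, hs₁.three]

end Init

end

section

open Set

namespace TwoSpin

namespace Cover

variable {S : TwoSpin} {R : S.Region} {C : Cover R} (B : NumberedGraph) {f g : Gad → RamExpr 3}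

/-- The program which writes a chain with the prefix `pre`, continued according to the digits of the
number given by the expression `x₀`. -/
def writeChain (C : Cover R) (B : NumberedGraph) (f g : Gad → RamExpr 3) (x₀ : RamExpr 3)
    (pre : List Gad) (D : ℕ) : RamProg 3 :=
  .seq (.store (.const 4) x₀) (.seq (.store (.const 6) (.const 0)) (.seq (.store (.const 7) (.const 1))
    (.seq (advanceAll B pre) (.seq (.store (.const 5) (.mul (.const D) (.cell 3)))
      (.seq (search C B f g) (finish B))))))

theorem exists_start {x : ℝ} (hx : |x - C.z| ≤ C.h / 2) {x₀ : RamExpr 3}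
    (hx₀ : Approx S.params univ (fun _ => Real.exp x) x₀) :
    ∃ K N₀ : ℕ, ∀ name, IsName S.params name → ∀ N ≥ N₀, ∀ mem : ℤ → ℤ,
      mem 2 = 2 ^ N → mem 3 = N → (x₀.eval name mem : ℝ) / 2 ^ N ∈ C.dom ∧
        |x - Real.log (x₀.eval name mem / 2 ^ N)| ≤ K / 2 ^ N ∧
        x₀.cost name mem ≤ K * (N + 1) := by
  obtain ⟨c, n₀, hc, -, h⟩ := hx₀
  have hh := C.h_pos
  have hx := abs_le.1 hx
  set δ := Real.exp (C.z - C.h) with hδ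
  have hδ0 : 0 < δ := Real.exp_pos _
  have d1 : δ < Real.exp x := Real.exp_lt_exp.2 (by linarith)
  have d2 : Real.exp x < Real.exp (C.z + C.h) := Real.exp_lt_exp.2 (by linarith)
  set θ := min (Real.exp x - δ) (Real.exp (C.z + C.h) - Real.exp x) with hθ
  have hθ0 : 0 < θ := lt_min (sub_pos.2 d1) (sub_pos.2 d2)
  obtain ⟨n₁, hn₁⟩ := pow_unbounded_of_one_lt (c / θ) (by norm_num : (1 : ℝ) < 2)
  refine ⟨⌈c + c / δ⌉₊, max n₀ n₁, fun name hname N hN mem h2 h3 => ?_⟩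
  obtain ⟨e1, e2⟩ := h name hname N ((le_max_left _ _).trans hN) mem h2 h3 (mem_univ _)
  have hp : (0 : ℝ) < 2 ^ N := by positivity
  have hq : 0 ≤ c / δ := by positivity
  have hceil := Nat.le_ceil (c + c / δ)
  have hbig : c / θ ≤ 2 ^ N :=
    hn₁.le.trans (pow_le_pow_right₀ (by norm_num) ((le_max_right _ _).trans hN))
  rw [div_le_iff₀ hθ0] at hbig
  set T : ℝ := ((x₀.eval name mem : ℤ) : ℝ) with hT
  have hTG : |T / 2 ^ N - Real.exp x| ≤ c / 2 ^ N := by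
    have : T / 2 ^ N - Real.exp x = (T - 2 ^ N * Real.exp x) / 2 ^ N := by field_simp
    rw [this, abs_div, abs_of_pos hp]
    gcongr
  have hcN : c / 2 ^ N ≤ θ := by
    rw [div_le_iff₀ hp]
    linarith
  have hTG' := abs_le.1 (hTG.trans hcN)
  have t1 : θ ≤ Real.exp x - δ := min_le_left _ _
  have t2 : θ ≤ Real.exp (C.z + C.h) - Real.exp x := min_le_right _ _
  refine ⟨⟨by linarith [hTG'.1], by linarith [hTG'.2]⟩, ?_, ?_⟩
  · have h1 := abs_log_sub_log_le hδ0 d1.le (show δ ≤ T / 2 ^ N by linarith [hTG'.1])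
    rw [Real.log_exp, abs_sub_comm (Real.exp x)] at h1
    refine h1.trans ?_
    have : |T / 2 ^ N - Real.exp x| / δ ≤ c / 2 ^ N / δ := by gcongr
    refine this.trans ?_
    rw [div_right_comm]
    gcongr
    linarith
  · have : (x₀.cost name mem : ℝ) ≤ (⌈c + c / δ⌉₊ : ℝ) * (N + 1) :=
      e2.trans (by gcongr; linarith)
    exact_mod_cast this

theorem writeChain_size_le {N D q M q' : ℕ} (b : ℕ) (h : q' ≤ q + D * N * M) :
    q' + b ≤ (q + D * M + b + 1) * (N + 1) := by
  have h1 : (q + D * M + b + 1) * (N + 1) =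
      q + D * N * M + b + (q * N + D * M + b * N + N + 1) := by ring
  omega

theorem writeChain_time_le (K₀ K K₁ K₂ K₃ K₄ b : ℕ) {N D q M q' : ℕ} (h : q' ≤ q + D * N * M) :
    K₀ * (N + 1) + K₁ * (1 + 1) + K₂ * (N + 1) + K₃ * (D * N + 1) * (N + q + D * N + 1) +
        K₄ * (q' + 1) + 100 ≤
      (K₀ + K + 2 * K₁ + K₂ + K₃ * (D + 1) * (q + D + 1) + (K₄ + 1) * (q + D * M + b + 1) + 100) *
        (N + 1) ^ 2 := by
  have n1 : 1 ≤ (N + 1) ^ 2 := Nat.one_le_pow _ _ (by omega)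
  have n2 : N + 1 ≤ (N + 1) ^ 2 := Nat.le_self_pow (by norm_num) _
  have u1 : K₀ * (N + 1) ≤ K₀ * (N + 1) ^ 2 := Nat.mul_le_mul_left _ n2
  have u2 : 2 * K₁ * 1 ≤ 2 * K₁ * (N + 1) ^ 2 := Nat.mul_le_mul_left _ n1
  have u3 : K₂ * (N + 1) ≤ K₂ * (N + 1) ^ 2 := Nat.mul_le_mul_left _ n2
  have u4 : K₃ * (D * N + 1) * (N + q + D * N + 1) ≤
      K₃ * (D + 1) * (q + D + 1) * (N + 1) ^ 2 := by
    have v1 : D * N + 1 ≤ (D + 1) * (N + 1) := by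
      have : (D + 1) * (N + 1) = D * N + 1 + (D + N) := by ring
      omega
    have v2 : N + q + D * N + 1 ≤ (q + D + 1) * (N + 1) := by
      have : (q + D + 1) * (N + 1) = N + q + D * N + 1 + (q * N + D) := by ring
      omega
    calc _ ≤ K₃ * ((D + 1) * (N + 1)) * ((q + D + 1) * (N + 1)) :=
          Nat.mul_le_mul (Nat.mul_le_mul_left _ v1) v2
      _ = _ := by ring
  have u5 : K₄ * (q' + 1) ≤ (K₄ + 1) * (q + D * M + b + 1) * (N + 1) ^ 2 := by
    have v1 : q' + 1 ≤ (q + D * M + b + 1) * (N + 1) := by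
      have : (q + D * M + b + 1) * (N + 1) =
        q + D * N * M + 1 + (q * N + D * M + b * N + b + N) := by ring
      omega
    calc _ ≤ (K₄ + 1) * ((q + D * M + b + 1) * (N + 1)) := Nat.mul_le_mul (Nat.le_succ _) v1
      _ ≤ (K₄ + 1) * ((q + D * M + b + 1) * (N + 1) ^ 2) := by gcongr
      _ = _ := by ring
  have u7 : (K₀ + K + 2 * K₁ + K₂ + K₃ * (D + 1) * (q + D + 1) + (K₄ + 1) * (q + D * M + b + 1) +
      100) * (N + 1) ^ 2 = K₀ * (N + 1) ^ 2 + K * (N + 1) ^ 2 + 2 * K₁ * (N + 1) ^ 2 +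
      K₂ * (N + 1) ^ 2 + K₃ * (D + 1) * (q + D + 1) * (N + 1) ^ 2 +
      (K₄ + 1) * (q + D * M + b + 1) * (N + 1) ^ 2 + 100 * (N + 1) ^ 2 := by ring
  have u6 := Nat.zero_le (K * (N + 1) ^ 2)
  rw [u7]
  linarith

theorem exists_writeChain (hs : C.Search f g) {x : ℝ} (hx : |x - C.z| ≤ C.h / 2) {x₀ : RamExpr 3}
    (hx₀ : Approx S.params univ (fun _ => Real.exp x) x₀) (pre : List Gad) (D : ℕ) :
    ∃ K N₀ : ℕ, ∀ name, IsName S.params name → ∀ N ≥ N₀, ∀ s : RamState,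
      s.mem 2 = 2 ^ N → s.mem 3 = N →
      ∃ w : List Gad, (∀ e ∈ w, e ∈ C.A) ∧ ∃ s',
        RunsIn name (writeChain C B f g x₀ pre D) s s' (K * (N + 1) ^ 2) ∧
        s'.mem 2 = 2 ^ N ∧ s'.mem 3 = N ∧
        s'.out = s.out ++ (edgeListing ((Gad.chain (pre ++ w) .leaf).code B.size B.numEdges 0 1) ++
          [-1, (((Gad.un (Gad.chain (pre ++ w) .leaf)).size B.size : ℕ) : ℤ), 0]) ∧
        (Gad.chain (pre ++ w) .leaf).size B.size + 1 ≤ K * (N + 1) ∧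
        |x - S.through w (S.val .leaf).1| ≤
          R.k₁ ^ (D * N) * (2 * (R.U - R.l) + 1) + K / 2 ^ N := by
  obtain ⟨K₀, n₀, h₀⟩ := exists_start hx hx₀
  obtain ⟨K₁, h₁⟩ := exists_advanceAll (k := 3) B pre
  obtain ⟨K₂, h₂⟩ := (LinCost.const D).mul (LinCost.cell (k := 3) (I := {3}) (i := 3) (by simp))
  obtain ⟨K₃, h₃⟩ := exists_search_run B hs
  obtain ⟨K₄, h₄⟩ := exists_finish (k := 3) B
  obtain ⟨M, hM1, hM⟩ := exists_size_bound B.size C.A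
  set q := Gad.spineEnd B.size pre 0 1 with hq
  have hq12 : q.1 ≤ q.2 := Gad.spineEnd_le _ _ (by norm_num)
  refine ⟨K₀ + ⌈hs.K / (1 - R.k₁)⌉₊ + 2 * K₁ + K₂ + K₃ * (D + 1) * (q.2 + D + 1) +
    (K₄ + 1) * (q.2 + D * M + B.size + 1) + 100, max n₀ hs.N₀, fun name hname N hN s s2 s3 => ?_⟩
  obtain ⟨x1, x2, x3⟩ := h₀ name hname N ((le_max_left _ _).trans hN) s.mem s2 s3
  have r1 := RunsIn.store (name := name) (s := s) 4 x3
  set s₁ : RamState := ⟨Function.update s.mem 4 (x₀.eval name s.mem), s.out⟩ with hs₁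
  have r2 := RunsIn.store (name := name) (e := .const 0) (s := s₁) 6 le_rfl
  set s₂ : RamState := ⟨Function.update s₁.mem 6 ((RamExpr.const 0 : RamExpr 3).eval name s₁.mem),
    s₁.out⟩ with hs₂
  have r3 := RunsIn.store (name := name) (e := .const 1) (s := s₂) 7 le_rfl
  set s₃ : RamState := ⟨Function.update s₂.mem 7 ((RamExpr.const 1 : RamExpr 3).eval name s₂.mem),
    s₂.out⟩ with hs₃
  obtain ⟨s₄, r4, a6, a7, am, ao⟩ := h₁ name s₃ 0 1 (by norm_num)
    (by simp [hs₃, hs₂, RamExpr.eval]) (by simp [hs₃, RamExpr.eval])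
  have a2 : s₄.mem 2 = 2 ^ N := by
    rw [am 2 (by norm_num) (by norm_num)]
    simpa [hs₃, hs₂, hs₁] using s2
  have a3 : s₄.mem 3 = N := by
    rw [am 3 (by norm_num) (by norm_num)]
    simpa [hs₃, hs₂, hs₁] using s3
  have a4 : s₄.mem 4 = x₀.eval name s.mem := by
    rw [am 4 (by norm_num) (by norm_num)]
    simp [hs₃, hs₂, hs₁]
  have r5 := RunsIn.store (name := name) (s := s₄) 5 (h₂ name s₄.mem (N + 1) (by omega) (by
    rintro i rfl
    rw [a3]
    exact (Approx.bitLen_natCast_le N).trans (by omega))).2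
  set s₅ : RamState := ⟨Function.update s₄.mem 5
    ((RamExpr.mul (.const D) (.cell 3) : RamExpr 3).eval name s₄.mem), s₄.out⟩ with hs₅
  obtain ⟨w, hw, hwA, s₆, r6, b2, b3, b6, b7, bo, blog⟩ := h₃ name hname N
    ((le_max_right _ _).trans hN) (D * N) s₅ q.1 q.2
    ⟨by simpa [hs₅] using a2, by simpa [hs₅] using a3, by simpa [hs₅, a4] using x1⟩ hq12
    (by simp [hs₅, RamExpr.eval, a3]) (by simpa [hs₅] using a6) (by simpa [hs₅] using a7)
  set q' := Gad.spineEnd B.size w q.1 q.2 with hq'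
  obtain ⟨s₇, r7, cm, co⟩ := h₄ name s₆ q'.1 q'.2 (Gad.spineEnd_le _ _ hq12) b6 b7
  have hend : Gad.spineEnd B.size (pre ++ w) 0 1 = q' := Gad.spineEnd_append _ _ _ _ _
  have hq'2 : q'.2 ≤ q.2 + D * N * M := by
    have := Gad.spineEnd_le_add w (fun e he => hM e (hwA e he)) q.1 q.2
    rwa [hw] at this
  have hsize : q'.2 + B.size = 1 + (Gad.chain (pre ++ w) .leaf).size B.size := by
    have := Gad.size_chain B.size (pre ++ w) .leaf 0 1
    rwa [hend] at this
  refine ⟨w, hwA, s₇, (r1.seq (r2.seq (r3.seq (r4.seq (r5.seq (r6.seq r7)))))).mono ?_,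
    by rw [cm]; exact b2, by rw [cm]; exact b3, ?_, ?_, ?_⟩
  · have e4 : bitLen 4 = 3 := by decide
    have e5 : bitLen 5 = 3 := by decide
    have e6 : bitLen 6 = 3 := by decide
    have e7 : bitLen 7 = 3 := by decide
    have e0 : bitLen 0 = 0 := by decide
    have e1 : bitLen 1 = 1 := by decide
    simp only [RamExpr.cost, e0, e1, e4, e5, e6, e7]
    have := writeChain_time_le K₀ ⌈hs.K / (1 - R.k₁)⌉₊ K₁ K₂ K₃ K₄ B.size hq'2
    linarith
  · rw [co, bo, Gad.code_chain, hend, Gad.spine_append]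
    have : ((q'.2 + B.size : ℕ) : ℤ) =
        (((Gad.un (Gad.chain (pre ++ w) .leaf)).size B.size : ℕ) : ℤ) := by
      rw [hsize, Gad.size, add_comm]
    rw [this]
    simp only [hs₅, ao, hs₃, hs₂, hs₁, edgeListing, List.flatMap_append, List.append_assoc, ← hq]
  · rw [add_comm, ← hsize]
    refine (writeChain_size_le B.size hq'2).trans (Nat.mul_le_mul_right _ ?_)
    have := Nat.le_mul_of_pos_left (q.2 + D * M + B.size + 1) (Nat.succ_pos K₄)
    rw [Nat.succ_eq_add_one] at this
    omega
  · have v1 := abs_sub_le x (Real.log (x₀.eval name s.mem / 2 ^ N)) (S.through w (S.val .leaf).1)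
    have v2 : s₅.mem 4 = x₀.eval name s.mem := by simpa [hs₅] using a4
    rw [v2] at blog
    refine v1.trans ((add_le_add x2 blog).trans ?_)
    have v3 := Nat.le_ceil (hs.K / (1 - R.k₁))
    have v4 : (K₀ : ℝ) / 2 ^ N + hs.K / (1 - R.k₁) / 2 ^ N ≤
        ((K₀ + ⌈hs.K / (1 - R.k₁)⌉₊ + 2 * K₁ + K₂ + K₃ * (D + 1) * (q.2 + D + 1) +
          (K₄ + 1) * (q.2 + D * M + B.size + 1) + 100 : ℕ) : ℝ) / 2 ^ N := by
      rw [← add_div]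
      gcongr
      refine (add_le_add le_rfl v3).trans ?_
      norm_cast
      omega
    linarith

end Cover

end TwoSpin

end

section

open Set

/-- The listing of a gadget. -/
def Gad.listing (B : NumberedGraph) (t : Gad) : List ℤ :=
  edgeListing (t.code B.size B.numEdges 0 1) ++ [-1, (((Gad.un t).size B.size : ℕ) : ℤ), 0]

theorem abs_exp_sub_le {V y η r : ℝ} (hV : 0 < V) (h : |Real.log V - y| ≤ η) (hη : η ≤ 1)
    (hr : V * (2 * η) ≤ r) : |Real.exp y - V| ≤ r := by
  have h1 : Real.exp y - V = V * (Real.exp (y - Real.log V) - 1) := by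
    rw [Real.exp_sub, Real.exp_log hV]
    field_simp
  rw [abs_sub_comm] at h
  rw [h1, abs_mul, abs_of_pos hV]
  refine le_trans ?_ hr
  gcongr
  exact (Real.abs_exp_sub_one_le (h.trans hη)).trans (by linarith)

section Precision

variable {r : ℚ} {i : ℕ}

theorem one_div_two_pow_le (h : (r.den : ℤ) ≤ 2 ^ i * r.num) : 1 / (2 : ℝ) ^ i ≤ r := by
  have h1 : (r.den : ℝ) ≤ 2 ^ i * r.num := by exact_mod_cast h
  have h2 : (0 : ℝ) < r.den := by exact_mod_cast r.den_pos
  rw [Rat.cast_def, div_le_div_iff₀ (by positivity) h2]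
  linarith

theorem le_abs_log (hr : 0 < r) (h : i = 0 ∨ 2 ^ (i - 1) * r.num < r.den) :
    (i : ℝ) * Real.log 2 ≤ |Real.log r| + Real.log 2 := by
  have hlog := Real.log_pos (by norm_num : (1 : ℝ) < 2)
  rcases Nat.eq_zero_or_pos i with rfl | hi
  · have := abs_nonneg (Real.log r)
    push_cast
    linarith
  · have h1 : 2 ^ (i - 1) * r.num < r.den := h.resolve_left hi.ne'
    have h2 : (2 : ℝ) ^ (i - 1) * r.num < r.den := by exact_mod_cast h1
    have h3 : (0 : ℝ) < r.den := by exact_mod_cast r.den_pos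
    have h4 : (0 : ℝ) < r := by exact_mod_cast hr
    have h5 : (2 : ℝ) ^ (i - 1) * r < 1 := by
      rw [Rat.cast_def, mul_div_assoc', div_lt_one h3]
      exact h2
    have h6 := Real.log_lt_log (by positivity) h5
    rw [Real.log_mul (by positivity) h4.ne', Real.log_pow, Real.log_one, Nat.cast_sub hi] at h6
    have h7 := neg_abs_le (Real.log r)
    push_cast at h6
    linarith

theorem log_two_le_abs_log (hr : 0 < r) (hr' : r < 1 / 2) : Real.log 2 ≤ |Real.log r| := by
  have h4 : (0 : ℝ) < r := by exact_mod_cast hr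
  have h5 : (r : ℝ) < 1 / 2 := by
    have : ((r : ℚ) : ℝ) < ((1 / 2 : ℚ) : ℝ) := by exact_mod_cast hr'
    simpa using this
  have h6 := Real.log_lt_log h4 h5
  rw [one_div, Real.log_inv] at h6
  rw [abs_of_neg (by linarith [Real.log_pos (by norm_num : (1 : ℝ) < 2)])]
  linarith

end Precision

namespace TwoSpin

variable {S : TwoSpin} {R : S.Region}

/-- An algorithm which writes two gadgets with leaves `B`, with prescribed accuracy of the fields and
with distant gaps. -/
def HasAlgorithm (S : TwoSpin) (B : NumberedGraph) : Prop :=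
  ∃ Rhat Ohat Xi : ℝ, 0 < Rhat ∧ 0 < Ohat ∧ 0 < Xi ∧
    ∃ (alg : RamProg 3) (time : Polynomial ℕ) (c : ℝ),
      ∀ name, IsName S.params name → ∀ r : ℚ, 0 < r → r < 1 / 2 →
        ∃ t₁ t₂ : Gad,
          RamOutputs name alg r (t₁.listing B ++ t₂.listing B) (time.eval (ratBits r)) ∧
          (∀ t ∈ ({t₁, t₂} : Set Gad), ((t.size B.size + 1 : ℕ) : ℝ) ≤ c * |Real.log r| ∧
            |Real.exp (S.val t).1 - Rhat| ≤ r ∧ |(S.val t).2| ≤ Xi) ∧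
          Ohat ≤ |(S.val t₁).2 - (S.val t₂).2|

theorem Cover.hasAlgorithm (C : Cover R) (hnt : ¬ S.IsTrivial)
    (hcomp : S.Computable (Real.exp S.base.1)) (B : NumberedGraph) :
    S.HasAlgorithm B := by
  obtain ⟨p₁, p₂, V, O, hV, hO, hp, hgap⟩ := exists_prefixes C hnt
  obtain ⟨x₁, hx₁, hx₁'⟩ := hp p₁ (by simp)
  obtain ⟨x₂, hx₂, hx₂'⟩ := hp p₂ (by simp)
  have hV' : (0 : ℝ) < V := by exact_mod_cast hV
  have hcV : S.Computable (Real.exp (Real.log V)) := by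
    rw [Real.exp_log hV']
    exact .ratCast V
  obtain ⟨e₁, he₁⟩ := hcomp.exp_of_through p₁ hcV hx₁' univ
  obtain ⟨e₂, he₂⟩ := hcomp.exp_of_through p₂ hcV hx₂' univ
  obtain ⟨f, g, ⟨hs⟩⟩ := C.exists_search hcomp
  obtain ⟨M, hM0, hM⟩ := exists_gap_bound R (p₁ ++ p₂ ++ C.A)
  have hk := R.k₁_pos
  obtain ⟨D, hD⟩ := exists_pow_lt_of_lt_one (by norm_num : (0 : ℝ) < 1 / 2) R.k₁_lt_one
  obtain ⟨K₁, n₁, h₁⟩ := exists_writeChain B hs hx₁ he₁ p₁ D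
  obtain ⟨K₂, n₂, h₂⟩ := exists_writeChain B hs hx₂ he₂ p₂ D
  have hW : 0 ≤ R.U - R.l := by linarith [R.U_nonneg, R.l_nonpos]
  set W := 2 * (R.U - R.l) + 1 with hWdef
  have hW0 : 0 ≤ W := by linarith
  obtain ⟨n₃, hn₃⟩ := pow_unbounded_of_one_lt ((W + (K₁ + K₂ : ℕ)) * (1 + 2 * V))
    (by norm_num : (1 : ℝ) < 2)
  set n := max n₃ (max n₁ n₂) with hn
  obtain ⟨K₀, h₀⟩ := exists_initPrecision n
  have hlog := Real.log_pos (by norm_num : (1 : ℝ) < 2)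
  refine ⟨V, O, M + 1, hV', hO, by linarith, .seq (initPrecision n)
    (.seq (writeChain C B f g e₁ p₁ D) (writeChain C B f g e₂ p₂ D)),
    .C (K₀ + (K₁ + K₂) * (n + 1) ^ 2) * (.X + 1) ^ 2,
    (K₁ + K₂ : ℕ) * (n + 3) / Real.log 2, fun name hname r hr hr' => ?_⟩
  obtain ⟨i, s, r0, hi, hden, hlow, s2, s3, so⟩ := h₀ name r hr
  have hNn : n ≤ i + n := Nat.le_add_left _ _
  obtain ⟨w₁, hw₁, s', r1, k2, k3, ko, ks, kx⟩ := h₁ name hname (i + n)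
    (((le_max_left _ _).trans (le_max_right _ _)).trans hNn) s s2 s3
  obtain ⟨w₂, hw₂, s'', r2, -, -, lo, ls, lx⟩ := h₂ name hname (i + n)
    (((le_max_right _ _).trans (le_max_right _ _)).trans hNn) s' k2 k3
  have hr0 : (0 : ℝ) < r := by exact_mod_cast hr
  have hpn : (0 : ℝ) < 2 ^ n := by positivity
  have key : ∀ (p w : List Gad) (x : ℝ) (K : ℕ), S.through p x = Real.log V →
      (∀ e ∈ p, e ∈ p₁ ++ p₂ ++ C.A) → (∀ e ∈ w, e ∈ C.A) → K ≤ K₁ + K₂ →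
      (Gad.chain (p ++ w) .leaf).size B.size + 1 ≤ K * (i + n + 1) →
      |x - S.through w (S.val .leaf).1| ≤ R.k₁ ^ (D * (i + n)) * W + K / 2 ^ (i + n) →
      (((Gad.chain (p ++ w) .leaf).size B.size + 1 : ℕ) : ℝ) ≤
          (K₁ + K₂ : ℕ) * (n + 3) / Real.log 2 * |Real.log r| ∧
        |Real.exp (S.val (Gad.chain (p ++ w) .leaf)).1 - V| ≤ r ∧
        |(S.val (Gad.chain (p ++ w) .leaf)).2| ≤ M + 1 := by
    intro p w x K hpx hpA hwA hK hsize hx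
    refine ⟨?_, ?_, ?_⟩
    · have h1 : (((Gad.chain (p ++ w) .leaf).size B.size + 1 : ℕ) : ℝ) ≤ K * (i + n + 1) := by
        exact_mod_cast hsize
      have h2 := le_abs_log hr hlow
      have h3 := log_two_le_abs_log hr hr'
      have h4 : (K : ℝ) ≤ ((K₁ + K₂ : ℕ) : ℝ) := by exact_mod_cast hK
      refine h1.trans ?_
      rw [div_mul_eq_mul_div, le_div_iff₀ hlog]
      have h5 : ((i : ℝ) + n + 1) * Real.log 2 ≤ (n + 3) * |Real.log r| := by
        have h6 : (n : ℝ) * Real.log 2 ≤ n * |Real.log r| := by gcongr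
        linarith
      calc (K : ℝ) * (i + n + 1) * Real.log 2 = K * ((i + n + 1) * Real.log 2) := by ring
        _ ≤ ((K₁ + K₂ : ℕ) : ℝ) * ((n + 3) * |Real.log r|) := by gcongr
        _ = _ := by ring
    · have h1 : |Real.log V - (S.val (Gad.chain (p ++ w) .leaf)).1| ≤
          (W + (K₁ + K₂ : ℕ)) / 2 ^ n * r := by
        rw [Gad.chain_append, val_chain_fst, val_chain_fst, ← hpx]
        refine (S.abs_through_sub_le p _ _).trans (hx.trans ?_)
        have h2 : R.k₁ ^ (D * (i + n)) ≤ 1 / 2 ^ (i + n) := by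
          rw [pow_mul, ← one_div_pow]
          gcongr
        have h3 : 1 / (2 : ℝ) ^ (i + n) ≤ r / 2 ^ n := by
          rw [pow_add, ← div_div]
          gcongr
          exact one_div_two_pow_le hden
        have h4 : (K : ℝ) ≤ ((K₁ + K₂ : ℕ) : ℝ) := by exact_mod_cast hK
        calc _ ≤ 1 / 2 ^ (i + n) * W + K / 2 ^ (i + n) := by gcongr
          _ = (W + K) * (1 / 2 ^ (i + n)) := by ring
          _ ≤ (W + (K₁ + K₂ : ℕ)) * (r / 2 ^ n) := by gcongr
          _ = _ := by ring
      have h5 : (W + (K₁ + K₂ : ℕ)) * (1 + 2 * V) ≤ 2 ^ n :=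
        hn₃.le.trans (pow_le_pow_right₀ (by norm_num) (le_max_left _ _))
      have h6 : 0 ≤ W + ((K₁ + K₂ : ℕ) : ℝ) := by positivity
      have h7 : (W + (K₁ + K₂ : ℕ)) / 2 ^ n * (1 + 2 * V) ≤ 1 := by
        rw [div_mul_eq_mul_div, div_le_one hpn]
        exact h5
      have h8 : 0 ≤ (W + (K₁ + K₂ : ℕ)) / 2 ^ n := by positivity
      have h9 : (r : ℝ) ≤ 1 := by
        have : r ≤ 1 := by linarith
        exact_mod_cast this
      refine abs_exp_sub_le hV' h1 ?_ ?_
      · have : (W + (K₁ + K₂ : ℕ)) / 2 ^ n ≤ 1 := by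
          have := mul_nonneg h8 hV'.le
          linarith
        exact mul_le_one₀ this hr0.le h9
      · have : V * (2 * ((W + (K₁ + K₂ : ℕ)) / 2 ^ n * r)) =
            ((W + (K₁ + K₂ : ℕ)) / 2 ^ n * (2 * V)) * r := by ring
        rw [this]
        refine mul_le_of_le_one_left hr0.le ?_
        linarith
    · refine (hM _ fun e he => ?_).trans (by linarith)
      rcases List.mem_append.1 he with he | he
      · exact hpA e he
      · exact List.mem_append_right _ (hwA e he)
  refine ⟨Gad.chain (p₁ ++ w₁) .leaf, Gad.chain (p₂ ++ w₂) .leaf, ?_, ?_, hgap w₁ w₂ hw₁ hw₂⟩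
  · obtain ⟨t, ht, hrun⟩ := r0.seq (r1.seq r2)
    refine ⟨s'', t, hrun, ?_, ht.trans ?_⟩
    · rw [lo, ko, so]
      rfl
    · have h1 : i + n + 1 ≤ (n + 1) * (ratBits r + 1) := by
        have : (n + 1) * (ratBits r + 1) = n * ratBits r + ratBits r + n + 1 := by ring
        have := Nat.zero_le (n * ratBits r)
        omega
      simp only [Polynomial.eval_mul, Polynomial.eval_C, Polynomial.eval_pow, Polynomial.eval_add,
        Polynomial.eval_X, Polynomial.eval_one]
      have h2 := Nat.pow_le_pow_left h1 2
      calc _ = K₀ * (ratBits r + 1) ^ 2 + (K₁ + K₂) * (i + n + 1) ^ 2 := by ring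
        _ ≤ K₀ * (ratBits r + 1) ^ 2 + (K₁ + K₂) * ((n + 1) * (ratBits r + 1)) ^ 2 := by gcongr
        _ = _ := by ring
  · rintro t (rfl | rfl)
    · exact key p₁ w₁ x₁ K₁ hx₁' (fun e he => by simp [he]) hw₁ (by omega) ks kx
    · exact key p₂ w₂ x₂ K₂ hx₂' (fun e he => by simp [he]) hw₂ (by omega) ls lx

end TwoSpin

end

section

/-! ### The three kinds of leaves -/

open Set

namespace TwoSpin

variable {S : TwoSpin}

theorem hasAlgorithm_of_phi_ne (hnt : ¬ S.IsTrivial) (hcomp : S.Computable (Real.exp S.base.1))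
    (hb : S.phi S.base.1 ≠ S.base.1) (B : NumberedGraph) : S.HasAlgorithm B := by
  obtain ⟨R⟩ := S.nonempty_region
  obtain ⟨C⟩ := nonempty_cover R hb
  exact C.hasAlgorithm hnt hcomp B

theorem hasAlgorithm_of_fst_eq {t₁ t₂ : Gad} (h : (S.val t₁).1 = (S.val t₂).1)
    (hne : (S.val t₁).2 ≠ (S.val t₂).2) (B : NumberedGraph) : S.HasAlgorithm B := by
  obtain ⟨A, hA⟩ := exists_emitAll (k := 3) (I := ∅)
    ((t₁.listing B ++ t₂.listing B).map RamExpr.const) (by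
      intro e he
      obtain ⟨z, -, rfl⟩ := List.mem_map.1 he
      exact LinCost.const z)
  have hlog := Real.log_pos (by norm_num : (1 : ℝ) < 2)
  refine ⟨Real.exp (S.val t₁).1, |(S.val t₁).2 - (S.val t₂).2|, |(S.val t₁).2| + |(S.val t₂).2| + 1,
    Real.exp_pos _, abs_pos.2 (sub_ne_zero.2 hne), by positivity,
    emitAll ((t₁.listing B ++ t₂.listing B).map RamExpr.const), .C A,
    (t₁.size B.size + t₂.size B.size + 1) / Real.log 2, fun name hname r hr hr' =>
      ⟨t₁, t₂, ?_, ?_, le_rfl⟩⟩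
  · obtain ⟨s, ⟨t, ht, hrun⟩, -, ho⟩ := hA name (ratInput r) 1 le_rfl (by simp)
    refine ⟨s, t, hrun, ?_, by simpa using ht⟩
    rw [ho, List.map_map]
    have : (fun e : RamExpr 3 => e.eval name (ratInput r).mem) ∘ RamExpr.const = id := rfl
    rw [this]
    simp [ratInput]
  · have hr0 : (0 : ℝ) < r := by exact_mod_cast hr
    have h2 := log_two_le_abs_log hr hr'
    have hsize : ∀ m : ℕ, m + 1 ≤ t₁.size B.size + t₂.size B.size + 1 → ((m + 1 : ℕ) : ℝ) ≤
        (t₁.size B.size + t₂.size B.size + 1) / Real.log 2 * |Real.log r| := by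
      intro m hm
      have h3 : ((m + 1 : ℕ) : ℝ) ≤ t₁.size B.size + t₂.size B.size + 1 := by exact_mod_cast hm
      rw [div_mul_eq_mul_div, le_div_iff₀ hlog]
      gcongr
    rintro t (rfl | rfl)
    · refine ⟨hsize _ (by omega), by simpa using hr0.le, ?_⟩
      linarith [abs_nonneg (S.val t₂).2]
    · refine ⟨hsize _ (by omega), by simpa [h] using hr0.le, ?_⟩
      linarith [abs_nonneg (S.val t₁).2]

/-- The conclusion about field gadgets, from that about shapes of gadgets. -/
theorem HasAlgorithm.fieldGadgets {B : NumberedGraph} (h : S.HasAlgorithm B) (hB : S.IsBase B)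
    (hroot : B.deg B.root ≤ 2) (hdeg : ∀ v, B.deg v ≤ 3)
    (hgadget : ∀ t : Gad, IsFieldGadget S.β S.γ S.lam (t.rooted B)) :
    ∃ Rhat Ohat Xi : ℝ, 0 < Rhat ∧ 0 < Ohat ∧ 0 < Xi ∧
      ∃ (alg : RamProg 3) (time : Polynomial ℕ) (C : ℝ),
        ∀ name : Fin 3 → ℕ → ℤ, IsName ![S.β, S.γ, S.lam] name →
        ∀ r : ℚ, 0 < r → r < 1 / 2 →
          ∃ (T₁ T₂ : RootedGraph) (L₁ L₂ : List ℤ),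
            RamOutputs name alg r (L₁ ++ L₂) (time.eval (ratBits r)) ∧
            IsListing L₁ T₁ ∧ IsListing L₂ T₂ ∧
            (∀ T ∈ ({T₁, T₂} : Set RootedGraph),
              IsFieldGadget S.β S.γ S.lam T ∧
              (∀ v, (T.graph.neighborSet v).ncard ≤ 3) ∧
              (T.n : ℝ) ≤ C * |Real.log r| ∧
              |effectiveField S.β S.γ S.lam T.graph T.root - Rhat| ≤ r ∧
              |observableGap S.β S.γ S.lam S.a S.b S.c T.graph T.root| ≤ Xi) ∧
            Ohat ≤ |observableGap S.β S.γ S.lam S.a S.b S.c T₁.graph T₁.root -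
              observableGap S.β S.γ S.lam S.a S.b S.c T₂.graph T₂.root| := by
  obtain ⟨Rhat, Ohat, Xi, hR, hO, hX, alg, time, c, h⟩ := h
  refine ⟨Rhat, Ohat, Xi, hR, hO, hX, alg, time, c, fun name hname r hr hr' => ?_⟩
  obtain ⟨t₁, t₂, hout, ht, hgap⟩ := h name hname r hr hr'
  have key : ∀ t ∈ ({t₁, t₂} : Set Gad), IsFieldGadget S.β S.γ S.lam (t.rooted B) ∧
      (∀ v, ((t.rooted B).graph.neighborSet v).ncard ≤ 3) ∧
      ((t.rooted B).n : ℝ) ≤ c * |Real.log r| ∧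
      |effectiveField S.β S.γ S.lam (t.rooted B).graph (t.rooted B).root - Rhat| ≤ r ∧
      |observableGap S.β S.γ S.lam S.a S.b S.c (t.rooted B).graph (t.rooted B).root| ≤ Xi := by
    intro t hmem
    obtain ⟨h1, h2, h3⟩ := ht t hmem
    rw [(rooted_spec hB t).1, (rooted_spec hB t).2]
    exact ⟨hgadget t, Gad.deg_rooted_le B hroot hdeg t, by rwa [Gad.rooted_n], h2, h3⟩
  refine ⟨t₁.rooted B, t₂.rooted B, t₁.listing B, t₂.listing B, hout, Gad.isListing_rooted B t₁,
    Gad.isListing_rooted B t₂, ?_, ?_⟩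
  · rintro T (rfl | rfl)
    · exact key t₁ (by simp)
    · exact key t₂ (by simp)
  · rw [(rooted_spec hB t₁).2, (rooted_spec hB t₂).2]
    exact hgap

theorem phi_eq_zero_iff : S.phi 0 = 0 ↔ S.lam * (1 - S.γ) = 1 - S.β := by
  rw [← Real.exp_eq_one_iff, S.exp_phi, fieldStep, Real.exp_zero,
    div_eq_one_iff_eq (by have := S.den_pos 0; rw [act, Real.exp_zero] at this; exact this.ne')]
  constructor <;> intro h <;> linarith

theorem computable_cycleField : S.Computable (cycleField S.β S.γ S.lam) := by
  have hl := S.lam_pos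
  have m : S.Computable (S.β + S.lam * S.γ) := .add .β (.mul .lam .γ)
  refine .div (.add m.sq (.mul .lam (.sq (.add .one (.mul .lam (.sq .γ))))))
    (.add (.sq (.add (.sq .β) .lam)) (.mul .lam m.sq)) ?_
  have h : 0 < S.β ^ 2 + S.lam := by positivity
  positivity

end TwoSpin

theorem cycleField_ne_one {β γ lam : ℝ} (hlam : 0 < lam) (h : lam * (1 - γ) = 1 - β)
    (hlt : β * γ < 1) (hne : lam ≠ 1) : cycleField β γ lam ≠ 1 := by
  have hβ : β ≠ 1 := by
    rintro rfl
    have : γ = 1 := by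
      have h1 : lam * (1 - γ) = 0 := by linarith
      have := (mul_eq_zero.1 h1).resolve_left hlam.ne'
      linarith
    rw [this] at hlt
    linarith
  have hd : 0 < β ^ 2 + lam := by positivity
  have hd' : 0 < (β ^ 2 + lam) ^ 2 + lam * (β + lam * γ) ^ 2 := by positivity
  rw [cycleField, Ne, div_eq_one_iff_eq hd'.ne', ← sub_eq_zero]
  have hg : γ = (lam - 1 + β) / lam := by
    field_simp
    linarith
  have e : (β + lam * γ) ^ 2 + lam * (1 + lam * γ ^ 2) ^ 2 -
      ((β ^ 2 + lam) ^ 2 + lam * (β + lam * γ) ^ 2) = (1 - lam) * (1 - β) ^ 4 / lam := by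
    rw [hg]
    field_simp
    ring
  rw [e]
  exact div_ne_zero (mul_ne_zero (sub_ne_zero.2 hne.symm) (pow_ne_zero _ (sub_ne_zero.2 hβ.symm)))
    hlam.ne'

theorem cycleField_symm (β : ℝ) : cycleField β β 1 = 1 := by
  have : 0 < (β ^ 2 + 1) ^ 2 + 1 * (β + 1 * β) ^ 2 := by positivity
  rw [cycleField, div_eq_one_iff_eq this.ne']
  ring

theorem cycleGap_symm (β a b c : ℝ) : cycleGap β β 1 a b c =
    (4 * β ^ 2 * (1 + β ^ 2) * (c - b) - a * (1 - β ^ 2) * (1 + 3 * β ^ 2)) /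
      ((1 + β ^ 2) ^ 2 + (2 * β) ^ 2) := by
  have h1 : (β + 1 * β) ^ 2 + 1 * (1 + 1 * β ^ 2) ^ 2 = (1 + β ^ 2) ^ 2 + (2 * β) ^ 2 := by ring
  have h2 : (β ^ 2 + 1) ^ 2 + 1 * (β + 1 * β) ^ 2 = (1 + β ^ 2) ^ 2 + (2 * β) ^ 2 := by ring
  rw [cycleGap, h1, h2, ← sub_div]
  congr 1
  ring

/-- In the symmetric case there are gadgets with field `1` and with distinct gaps. -/
theorem TwoSpin.exists_gap_ne {S : TwoSpin} (hβγ : S.β = S.γ) (hlam : S.lam = 1)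
    (hbase : S.base = (0, cycleGap S.β S.γ S.lam S.a S.b S.c)) (hsym : ¬ (S.a = 0 ∧ S.b = S.c)) :
    ∃ t₁ t₂, (S.val t₁).1 = (S.val t₂).1 ∧ (S.val t₁).2 ≠ (S.val t₂).2 := by
  have hβ0 : 0 < S.β := by
    refine lt_of_le_of_ne S.β_nonneg fun h => ?_
    rcases S.ne_zero with h' | h'
    · exact h' h.symm
    · exact h' (hβγ ▸ h.symm)
  have hβ1 : S.β < 1 := by
    have := S.mul_lt_one
    rw [← hβγ] at this
    nlinarith
  have hphi : S.phi 0 = 0 := phi_eq_zero_iff.2 (by rw [hlam, ← hβγ, one_mul])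
  have hstep : ∀ o, S.step (0, o) = (0, (-((1 - S.β) * (o + S.a)) + (S.c - S.b) * S.β) / (1 + S.β)) := by
    intro o
    have h1 : S.act 0 = 1 := by rw [act, hlam, Real.exp_zero, one_mul]
    refine Prod.ext hphi ?_
    simp only [step, dphi, eps, h1, ← hβγ]
    have : S.β + 1 ≠ 0 := by positivity
    field_simp
    ring
  set O := cycleGap S.β S.γ S.lam S.a S.b S.c with hO
  set F : ℝ → ℝ := fun o => (-((1 - S.β) * (o + S.a)) + (S.c - S.b) * S.β) / (1 + S.β) with hF
  have v1 : S.val .leaf = (0, F O) := by rw [val_leaf, hbase, hstep]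
  have v2 : S.val (.un .leaf) = (0, F (F O)) := by rw [val_un, v1, hstep]
  have v3 : S.val (.bin .leaf .leaf) = (0, F (F O + F O)) := by
    rw [val_bin, v1, Prod.mk_add_mk, add_zero, hstep]
  have hinj : Function.Injective F := by
    intro x y hxy
    have h1 : 1 + S.β ≠ 0 := by positivity
    rw [hF] at hxy
    simp only [div_left_inj' h1] at hxy
    have h2 : (1 - S.β) * (x - y) = 0 := by linarith
    have := (mul_eq_zero.1 h2).resolve_left (by linarith)
    linarith
  by_contra! hcon
  have e1 := hcon .leaf (.un .leaf) (by rw [v1, v2])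
  have e2 := hcon (.un .leaf) (.bin .leaf .leaf) (by rw [v2, v3])
  rw [v1, v2] at e1
  rw [v2, v3] at e2
  have z1 : F O = 0 := by
    have := hinj e2
    linarith
  have z2 : O = 0 := by
    have := hinj e1
    rw [this, z1]
  have z3 : S.a * (1 - S.β) = (S.c - S.b) * S.β := by
    rw [z2, hF] at z1
    have h1 : 1 + S.β ≠ 0 := by positivity
    simp only [div_eq_zero_iff, h1, or_false] at z1
    linarith
  rw [hO, ← hβγ, hlam, cycleGap_symm, div_eq_zero_iff,
    or_iff_left (by positivity : (1 + S.β ^ 2) ^ 2 + (2 * S.β) ^ 2 ≠ 0)] at z2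
  have z4 : (S.c - S.b) * (S.β * (1 - S.β) ^ 3) = 0 := by
    linear_combination -z2 - (1 + S.β) * (1 + 3 * S.β ^ 2) * z3
  have z5 : S.c - S.b = 0 :=
    (mul_eq_zero.1 z4).resolve_right (mul_pos hβ0 (pow_pos (by linarith) 3)).ne'
  rw [z5, zero_mul] at z3
  exact hsym ⟨(mul_eq_zero.1 z3).resolve_right (by linarith), by linarith⟩

end

theorem theorem11 (β γ lam a b c : ℝ)
    (hanti : Antiferromagnetic β γ) (hlam : 0 < lam)
    (hnontriv : ¬ TrivialOnGeneralGraphs β γ lam a b c)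
    (hsym : ¬ (β = γ ∧ lam = 1 ∧ a = 0 ∧ b = c)) :
    ∃ Rhat Ohat Xi : ℝ, 0 < Rhat ∧ 0 < Ohat ∧ 0 < Xi ∧
      ∃ (alg : RamProg 3) (time : Polynomial ℕ) (C : ℝ),
        ∀ name : Fin 3 → ℕ → ℤ, IsName ![β, γ, lam] name →
        ∀ r : ℚ, 0 < r → r < 1 / 2 →
          ∃ (T₁ T₂ : RootedGraph) (L₁ L₂ : List ℤ),
            RamOutputs name alg r (L₁ ++ L₂) (time.eval (ratBits r)) ∧
            IsListing L₁ T₁ ∧ IsListing L₂ T₂ ∧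
            (∀ T ∈ ({T₁, T₂} : Set RootedGraph),
              IsFieldGadget β γ lam T ∧
              (∀ v, (T.graph.neighborSet v).ncard ≤ 3) ∧
              (T.n : ℝ) ≤ C * |Real.log r| ∧
              |effectiveField β γ lam T.graph T.root - Rhat| ≤ r ∧
              |observableGap β γ lam a b c T.graph T.root| ≤ Xi) ∧
            Ohat ≤ |observableGap β γ lam a b c T₁.graph T₁.root -
              observableGap β γ lam a b c T₂.graph T₂.root| := by
  obtain ⟨h1, h2, h3, h4⟩ := hanti
  let S : ℝ × ℝ → TwoSpin := fun p => ⟨β, γ, lam, a, b, c, p, h1, h2, h3, h4, hlam⟩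
  have hnt : ∀ p, ¬ (S p).IsTrivial := by
    rintro p ⟨ha, hb, hc⟩
    refine hnontriv ?_
    change β = 0 ∨ b = 0 at hb
    change γ = 0 ∨ c = 0 at hc
    change a = 0 at ha
    unfold TrivialOnGeneralGraphs
    tauto
  by_cases hcase : lam * (1 - γ) = 1 - β
  · have hbase : (S (Real.log (cycleField β γ lam), cycleGap β γ lam a b c)).IsBase
        NumberedGraph.fourCycle := by
      have := hasField_fourCycle β γ a b c hlam
      rw [← Real.exp_log (cycleField_pos β γ hlam)] at this
      exact this
    refine TwoSpin.HasAlgorithm.fieldGadgets ?_ hbase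
      (by rw [NumberedGraph.deg_fourCycle]) (fun v => by rw [NumberedGraph.deg_fourCycle]; norm_num)
      (Gad.isFieldGadget_fourCycle hcase)
    by_cases hl : lam = 1
    · have hβγ : β = γ := by
        rw [hl] at hcase
        linarith
      obtain ⟨t₁, t₂, e1, e2⟩ := TwoSpin.exists_gap_ne
        (S := S (Real.log (cycleField β γ lam), cycleGap β γ lam a b c)) hβγ hl
        (by simp [S, ← hβγ, hl, cycleField_symm]) fun h => hsym ⟨hβγ, hl, h⟩
      exact TwoSpin.hasAlgorithm_of_fst_eq e1 e2 _
    · refine TwoSpin.hasAlgorithm_of_phi_ne (hnt _) ?_ ?_ _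
      · change TwoSpin.Computable _ (Real.exp (Real.log (cycleField β γ lam)))
        rw [Real.exp_log (cycleField_pos β γ hlam)]
        exact TwoSpin.computable_cycleField
      · intro hfix
        have hz := TwoSpin.phi_eq_zero_iff
          (S := S (Real.log (cycleField β γ lam), cycleGap β γ lam a b c)) |>.2 hcase
        have hanti := TwoSpin.phi_strictAnti
          (S := S (Real.log (cycleField β γ lam), cycleGap β γ lam a b c))
        have hne : Real.log (cycleField β γ lam) ≠ 0 := by
          refine Real.log_ne_zero_of_pos_of_ne_one (cycleField_pos β γ hlam)
            (cycleField_ne_one hlam hcase h3 hl)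
        change TwoSpin.phi _ (Real.log (cycleField β γ lam)) = Real.log (cycleField β γ lam) at hfix
        rcases lt_or_gt_of_ne hne with h | h
        · have := hanti h
          linarith
        · have := hanti h
          linarith
  · have hbase : (S (0, 0)).IsBase NumberedGraph.vertex := by
      have := hasField_vertex β γ lam a b c
      rw [← Real.exp_zero] at this
      exact this
    refine TwoSpin.HasAlgorithm.fieldGadgets ?_ hbase
      (by rw [NumberedGraph.deg_vertex]; norm_num)
      (fun v => by rw [NumberedGraph.deg_vertex]; norm_num) (Gad.isFieldGadget_vertex hcase)
    refine TwoSpin.hasAlgorithm_of_phi_ne (hnt _) ?_ ?_ _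
    · change TwoSpin.Computable _ (Real.exp 0)
      rw [Real.exp_zero]
      exact .one
    · exact fun h => hcase (TwoSpin.phi_eq_zero_iff.1 h)
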